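/- Let $(M_1^{2m+1},\varphi,\xi,\eta,g_1)$ be a Sasakian space form of constant $\varphi$-sectional curvature $c$. That is, $(\varphi,\xi,\eta,g_1)$ is an almost contact metric structure ($\varphi^2=-\mathrm{id}+\eta\otimes\xi$, $\eta(\xi)=1$, $\eta\circ\varphi=0$, $\eta=g_1(\xi,\cdot)$, $g_1(\varphi X,\varphi Y)=g_1(X,Y)-\eta(X)\eta(Y)$) which is contact, $g_1(X,\varphi Y)=d\eta(X,Y)$, and normal, $N_\varphi+2\,d\eta\otimes\xi=0$, where $d\eta(X,Y)=\tfrac12\big(X\eta(Y)-Y\eta(X)-\eta([X,Y])\big)$ and $N_\varphi$ is the Nijenhuis tensor of $\varphi$; and every plane spanned by $X,\varphi X$ with $0\ne X\perp\xi$ has sectional curvature $c$. Let $(M_2^{2n},J,g_2)$ be a complex space form, i.e. a Kähler manifold with curvature tensor $$R^2(X,Y)Z=k\{g_2(Y,Z)X-g_2(X,Z)Y+g_2(JY,Z)JX-g_2(JX,Z)JY-2g_2(JX,Y)JZ\}$$ for a constant $k$. Let $f:M_1\to(0,\infty)$ be smooth, and let $M_1\times_f M_2$ be the warped product, i.e.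 $M_1\times M_2$ with the metric $g_f=\pi^*g_1+f^2\sigma^*g_2$, where $\pi,\sigma$ are the projections. Let $M^{2(m+n)}$ be a nonempty Riemannian manifold and $\psi:M\to M_1\times_f M_2$ an isometric immersion (a hypersurface) with second fundamental form $B$ and mean curvature vector $H=\frac{1}{2(m+n)}\operatorname{trace}B$. Assume that the vector field $(\xi,0)$ is tangent to $M$, that $H$ is horizontal (tangent to the factor $M_1$), and that $|H|$ is a nonzero constant. Then $\psi$ is proper biharmonic, i.e. not harmonic and with $$\tau_2(\psi)=\operatorname{trace}\nabla^2\tau(\psi)-\operatorname{trace}R^f(d\psi(\cdot),\tau(\psi))d\psi(\cdot)=0,\qquad \tau(\psi)=\operatorname{trace}\nabla d\psi,$$ where $R^f(X,Y)=[\nabla_X,\nabla_Y]-\nabla_{[X,Y]}$ is the curvature tensor of $g_f$, if and only if, at every point of $M$, $$|B|^2H=\frac{c(m+1)+3m-1}{2}\,H-\frac{2n}{f}\,\nabla_H\nabla f,$$ where $\nabla$ is the Levi-Civita connection of $g_f$ and $\nabla f$ is the gradient of $f\circ\pi$. -/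

import Mathlib

open Set Bundle
open scoped Manifold ContDiff

noncomputable section

namespace WarpedBiharmonic

/-! ### Riemannian geometry in coordinates

`E`, `F` are the coordinate spaces of two charts. A metric in coordinates is a map
`G : E → E →L[ℝ] E →L[ℝ] ℝ`, and tangent vectors are identified with their component vectors. -/

section Coordinates

variable {E F : Type*} [NormedAddCommGroup E] [NormedSpace ℝ E]
  [NormedAddCommGroup F] [NormedSpace ℝ F]

/-- The vector `α♯` with `G_x(α♯, w) = α(w)` for all `w`. -/
def sharp (G : E → E →L[ℝ] E →L[ℝ] ℝ) (x : E) : (E →L[ℝ] ℝ) →L[ℝ] E :=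
  (G x).inverse

/-- The covector `w ↦ ½ (∂_u G(v, w) + ∂_v G(u, w) - ∂_w G(u, v))`. -/
def koszul (G : E → E →L[ℝ] E →L[ℝ] ℝ) (x u v : E) : E →L[ℝ] ℝ :=
  (1 / 2 : ℝ) • (fderiv ℝ G x u v + fderiv ℝ G x v u - ((fderiv ℝ G x).flip u).flip v)

/-- The Christoffel symbols `Γ_x(u, v)` of the Levi-Civita connection of `G`. -/
def christoffel (G : E → E →L[ℝ] E →L[ℝ] ℝ) (x u v : E) : E :=
  sharp G x (koszul G x u v)

/-- The covariant derivative at `x`, in the direction `u`, of a vector field `V` along the map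
`ψ : E → F`, for the Levi-Civita connection of the metric `G` of the target. With `ψ = id` this is
the usual covariant derivative `∇_u V` of a vector field. -/
def covDeriv (G : F → F →L[ℝ] F →L[ℝ] ℝ) (ψ V : E → F) (x u : E) : F :=
  fderiv ℝ V x u + christoffel G (ψ x) (fderiv ℝ ψ x u) (V x)

/-- The curvature tensor `R(u, v)w = ∇_u ∇_v w - ∇_v ∇_u w - ∇_{[u, v]} w`, evaluated on constant
coordinate fields (for which the bracket vanishes). -/
def curvature (G : E → E →L[ℝ] E →L[ℝ] ℝ) (x u v w : E) : E :=
  covDeriv G id (fun y => covDeriv G id (fun _ => w) y v) x u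
    - covDeriv G id (fun y => covDeriv G id (fun _ => w) y u) x v

/-- The sectional curvature of the plane spanned by `u` and `v`. -/
def sectionalCurvature (G : E → E →L[ℝ] E →L[ℝ] ℝ) (x u v : E) : ℝ :=
  G x (curvature G x u v v) u / (G x u u * G x v v - G x u v ^ 2)

/-- The gradient of a function. -/
def gradient (G : E → E →L[ℝ] E →L[ℝ] ℝ) (f : E → ℝ) (x : E) : E :=
  sharp G x (fderiv ℝ f x)

/-- The second fundamental form `B(u, v) = (∇dψ)(u, v) = ∇_u(dψ v) - dψ(∇_u v)` of a map `ψ`. For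
an isometric immersion this is the normal-valued form in the Gauss formula. -/
def secondFundamentalForm (g : E → E →L[ℝ] E →L[ℝ] ℝ) (G : F → F →L[ℝ] F →L[ℝ] ℝ) (ψ : E → F)
    (x u v : E) : F :=
  covDeriv G ψ (fun y => fderiv ℝ ψ y v) x u - fderiv ℝ ψ x (christoffel g x u v)

/-- The second covariant derivative `∇_u ∇_v V - ∇_{∇_u v} V` of a vector field `V` along `ψ`. -/
def secondCovDeriv (g : E → E →L[ℝ] E →L[ℝ] ℝ) (G : F → F →L[ℝ] F →L[ℝ] ℝ) (ψ V : E → F)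
    (x u v : E) : F :=
  covDeriv G ψ (fun y => covDeriv G ψ V y v) x u - covDeriv G ψ V x (christoffel g x u v)

/-- `dη(X, Y) = ½ (X η(Y) - Y η(X) - η([X, Y]))`. -/
def extDeriv (η : E → E →L[ℝ] ℝ) (X Y : E → E) (x : E) : ℝ :=
  (1 / 2 : ℝ) * (fderiv ℝ (fun y => η y (Y y)) x (X x) - fderiv ℝ (fun y => η y (X y)) x (Y x)
    - η x (VectorField.lieBracket ℝ X Y x))

/-- The Nijenhuis tensor
`N_φ(X, Y) = [φX, φY] - φ[φX, Y] - φ[X, φY] + φ²[X, Y]`. -/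
def nijenhuis (φ : E → E →L[ℝ] E) (X Y : E → E) (x : E) : E :=
  VectorField.lieBracket ℝ (fun y => φ y (X y)) (fun y => φ y (Y y)) x
    - φ x (VectorField.lieBracket ℝ (fun y => φ y (X y)) Y x)
    - φ x (VectorField.lieBracket ℝ X (fun y => φ y (Y y)) x)
    + φ x (φ x (VectorField.lieBracket ℝ X Y x))

end Coordinates

section Traces

variable {d : ℕ} {F : Type*} [NormedAddCommGroup F] [NormedSpace ℝ F]

/-- The trace `∑_{i,j} g^{ij} b(∂_i, ∂_j)` at `x` of a bilinear map `b` with respect to `g`; this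
is `∑_i b(e_i, e_i)` for every `g_x`-orthonormal basis `e_i`. -/
def metricTrace {W : Type*} [AddCommMonoid W]
    (g : EuclideanSpace ℝ (Fin d) → EuclideanSpace ℝ (Fin d) →L[ℝ] EuclideanSpace ℝ (Fin d) →L[ℝ] ℝ)
    (x : EuclideanSpace ℝ (Fin d))
    (b : EuclideanSpace ℝ (Fin d) → EuclideanSpace ℝ (Fin d) → W) : W :=
  ∑ i : Fin d, b (sharp g x (EuclideanSpace.proj i)) (EuclideanSpace.single i 1)

variable
  (g : EuclideanSpace ℝ (Fin d) → EuclideanSpace ℝ (Fin d) →L[ℝ] EuclideanSpace ℝ (Fin d) →L[ℝ] ℝ)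
  (G : F → F →L[ℝ] F →L[ℝ] ℝ) (ψ : EuclideanSpace ℝ (Fin d) → F) (x : EuclideanSpace ℝ (Fin d))

/-- The tension field `τ(ψ) = trace ∇dψ`. -/
def tension : F :=
  metricTrace g x (secondFundamentalForm g G ψ x)

/-- The bitension field `τ₂(ψ) = trace ∇²τ(ψ) - trace R(dψ(·), τ(ψ)) dψ(·)`. -/
def bitension : F :=
  metricTrace g x (secondCovDeriv g G ψ (tension g G ψ) x)
    - metricTrace g x (fun u v =>
        curvature G (ψ x) (fderiv ℝ ψ x u) (tension g G ψ x) (fderiv ℝ ψ x v))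

/-- The mean curvature vector `H = (1 / d) trace B`. -/
def meanCurvature : F :=
  (1 / (d : ℝ)) • metricTrace g x (secondFundamentalForm g G ψ x)

/-- The squared norm `|B|² = ∑_{i,j} |B(e_i, e_j)|²` of the second fundamental form. -/
def normSqSecondFundamentalForm : ℝ :=
  metricTrace g x (fun u u' => metricTrace g x (fun v v' =>
    G (ψ x) (secondFundamentalForm g G ψ x u v) (secondFundamentalForm g G ψ x u' v')))

end Traces

/-! ### Coordinate representations of objects on manifolds

For a point `p₀`, all representations are in the charts `extChartAt I p₀`. A tensorial notion on a
manifold is imposed in each of these charts, at each point of its domain. -/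

section Charts

variable {E : Type*} [NormedAddCommGroup E] [NormedSpace ℝ E]
  {H : Type*} [TopologicalSpace H] (I : ModelWithCorners ℝ E H)
  {M : Type*} [TopologicalSpace M] [ChartedSpace H M]

/-- The differential of the inverse chart at the coordinate point `x`. -/
def fromCoord (p₀ : M) (x : E) :
    E →L[ℝ] TangentSpace I ((extChartAt I p₀).symm x) :=
  mfderivWithin 𝓘(ℝ, E) I (extChartAt I p₀).symm (range I) x

/-- The differential of the chart at the point with coordinates `x`. -/
def toCoord (p₀ : M) (x : E) :
    TangentSpace I ((extChartAt I p₀).symm x) →L[ℝ] E :=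
  mfderiv I 𝓘(ℝ, E) (extChartAt I p₀) ((extChartAt I p₀).symm x)

/-- A bilinear form on the tangent bundle, in coordinates. -/
def localMetric (g : ∀ p : M, TangentSpace I p →L[ℝ] TangentSpace I p →L[ℝ] ℝ) (p₀ : M) (x : E) :
    E →L[ℝ] E →L[ℝ] ℝ :=
  ((fromCoord I p₀ x).precomp ℝ).comp ((g ((extChartAt I p₀).symm x)).comp (fromCoord I p₀ x))

/-- A vector field in coordinates. -/
def localVec (ξ : ∀ p : M, TangentSpace I p) (p₀ : M) (x : E) : E :=
  toCoord I p₀ x (ξ ((extChartAt I p₀).symm x))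

/-- A one-form in coordinates. -/
def localForm (η : ∀ p : M, TangentSpace I p →L[ℝ] ℝ) (p₀ : M) (x : E) : E →L[ℝ] ℝ :=
  (η ((extChartAt I p₀).symm x)).comp (fromCoord I p₀ x)

/-- A field of endomorphisms of the tangent spaces in coordinates. -/
def localEnd (φ : ∀ p : M, TangentSpace I p →L[ℝ] TangentSpace I p) (p₀ : M) (x : E) :
    E →L[ℝ] E :=
  (toCoord I p₀ x).comp ((φ ((extChartAt I p₀).symm x)).comp (fromCoord I p₀ x))

variable {E' : Type*} [NormedAddCommGroup E'] [NormedSpace ℝ E']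
  {H' : Type*} [TopologicalSpace H'] (I' : ModelWithCorners ℝ E' H')
  {N : Type*} [TopologicalSpace N] [ChartedSpace H' N]

/-- The set of coordinates `x` in the chart at `p₀` of points `p` for which `ψ p` lies in the domain
of the chart at `ψ p₀`. On it `writtenInExtChartAt I I' p₀ ψ` represents `ψ`. -/
def localDomain (ψ : M → N) (p₀ : M) : Set E :=
  (extChartAt I p₀).target ∩ (extChartAt I p₀).symm ⁻¹' (ψ ⁻¹' (extChartAt I' (ψ p₀)).source)

end Charts

/-! ### Sasakian space forms and complex space forms -/

section SpaceForms

variable {d : ℕ} {M : Type*} [TopologicalSpace M] [ChartedSpace (EuclideanSpace ℝ (Fin d)) M]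
  [IsManifold (𝓡 d) ∞ M]

/-- `(φ, ξ, η, g)` is a Sasakian structure: an almost contact metric structure which is contact,
`g(X, φY) = dη(X, Y)`, and normal, `N_φ + 2 dη ⊗ ξ = 0`. Here `dη` carries the factor `½`. -/
structure IsSasakian
    (g : ContMDiffRiemannianMetric (𝓡 d) ∞ (EuclideanSpace ℝ (Fin d))
      (fun p : M => TangentSpace (𝓡 d) p))
    (φ : ∀ p : M, TangentSpace (𝓡 d) p →L[ℝ] TangentSpace (𝓡 d) p)
    (ξ : ∀ p : M, TangentSpace (𝓡 d) p)
    (η : ∀ p : M, TangentSpace (𝓡 d) p →L[ℝ] ℝ) : Prop where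
  smooth_φ : ContMDiff (𝓡 d)
    ((𝓡 d).prod 𝓘(ℝ, EuclideanSpace ℝ (Fin d) →L[ℝ] EuclideanSpace ℝ (Fin d))) ∞
    (fun p => TotalSpace.mk' (EuclideanSpace ℝ (Fin d) →L[ℝ] EuclideanSpace ℝ (Fin d)) p (φ p))
  smooth_ξ : ContMDiff (𝓡 d) ((𝓡 d).prod 𝓘(ℝ, EuclideanSpace ℝ (Fin d))) ∞
    (fun p => TotalSpace.mk' (EuclideanSpace ℝ (Fin d)) p (ξ p))
  smooth_η : ContMDiff (𝓡 d) ((𝓡 d).prod 𝓘(ℝ, EuclideanSpace ℝ (Fin d) →L[ℝ] ℝ)) ∞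
    (fun p => TotalSpace.mk' (EuclideanSpace ℝ (Fin d) →L[ℝ] ℝ) p (η p))
  φ_sq : ∀ p (u : TangentSpace (𝓡 d) p), φ p (φ p u) = -u + η p u • ξ p
  η_ξ : ∀ p, η p (ξ p) = 1
  η_φ : ∀ p (u : TangentSpace (𝓡 d) p), η p (φ p u) = 0
  η_eq : ∀ p (u : TangentSpace (𝓡 d) p), η p u = g.inner p (ξ p) u
  compatible : ∀ p (u v : TangentSpace (𝓡 d) p),
    g.inner p (φ p u) (φ p v) = g.inner p u v - η p u * η p v
  contact : ∀ (p₀ : M), ∀ x ∈ (extChartAt (𝓡 d) p₀).target,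
    ∀ X Y : EuclideanSpace ℝ (Fin d) → EuclideanSpace ℝ (Fin d), ContDiff ℝ ∞ X → ContDiff ℝ ∞ Y →
      localMetric (𝓡 d) g.inner p₀ x (X x) (localEnd (𝓡 d) φ p₀ x (Y x))
        = extDeriv (localForm (𝓡 d) η p₀) X Y x
  normal : ∀ (p₀ : M), ∀ x ∈ (extChartAt (𝓡 d) p₀).target,
    ∀ X Y : EuclideanSpace ℝ (Fin d) → EuclideanSpace ℝ (Fin d), ContDiff ℝ ∞ X → ContDiff ℝ ∞ Y →
      nijenhuis (localEnd (𝓡 d) φ p₀) X Y x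
        + (2 * extDeriv (localForm (𝓡 d) η p₀) X Y x) • localVec (𝓡 d) ξ p₀ x = 0

/-- A Sasakian manifold of constant `φ`-sectional curvature `c`: the sectional curvature of the
plane spanned by `u` and `φu` is `c` for every nonzero `u` orthogonal to `ξ`. -/
structure IsSasakianSpaceForm
    (g : ContMDiffRiemannianMetric (𝓡 d) ∞ (EuclideanSpace ℝ (Fin d))
      (fun p : M => TangentSpace (𝓡 d) p))
    (φ : ∀ p : M, TangentSpace (𝓡 d) p →L[ℝ] TangentSpace (𝓡 d) p)
    (ξ : ∀ p : M, TangentSpace (𝓡 d) p)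
    (η : ∀ p : M, TangentSpace (𝓡 d) p →L[ℝ] ℝ) (c : ℝ) : Prop extends
    IsSasakian g φ ξ η where
  φ_sectional : ∀ (p₀ : M), ∀ x ∈ (extChartAt (𝓡 d) p₀).target, ∀ u : EuclideanSpace ℝ (Fin d),
    u ≠ 0 → localForm (𝓡 d) η p₀ x u = 0 →
      sectionalCurvature (localMetric (𝓡 d) g.inner p₀) x u (localEnd (𝓡 d) φ p₀ x u) = c

/-- A complex space form: a Kähler manifold `(g, J)`, with `J² = -1`, `g(Ju, Jv) = g(u, v)` and
`∇J = 0`, whose curvature tensor is that of constant holomorphic sectional curvature `4k`. -/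
structure IsComplexSpaceForm
    (g : ContMDiffRiemannianMetric (𝓡 d) ∞ (EuclideanSpace ℝ (Fin d))
      (fun p : M => TangentSpace (𝓡 d) p))
    (J : ∀ p : M, TangentSpace (𝓡 d) p →L[ℝ] TangentSpace (𝓡 d) p) (k : ℝ) : Prop where
  smooth_J : ContMDiff (𝓡 d)
    ((𝓡 d).prod 𝓘(ℝ, EuclideanSpace ℝ (Fin d) →L[ℝ] EuclideanSpace ℝ (Fin d))) ∞
    (fun p => TotalSpace.mk' (EuclideanSpace ℝ (Fin d) →L[ℝ] EuclideanSpace ℝ (Fin d)) p (J p))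
  J_sq : ∀ p (u : TangentSpace (𝓡 d) p), J p (J p u) = -u
  hermitian : ∀ p (u v : TangentSpace (𝓡 d) p), g.inner p (J p u) (J p v) = g.inner p u v
  parallel : ∀ (p₀ : M), ∀ x ∈ (extChartAt (𝓡 d) p₀).target, ∀ u v : EuclideanSpace ℝ (Fin d),
    covDeriv (localMetric (𝓡 d) g.inner p₀) id (fun y => localEnd (𝓡 d) J p₀ y v) x u
      = localEnd (𝓡 d) J p₀ x (covDeriv (localMetric (𝓡 d) g.inner p₀) id (fun _ => v) x u)
  curvature_eq : ∀ (p₀ : M), ∀ x ∈ (extChartAt (𝓡 d) p₀).target,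
    ∀ u v w : EuclideanSpace ℝ (Fin d),
      curvature (localMetric (𝓡 d) g.inner p₀) x u v w =
        let G := localMetric (𝓡 d) g.inner p₀ x
        let j := localEnd (𝓡 d) J p₀ x
        k • (G v w • u - G u w • v + G (j v) w • j u - G (j u) w • j v - (2 * G (j u) v) • j w)

end SpaceForms

/-! ### Warped products and their hypersurfaces -/

section Warped

variable {E₁ : Type*} [NormedAddCommGroup E₁] [NormedSpace ℝ E₁]
  {H₁ : Type*} [TopologicalSpace H₁] (I₁ : ModelWithCorners ℝ E₁ H₁)
  {M₁ : Type*} [TopologicalSpace M₁] [ChartedSpace H₁ M₁]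
  {E₂ : Type*} [NormedAddCommGroup E₂] [NormedSpace ℝ E₂]
  {H₂ : Type*} [TopologicalSpace H₂] (I₂ : ModelWithCorners ℝ E₂ H₂)
  {M₂ : Type*} [TopologicalSpace M₂] [ChartedSpace H₂ M₂]

/-- The warped product metric `π^* g₁ + f² σ^* g₂` on `M₁ × M₂`. -/
def warpedMetric (g₁ : ∀ p : M₁, TangentSpace I₁ p →L[ℝ] TangentSpace I₁ p →L[ℝ] ℝ)
    (g₂ : ∀ p : M₂, TangentSpace I₂ p →L[ℝ] TangentSpace I₂ p →L[ℝ] ℝ) (f : M₁ → ℝ)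
    (z : M₁ × M₂) :
    TangentSpace (I₁.prod I₂) z →L[ℝ] TangentSpace (I₁.prod I₂) z →L[ℝ] ℝ :=
  let dπ := mfderiv (I₁.prod I₂) I₁ (Prod.fst : M₁ × M₂ → M₁) z
  let dσ := mfderiv (I₁.prod I₂) I₂ (Prod.snd : M₁ × M₂ → M₂) z
  (dπ.precomp ℝ).comp ((g₁ z.1).comp dπ) + (f z.1) ^ 2 • (dσ.precomp ℝ).comp ((g₂ z.2).comp dσ)

end Warped

section Maps

variable {d : ℕ} {M : Type*} [TopologicalSpace M] [ChartedSpace (EuclideanSpace ℝ (Fin d)) M]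
  {E' : Type*} [NormedAddCommGroup E'] [NormedSpace ℝ E']
  {H' : Type*} [TopologicalSpace H'] (I' : ModelWithCorners ℝ E' H')
  {N : Type*} [TopologicalSpace N] [ChartedSpace H' N]
  (g : ∀ p : M, TangentSpace (𝓡 d) p →L[ℝ] TangentSpace (𝓡 d) p →L[ℝ] ℝ)
  (G : ∀ q : N, TangentSpace I' q →L[ℝ] TangentSpace I' q →L[ℝ] ℝ) (ψ : M → N)

/-- `ψ` is a smooth isometric immersion: `ψ^* G = g`. -/
structure IsIsometricImmersion : Prop where
  smooth : ContMDiff (𝓡 d) I' ∞ ψ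
  isometric : ∀ (p : M) (u v : TangentSpace (𝓡 d) p),
    G (ψ p) (mfderiv (𝓡 d) I' ψ p u) (mfderiv (𝓡 d) I' ψ p v) = g p u v

/-- The mean curvature vector of `ψ` at the point with coordinates `x`, in the charts at `p₀` and
`ψ p₀`. -/
def meanCurvatureAt (p₀ : M) (x : EuclideanSpace ℝ (Fin d)) : E' :=
  meanCurvature (localMetric (𝓡 d) g p₀) (localMetric I' G (ψ p₀))
    (writtenInExtChartAt (𝓡 d) I' p₀ ψ) x

/-- `|B|²` at the point with coordinates `x` in the chart at `p₀`. -/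
def normSqBAt (p₀ : M) (x : EuclideanSpace ℝ (Fin d)) : ℝ :=
  normSqSecondFundamentalForm (localMetric (𝓡 d) g p₀) (localMetric I' G (ψ p₀))
    (writtenInExtChartAt (𝓡 d) I' p₀ ψ) x

/-- The length `|H|` of the mean curvature vector is everywhere equal to `h`. -/
def HasConstantMeanCurvature (h : ℝ) : Prop :=
  ∀ p₀, ∀ x ∈ localDomain (𝓡 d) I' ψ p₀,
    √(localMetric I' G (ψ p₀) (writtenInExtChartAt (𝓡 d) I' p₀ ψ x)
      (meanCurvatureAt I' g G ψ p₀ x) (meanCurvatureAt I' g G ψ p₀ x)) = h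

/-- `ψ` is harmonic: its tension field vanishes. -/
def IsHarmonic : Prop :=
  ∀ p₀, ∀ x ∈ localDomain (𝓡 d) I' ψ p₀,
    tension (localMetric (𝓡 d) g p₀) (localMetric I' G (ψ p₀))
      (writtenInExtChartAt (𝓡 d) I' p₀ ψ) x = 0

/-- `ψ` is biharmonic: its bitension field vanishes. -/
def IsBiharmonic : Prop :=
  ∀ p₀, ∀ x ∈ localDomain (𝓡 d) I' ψ p₀,
    bitension (localMetric (𝓡 d) g p₀) (localMetric I' G (ψ p₀))
      (writtenInExtChartAt (𝓡 d) I' p₀ ψ) x = 0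

/-- `ψ` is proper biharmonic: biharmonic and not harmonic. -/
def IsProperBiharmonic : Prop :=
  IsBiharmonic I' g G ψ ∧ ¬ IsHarmonic I' g G ψ

/-- `∇_H ∇f` at the point with coordinates `x`, where `f` is a function on the target, `∇f` is its
gradient and `H` is the mean curvature vector of `ψ`. -/
def covDerivGradAlongH (f : N → ℝ) (p₀ : M) (x : EuclideanSpace ℝ (Fin d)) : E' :=
  covDeriv (localMetric I' G (ψ p₀)) id
    (gradient (localMetric I' G (ψ p₀)) (fun y => f ((extChartAt I' (ψ p₀)).symm y)))
    (writtenInExtChartAt (𝓡 d) I' p₀ ψ x) (meanCurvatureAt I' g G ψ p₀ x)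

end Maps

section Hypersurface

variable {d d₁ d₂ : ℕ}
  {M : Type*} [TopologicalSpace M] [ChartedSpace (EuclideanSpace ℝ (Fin d)) M]
  {M₁ : Type*} [TopologicalSpace M₁] [ChartedSpace (EuclideanSpace ℝ (Fin d₁)) M₁]
  {M₂ : Type*} [TopologicalSpace M₂] [ChartedSpace (EuclideanSpace ℝ (Fin d₂)) M₂]

/-- The mean curvature vector is horizontal, i.e. tangent to the factor `M₁`: its component in the
factor `M₂` vanishes (the charts of `M₁ × M₂` are products of charts). -/
def HasHorizontalMeanCurvature
    (g : ∀ p : M, TangentSpace (𝓡 d) p →L[ℝ] TangentSpace (𝓡 d) p →L[ℝ] ℝ)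
    (G : ∀ z : M₁ × M₂, TangentSpace ((𝓡 d₁).prod (𝓡 d₂)) z →L[ℝ]
      TangentSpace ((𝓡 d₁).prod (𝓡 d₂)) z →L[ℝ] ℝ) (ψ : M → M₁ × M₂) : Prop :=
  ∀ p₀, ∀ x ∈ localDomain (𝓡 d) ((𝓡 d₁).prod (𝓡 d₂)) ψ p₀,
    (meanCurvatureAt ((𝓡 d₁).prod (𝓡 d₂)) g G ψ p₀ x).2 = 0

/-- The horizontal lift `(ξ, 0)` of the vector field `ξ` on `M₁` is tangent to the hypersurface. -/
def IsTangentTo (ξ : ∀ p : M₁, TangentSpace (𝓡 d₁) p) (ψ : M → M₁ × M₂) : Prop :=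
  ∀ p : M, ∃ u : TangentSpace (𝓡 d) p,
    mfderiv ((𝓡 d₁).prod (𝓡 d₂)) (𝓡 d₁) (Prod.fst : M₁ × M₂ → M₁) (ψ p)
        (mfderiv (𝓡 d) ((𝓡 d₁).prod (𝓡 d₂)) ψ p u) = ξ (ψ p).1 ∧
      mfderiv ((𝓡 d₁).prod (𝓡 d₂)) (𝓡 d₂) (Prod.snd : M₁ × M₂ → M₂) (ψ p)
        (mfderiv (𝓡 d) ((𝓡 d₁).prod (𝓡 d₂)) ψ p u) = 0

end Hypersurface

end WarpedBiharmonic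

end

noncomputable section

namespace WarpedBiharmonic

set_option maxSynthPendingDepth 3

section Calculus

variable {E F F' W : Type*} [NormedAddCommGroup E] [NormedSpace ℝ E]
  [NormedAddCommGroup F] [NormedSpace ℝ F] [NormedAddCommGroup F'] [NormedSpace ℝ F']
  [NormedAddCommGroup W] [NormedSpace ℝ W]

lemma fderiv_clm_apply' {A : E → F →L[ℝ] W} {a : E → F} {x : E} (u : E)
    (hA : DifferentiableAt ℝ A x) (ha : DifferentiableAt ℝ a x) :
    fderiv ℝ (fun y => A y (a y)) x u = fderiv ℝ A x u (a x) + A x (fderiv ℝ a x u) := by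
  rw [fderiv_clm_apply hA ha]
  simp [add_comm]

lemma fderiv_clm_apply₂ {A : E → F →L[ℝ] F' →L[ℝ] W} {a : E → F} {b : E → F'} {x : E} (u : E)
    (hA : DifferentiableAt ℝ A x) (ha : DifferentiableAt ℝ a x) (hb : DifferentiableAt ℝ b x) :
    fderiv ℝ (fun y => A y (a y) (b y)) x u =
      fderiv ℝ A x u (a x) (b x) + A x (fderiv ℝ a x u) (b x) + A x (a x) (fderiv ℝ b x u) := by
  rw [fderiv_clm_apply' u (hA.clm_apply ha) hb, fderiv_clm_apply' u hA ha]
  simp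

lemma fderiv_fderiv_apply {f : E → F} {x : E} (hf : ContDiffAt ℝ ∞ f x) (u v : E) :
    fderiv ℝ (fun y => fderiv ℝ f y v) x u = fderiv ℝ (fderiv ℝ f) x u v := by
  have h : ContDiffAt ℝ ∞ (fderiv ℝ f) x := hf.fderiv_right (by simp)
  rw [fderiv_clm_apply' u (h.differentiableAt (by simp)) (differentiableAt_const v)]
  simp

lemma fderiv_fderiv_symm {f : E → F} {x : E} (hf : ContDiffAt ℝ ∞ f x) (u v : E) :
    fderiv ℝ (fderiv ℝ f) x u v = fderiv ℝ (fderiv ℝ f) x v u :=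
  hf.isSymmSndFDerivAt (by simp only [minSmoothness_of_isRCLikeNormedField]; exact WithTop.coe_le_coe.2 (le_top : (2 : ℕ∞) ≤ ⊤)) u v

lemma _root_.ContDiffAt.fderiv_top {f : E → F} {x : E} (hf : ContDiffAt ℝ ∞ f x) :
    ContDiffAt ℝ ∞ (fderiv ℝ f) x :=
  hf.fderiv_right (by simp)

lemma _root_.ContDiffAt.diff {f : E → F} {x : E} (hf : ContDiffAt ℝ ∞ f x) :
    DifferentiableAt ℝ f x :=
  hf.differentiableAt (by simp)

end Calculus

section Metric

variable {E F : Type*} [NormedAddCommGroup E] [NormedSpace ℝ E]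
  [NormedAddCommGroup F] [NormedSpace ℝ F]

/-- `G` is a smooth Riemannian metric, in coordinates, on the open set `V`. -/
structure IsMetricOn (G : F → F →L[ℝ] F →L[ℝ] ℝ) (V : Set F) : Prop where
  isOpen : IsOpen V
  smooth : ∀ x ∈ V, ContDiffAt ℝ ∞ G x
  symm : ∀ x ∈ V, ∀ u v, G x u v = G x v u
  pos : ∀ x ∈ V, ∀ u, u ≠ 0 → 0 < G x u u

/-- The map `(u, v) ↦ koszul G x u v` as a continuous bilinear map. -/
def koszulL (G : F → F →L[ℝ] F →L[ℝ] ℝ) (x : F) : F →L[ℝ] F →L[ℝ] F →L[ℝ] ℝ :=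
  (1 / 2 : ℝ) • (fderiv ℝ G x + (fderiv ℝ G x).flip
    - ((ContinuousLinearMap.flipₗᵢ ℝ F F ℝ).toContinuousLinearEquiv :
        (F →L[ℝ] F →L[ℝ] ℝ) →L[ℝ] (F →L[ℝ] F →L[ℝ] ℝ)).comp (fderiv ℝ G x).flip)

lemma koszulL_apply (G : F → F →L[ℝ] F →L[ℝ] ℝ) (x u v : F) :
    koszulL G x u v = koszul G x u v := by
  ext w
  simp [koszulL, koszul]

/-- The Christoffel symbols as a continuous bilinear map. -/
def christoffelL (G : F → F →L[ℝ] F →L[ℝ] ℝ) (x : F) : F →L[ℝ] F →L[ℝ] F :=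
  (ContinuousLinearMap.compL ℝ F (F →L[ℝ] ℝ) F (sharp G x)).comp (koszulL G x)

lemma christoffelL_apply (G : F → F →L[ℝ] F →L[ℝ] ℝ) (x u v : F) :
    christoffelL G x u v = christoffel G x u v := by
  simp [christoffelL, christoffel, koszulL_apply]

lemma christoffel_add_left (G : F → F →L[ℝ] F →L[ℝ] ℝ) (x u u' v : F) :
    christoffel G x (u + u') v = christoffel G x u v + christoffel G x u' v := by
  simp [← christoffelL_apply]

lemma christoffel_smul_left (G : F → F →L[ℝ] F →L[ℝ] ℝ) (x u v : F) (c : ℝ) :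
    christoffel G x (c • u) v = c • christoffel G x u v := by
  simp [← christoffelL_apply]

lemma christoffel_smul_right (G : F → F →L[ℝ] F →L[ℝ] ℝ) (x u v : F) (c : ℝ) :
    christoffel G x u (c • v) = c • christoffel G x u v := by
  simp [← christoffelL_apply]

lemma covDeriv_add_left (G : F → F →L[ℝ] F →L[ℝ] ℝ) (ψ V : E → F) (x u u' : E) :
    covDeriv G ψ V x (u + u') = covDeriv G ψ V x u + covDeriv G ψ V x u' := by
  simp only [covDeriv, map_add, christoffel_add_left]; abel

lemma covDeriv_smul_left (G : F → F →L[ℝ] F →L[ℝ] ℝ) (ψ V : E → F) (x u : E) (c : ℝ) :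
    covDeriv G ψ V x (c • u) = c • covDeriv G ψ V x u := by
  simp only [covDeriv, map_smul, christoffel_smul_left, smul_add]

namespace IsMetricOn

variable {G : F → F →L[ℝ] F →L[ℝ] ℝ} {V : Set F} (hG : IsMetricOn G V) {x : F} (hx : x ∈ V)

include hG hx

lemma fderiv_symm (u v w : F) : fderiv ℝ G x u v w = fderiv ℝ G x u w v := by
  have hd := (hG.smooth x hx).diff
  have h1 : fderiv ℝ (fun y => G y v w) x u = fderiv ℝ G x u v w := by
    rw [fderiv_clm_apply₂ u hd (differentiableAt_const v) (differentiableAt_const w)]; simp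
  have h2 : fderiv ℝ (fun y => G y w v) x u = fderiv ℝ G x u w v := by
    rw [fderiv_clm_apply₂ u hd (differentiableAt_const w) (differentiableAt_const v)]; simp
  rw [← h1, ← h2]
  congr 1
  apply Filter.EventuallyEq.fderiv_eq
  filter_upwards [hG.isOpen.mem_nhds hx] with y hy using hG.symm y hy v w

lemma christoffel_symm (u v : F) : christoffel G x u v = christoffel G x v u := by
  unfold christoffel
  congr 1
  ext w
  simp only [koszul, _root_.smul_apply, _root_.sub_apply,
    _root_.add_apply, ContinuousLinearMap.flip_apply, smul_eq_mul]
  rw [hG.fderiv_symm hx w u v]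
  ring

lemma eq_of_forall_inner {u v : F} (h : ∀ w, G x u w = G x v w) : u = v := by
  by_contra hne
  have h1 := hG.pos x hx (u - v) (sub_ne_zero.mpr hne)
  have h2 := h (u - v)
  simp only [map_sub, _root_.sub_apply] at h1 h2
  linarith

lemma eq_zero_of_self {u : F} (h : G x u u = 0) : u = 0 := by
  by_contra hne
  exact absurd h (hG.pos x hx u hne).ne'

variable [FiniteDimensional ℝ F]

lemma isInvertible : (G x).IsInvertible := by
  have hinj : Function.Injective (G x : F →ₗ[ℝ] F →L[ℝ] ℝ) := fun u v huv =>
    hG.eq_of_forall_inner hx fun w => by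
      have : G x u = G x v := huv
      rw [this]
  have hrank : Module.finrank ℝ F = Module.finrank ℝ (F →L[ℝ] ℝ) := by
    rw [LinearEquiv.finrank_eq (LinearMap.toContinuousLinearMap (𝕜 := ℝ) (E := F) (F' := ℝ)).symm]
    exact (Subspace.dual_finrank_eq).symm
  refine ⟨(LinearEquiv.ofInjectiveOfFinrankEq (G x : F →ₗ[ℝ] F →L[ℝ] ℝ) hinj
    hrank).toContinuousLinearEquiv, ?_⟩
  ext u v
  rfl

lemma inner_sharp (α : F →L[ℝ] ℝ) (w : F) : G x (sharp G x α) w = α w := by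
  rw [sharp, (hG.isInvertible hx).self_apply_inverse]

lemma contDiffAt_sharp : ContDiffAt ℝ ∞ (sharp G) x :=
  ((hG.isInvertible hx).contDiffAt_map_inverse).comp x (hG.smooth x hx)

set_option synthInstance.maxHeartbeats 100000 in
omit [FiniteDimensional ℝ F] in
lemma contDiffAt_koszulL : ContDiffAt ℝ ∞ (koszulL G) x := by
  have h := (hG.smooth x hx).fderiv_top
  have hflip : ContDiffAt ℝ ∞ (fun y => (fderiv ℝ G y).flip) x :=
    (ContinuousLinearMap.flipₗᵢ ℝ F F (F →L[ℝ] ℝ)).contDiff.contDiffAt.comp x h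
  have hcomp : ContDiffAt ℝ ∞ (fun y => ((ContinuousLinearMap.flipₗᵢ ℝ F F
      ℝ).toContinuousLinearEquiv : (F →L[ℝ] F →L[ℝ] ℝ) →L[ℝ] (F →L[ℝ] F →L[ℝ] ℝ)).comp
        (fderiv ℝ G y).flip) x :=
    contDiffAt_const.clm_comp hflip
  exact ((h.add hflip).sub hcomp).const_smul _

lemma contDiffAt_christoffelL : ContDiffAt ℝ ∞ (christoffelL G) x :=
  ((ContinuousLinearMap.contDiff _).contDiffAt.comp x (hG.contDiffAt_sharp hx)).clm_comp
    (hG.contDiffAt_koszulL hx)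

lemma inner_christoffel (u v w : F) : G x (christoffel G x u v) w = koszul G x u v w :=
  hG.inner_sharp hx _ w

lemma fderiv_inner (u v w : F) :
    fderiv ℝ G x u v w = G x (christoffel G x u v) w + G x v (christoffel G x u w) := by
  rw [hG.symm x hx v, hG.inner_christoffel hx, hG.inner_christoffel hx]
  simp only [koszul, _root_.smul_apply, _root_.sub_apply,
    _root_.add_apply, ContinuousLinearMap.flip_apply, smul_eq_mul]
  rw [hG.fderiv_symm hx u w v]
  ring

end IsMetricOn

end Metric

section AlongMap

variable {E F : Type*} [NormedAddCommGroup E] [NormedSpace ℝ E]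
  [NormedAddCommGroup F] [NormedSpace ℝ F]
  {G : F → F →L[ℝ] F →L[ℝ] ℝ} {V : Set F} {ψ X Y : E → F} {x : E}

lemma covDeriv_eq (G : F → F →L[ℝ] F →L[ℝ] ℝ) (ψ X : E → F) (x u : E) :
    covDeriv G ψ X x u = fderiv ℝ X x u + christoffelL G (ψ x) (fderiv ℝ ψ x u) (X x) := by
  rw [christoffelL_apply]; rfl

lemma covDeriv_congr {X' : E → F} (h : X =ᶠ[nhds x] X') (u : E) :
    covDeriv G ψ X x u = covDeriv G ψ X' x u := by
  simp only [covDeriv, h.fderiv_eq, h.eq_of_nhds]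

lemma covDeriv_add (hX : DifferentiableAt ℝ X x) (hY : DifferentiableAt ℝ Y x) (u : E) :
    covDeriv G ψ (fun y => X y + Y y) x u = covDeriv G ψ X x u + covDeriv G ψ Y x u := by
  simp only [covDeriv_eq, fderiv_fun_add hX hY, _root_.add_apply, map_add]
  abel

lemma covDeriv_sub (hX : DifferentiableAt ℝ X x) (hY : DifferentiableAt ℝ Y x) (u : E) :
    covDeriv G ψ (fun y => X y - Y y) x u = covDeriv G ψ X x u - covDeriv G ψ Y x u := by
  simp only [covDeriv_eq, fderiv_fun_sub hX hY, _root_.sub_apply, map_sub]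
  abel

lemma covDeriv_neg (u : E) :
    covDeriv G ψ (fun y => -X y) x u = -covDeriv G ψ X x u := by
  simp only [covDeriv_eq, fderiv_fun_neg, _root_.neg_apply, map_neg]
  abel

lemma covDeriv_smul {a : E → ℝ} (ha : DifferentiableAt ℝ a x) (hX : DifferentiableAt ℝ X x)
    (u : E) : covDeriv G ψ (fun y => a y • X y) x u
      = fderiv ℝ a x u • X x + a x • covDeriv G ψ X x u := by
  simp only [covDeriv_eq, fderiv_fun_smul ha hX, _root_.add_apply,
    _root_.smul_apply, ContinuousLinearMap.smulRight_apply, map_smul, smul_add]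
  abel

lemma covDeriv_const_smul (a : ℝ) (hX : DifferentiableAt ℝ X x)
    (u : E) : covDeriv G ψ (fun y => a • X y) x u = a • covDeriv G ψ X x u := by
  rw [covDeriv_smul (differentiableAt_const a) hX]; simp

variable [FiniteDimensional ℝ F]

lemma IsMetricOn.contDiffAt_covDeriv (hG : IsMetricOn G V) (hx : ψ x ∈ V)
    (hψ : ContDiffAt ℝ ∞ ψ x) (hX : ContDiffAt ℝ ∞ X x) {u : E → E} (hu : ContDiffAt ℝ ∞ u x) :
    ContDiffAt ℝ ∞ (fun y => covDeriv G ψ X y (u y)) x := by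
  simp only [covDeriv_eq]
  exact (hX.fderiv_top.clm_apply hu).add
    ((((hG.contDiffAt_christoffelL hx).comp x hψ).clm_apply (hψ.fderiv_top.clm_apply hu)).clm_apply
      hX)

/-- Metric compatibility of the Levi-Civita connection, for fields along a map. -/
lemma IsMetricOn.fderiv_inner_along (hG : IsMetricOn G V) (hx : ψ x ∈ V)
    (hψ : DifferentiableAt ℝ ψ x) (hX : DifferentiableAt ℝ X x) (hY : DifferentiableAt ℝ Y x)
    (u : E) : fderiv ℝ (fun y => G (ψ y) (X y) (Y y)) x u
      = G (ψ x) (covDeriv G ψ X x u) (Y x) + G (ψ x) (X x) (covDeriv G ψ Y x u) := by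
  have hd := (hG.smooth _ hx).diff
  rw [fderiv_clm_apply₂ (A := fun y => G (ψ y)) u (hd.comp x hψ) hX hY,
    show (fun y => G (ψ y)) = G ∘ ψ from rfl, fderiv_comp x hd hψ]
  simp only [ContinuousLinearMap.comp_apply, covDeriv, map_add,
    _root_.add_apply, hG.fderiv_inner hx]
  ring

omit [FiniteDimensional ℝ F] in
lemma IsMetricOn.covDeriv_fderiv_symm (hG : IsMetricOn G V) (hx : ψ x ∈ V)
    (hψ : ContDiffAt ℝ ∞ ψ x) (u v : E) :
    covDeriv G ψ (fun y => fderiv ℝ ψ y v) x u = covDeriv G ψ (fun y => fderiv ℝ ψ y u) x v := by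
  simp only [covDeriv, fderiv_fderiv_apply hψ]
  rw [fderiv_fderiv_symm hψ, hG.christoffel_symm hx]

lemma IsMetricOn.covDeriv_covDeriv (hG : IsMetricOn G V) (hx : ψ x ∈ V)
    (hψ : ContDiffAt ℝ ∞ ψ x) (hX : ContDiffAt ℝ ∞ X x) (u v : E) :
    covDeriv G ψ (fun y => covDeriv G ψ X y v) x u
      = fderiv ℝ (fderiv ℝ X) x u v
        + fderiv ℝ (christoffelL G) (ψ x) (fderiv ℝ ψ x u) (fderiv ℝ ψ x v) (X x)
        + christoffelL G (ψ x) (fderiv ℝ (fderiv ℝ ψ) x u v) (X x)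
        + christoffelL G (ψ x) (fderiv ℝ ψ x v) (fderiv ℝ X x u)
        + christoffelL G (ψ x) (fderiv ℝ ψ x u) (fderiv ℝ X x v)
        + christoffelL G (ψ x) (fderiv ℝ ψ x u)
            (christoffelL G (ψ x) (fderiv ℝ ψ x v) (X x)) := by
  have hΓ := (hG.contDiffAt_christoffelL hx).diff
  have hψ' := hψ.fderiv_top.diff.clm_apply (differentiableAt_const v)
  have hX' := hX.fderiv_top.diff.clm_apply (differentiableAt_const v)
  have hc : DifferentiableAt ℝ (fun y => christoffelL G (ψ y)) x := hΓ.comp x hψ.diff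
  simp only [covDeriv_eq]
  rw [fderiv_fun_add hX' ((hc.clm_apply hψ').clm_apply hX.diff), _root_.add_apply,
    fderiv_clm_apply₂ u hc hψ' hX.diff, fderiv_fderiv_apply hX, fderiv_fderiv_apply hψ,
    show (fun y => christoffelL G (ψ y)) = christoffelL G ∘ ψ from rfl, fderiv_comp x hΓ hψ.diff]
  simp only [ContinuousLinearMap.comp_apply, map_add]
  abel

lemma IsMetricOn.curvature_eq (hG : IsMetricOn G V) {x : F} (hx : x ∈ V) (u v w : F) :
    curvature G x u v w = fderiv ℝ (christoffelL G) x u v w - fderiv ℝ (christoffelL G) x v u w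
      + christoffelL G x u (christoffelL G x v w) - christoffelL G x v (christoffelL G x u w) := by
  unfold curvature
  rw [hG.covDeriv_covDeriv (ψ := id) (X := fun _ => w) hx contDiffAt_id contDiffAt_const,
    hG.covDeriv_covDeriv (ψ := id) (X := fun _ => w) hx contDiffAt_id contDiffAt_const]
  have h0 : fderiv ℝ (fun _ : F => w) = fun _ => 0 := by ext; simp
  have h1 : fderiv ℝ (id : F → F) = fun _ => ContinuousLinearMap.id ℝ F := by ext; simp
  simp only [h0, h1, fderiv_fun_const]
  simp
  abel

/-- The curvature tensor measures the failure of second covariant derivatives to commute. -/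
lemma IsMetricOn.covDeriv_commutator (hG : IsMetricOn G V) (hx : ψ x ∈ V)
    (hψ : ContDiffAt ℝ ∞ ψ x) (hX : ContDiffAt ℝ ∞ X x) (u v : E) :
    covDeriv G ψ (fun y => covDeriv G ψ X y v) x u - covDeriv G ψ (fun y => covDeriv G ψ X y u) x v
      = curvature G (ψ x) (fderiv ℝ ψ x u) (fderiv ℝ ψ x v) (X x) := by
  rw [hG.covDeriv_covDeriv hx hψ hX, hG.covDeriv_covDeriv hx hψ hX, hG.curvature_eq hx,
    fderiv_fderiv_symm hψ v u, fderiv_fderiv_symm hX v u]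
  abel

end AlongMap

section CurvatureSymmetries

variable {F : Type*} [NormedAddCommGroup F] [NormedSpace ℝ F] [FiniteDimensional ℝ F]
  {G : F → F →L[ℝ] F →L[ℝ] ℝ} {V : Set F}

namespace IsMetricOn

variable (hG : IsMetricOn G V) {x : F} (hx : x ∈ V)

include hG hx

/-- The curvature tensor as a trilinear map. -/
lemma exists_curvature_trilinear : ∃ R : F →ₗ[ℝ] F →ₗ[ℝ] F →ₗ[ℝ] F,
    ∀ u v w, R u v w = curvature G x u v w := by
  let A : F →ₗ[ℝ] F →ₗ[ℝ] F →ₗ[ℝ] F := LinearMap.mk₂ ℝ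
    (fun u v => ((fderiv ℝ (christoffelL G) x u v - fderiv ℝ (christoffelL G) x v u
      + (christoffelL G x u).comp (christoffelL G x v)
      - (christoffelL G x v).comp (christoffelL G x u) : F →L[ℝ] F) : F →ₗ[ℝ] F))
    (by intros; ext; simp; abel) (by intros; ext; simp [smul_sub, smul_add])
    (by intros; ext; simp; abel) (by intros; ext; simp [smul_sub, smul_add])
  refine ⟨A, fun u v w => ?_⟩
  rw [hG.curvature_eq hx]
  simp [A]

omit [FiniteDimensional ℝ F] hG hx in
lemma curvature_swap (u v w : F) : curvature G x u v w = -curvature G x v u w := by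
  simp [curvature]

lemma curvature_bianchi (u v w : F) :
    curvature G x u v w + curvature G x v w u + curvature G x w u v = 0 := by
  have hs : ∀ a b c, fderiv ℝ (christoffelL G) x a b c = fderiv ℝ (christoffelL G) x a c b := by
    intro a b c
    have hd := (hG.contDiffAt_christoffelL hx).diff
    have h1 : fderiv ℝ (fun y => christoffelL G y b c) x a = fderiv ℝ (christoffelL G) x a b c := by
      rw [fderiv_clm_apply₂ a hd (differentiableAt_const b) (differentiableAt_const c)]; simp
    have h2 : fderiv ℝ (fun y => christoffelL G y c b) x a = fderiv ℝ (christoffelL G) x a c b := by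
      rw [fderiv_clm_apply₂ a hd (differentiableAt_const c) (differentiableAt_const b)]; simp
    rw [← h1, ← h2]
    congr 1
    apply Filter.EventuallyEq.fderiv_eq
    filter_upwards [hG.isOpen.mem_nhds hx] with y hy
    simp only [christoffelL_apply, hG.christoffel_symm hy b c]
  have hc : ∀ b c, christoffelL G x b c = christoffelL G x c b := fun b c => by
    simp only [christoffelL_apply, hG.christoffel_symm hx b c]
  simp only [hG.curvature_eq hx]
  rw [hs u v w, hs v w u, hs w u v, hc v w, hc u w, hc u v]
  abel

lemma curvature_skew (u v w z : F) :
    G x (curvature G x u v w) z = -G x (curvature G x u v z) w := by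
  have key : ∀ w, G x (curvature G x u v w) w = 0 := by
    intro w
    have hc : ∀ v, ∀ y ∈ V, ContDiffAt ℝ ∞ (fun y => covDeriv G id (fun _ => w) y v) y :=
      fun v y hy => hG.contDiffAt_covDeriv (ψ := id) hy contDiffAt_id contDiffAt_const
        contDiffAt_const
    have h1 : ∀ y ∈ V, ∀ u, fderiv ℝ (fun y => G y w w) y u
        = 2 * G y (covDeriv G id (fun _ => w) y u) w := by
      intro y hy u
      have h := hG.fderiv_inner_along (ψ := id) (X := fun _ => w) (Y := fun _ => w) hy
        differentiableAt_id (differentiableAt_const w) (differentiableAt_const w) u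
      simp only [id] at h
      rw [h, hG.symm _ hy w]; ring
    have hsm : ContDiffAt ℝ ∞ (fun y => G y w w) x :=
      ((hG.smooth x hx).clm_apply contDiffAt_const).clm_apply contDiffAt_const
    have h2 : ∀ u v, fderiv ℝ (fderiv ℝ (fun y => G y w w)) x u v
        = 2 * (G x (covDeriv G id (fun y => covDeriv G id (fun _ => w) y v) x u) w
          + G x (covDeriv G id (fun _ => w) x v) (covDeriv G id (fun _ => w) x u)) := by
      intro u v
      rw [← fderiv_fderiv_apply hsm]
      have : (fun y => fderiv ℝ (fun y => G y w w) y v)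
          =ᶠ[nhds x] fun y => 2 * G y (covDeriv G id (fun _ => w) y v) w := by
        filter_upwards [hG.isOpen.mem_nhds hx] with y hy using h1 y hy v
      rw [this.fderiv_eq, fderiv_const_mul]
      · rw [_root_.smul_apply, smul_eq_mul]
        congr 1
        exact hG.fderiv_inner_along (ψ := id) hx differentiableAt_id (hc v x hx).diff
          (differentiableAt_const w) u
      · exact ((hG.smooth x hx).diff.clm_apply (hc v x hx).diff).clm_apply (differentiableAt_const w)
    have h3 := fderiv_fderiv_symm hsm u v
    rw [h2, h2, hG.symm x hx (covDeriv G id (fun _ => w) x v)] at h3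
    simp only [curvature, map_sub, _root_.sub_apply]
    linarith
  obtain ⟨R, hR⟩ := hG.exists_curvature_trilinear hx
  have h1 := key (w + z)
  have h2 := key w
  have h3 := key z
  simp only [← hR, map_add, _root_.add_apply] at *
  linarith

lemma curvature_pair (u v w z : F) :
    G x (curvature G x u v w) z = G x (curvature G x w z u) v := by
  have b : ∀ a b c d, G x (curvature G x a b c) d + G x (curvature G x b c a) d
      + G x (curvature G x c a b) d = 0 := by
    intro a b c d
    have := congrArg (fun t => G x t d) (hG.curvature_bianchi hx a b c)
    simpa using this
  have s : ∀ a b c d, G x (curvature G x a b c) d = - G x (curvature G x b a c) d := by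
    intro a b c d
    rw [curvature_swap]; simp
  have k := fun a b c d => hG.curvature_skew hx a b c d
  linarith [b u v w z, b v w z u, b w z u v, b z u v w, s u v w z, s v w u z, s w u v z,
    k u v w z, k u v z w, k v w z u, k v w u z, k w z u v, k w z v u, k z u v w, k z u w v, k w u v z, k w u z v, k z v w u, k z v u w,
    s v w z u, s w z v u, s z v w u, s w z u v, s z u w v, s u w z v, s z u v w, s u v z w, s v z u w,
    k u w z v, k u w v z, k v z u w, k v z w u]

end IsMetricOn

end CurvatureSymmetries

section OrthonormalBases

variable {F : Type*} [NormedAddCommGroup F] [NormedSpace ℝ F] [FiniteDimensional ℝ F]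

/-- The vectors `e i` are orthonormal for the bilinear form `B`. -/
def IsOrthonormalFor {ι : Type*} [DecidableEq ι] (B : F →L[ℝ] F →L[ℝ] ℝ) (e : ι → F) : Prop :=
  ∀ i j, B (e i) (e j) = if i = j then 1 else 0

lemma IsMetricOn.exists_orthonormal {G : F → F →L[ℝ] F →L[ℝ] ℝ} {V : Set F} (hG : IsMetricOn G V)
    {x : F} (hx : x ∈ V) :
    ∃ e : Module.Basis (Fin (Module.finrank ℝ F)) ℝ F, IsOrthonormalFor (G x) e := by
  let B : LinearMap.BilinForm ℝ F :=
    LinearMap.mk₂ ℝ (fun u v => G x u v) (by simp) (by simp) (by simp) (by simp)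
  have hB : LinearMap.IsSymm B := ⟨fun u v => hG.symm x hx u v⟩
  obtain ⟨v, hv⟩ := LinearMap.BilinForm.exists_orthogonal_basis (B := B) hB
  have hpos : ∀ i, 0 < G x (v i) (v i) := fun i => hG.pos x hx _ (v.ne_zero i)
  have hu : ∀ i, IsUnit ((√(G x (v i) (v i)))⁻¹) := fun i =>
    (isUnit_iff_ne_zero.mpr (inv_ne_zero (Real.sqrt_pos.mpr (hpos i)).ne'))
  refine ⟨v.isUnitSMul hu, fun i j => ?_⟩
  simp only [Module.Basis.isUnitSMul_apply, map_smul, _root_.smul_apply, smul_eq_mul]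
  split_ifs with h
  · subst h
    have := Real.mul_self_sqrt (hpos i).le
    have h0 := (Real.sqrt_pos.mpr (hpos i)).ne'
    field_simp
    nlinarith
  · have : G x (v i) (v j) = 0 := hv h
    simp [this]

variable {ι : Type*} [Fintype ι] [DecidableEq ι] {B : F →L[ℝ] F →L[ℝ] ℝ}
  {e : Module.Basis ι ℝ F} (he : IsOrthonormalFor B e)

include he

omit [FiniteDimensional ℝ F] in
lemma IsOrthonormalFor.repr_eq (u : F) (i : ι) : e.repr u i = B u (e i) := by
  conv_rhs => rw [← e.sum_repr u]
  simp only [map_sum, map_smul, _root_.sum_apply, _root_.smul_apply,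
    he _ i, smul_eq_mul]
  simp

omit [FiniteDimensional ℝ F] in
lemma IsOrthonormalFor.sum_inner_smul (u : F) : ∑ i, B u (e i) • e i = u := by
  simp only [← he.repr_eq, e.sum_repr]

omit [FiniteDimensional ℝ F] in
lemma IsOrthonormalFor.sum_inner_mul_inner (u v : F) :
    ∑ i, B u (e i) * B (e i) v = B u v := by
  conv_rhs => rw [← he.sum_inner_smul u]
  simp

omit [FiniteDimensional ℝ F] in
lemma IsOrthonormalFor.trace_eq (A : F →ₗ[ℝ] F) : LinearMap.trace ℝ F A = ∑ i, B (A (e i)) (e i) := by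
  rw [LinearMap.trace_eq_matrix_trace ℝ e, Matrix.trace]
  simp [LinearMap.toMatrix_apply, he.repr_eq]

end OrthonormalBases

section MetricTrace

variable {d : ℕ} {W : Type*} [AddCommGroup W] [Module ℝ W]

/-- The metric trace is the sum over an orthonormal basis. -/
lemma IsMetricOn.metricTrace_eq_sum {g : EuclideanSpace ℝ (Fin d) → EuclideanSpace ℝ (Fin d) →L[ℝ] EuclideanSpace ℝ (Fin d) →L[ℝ] ℝ} {U : Set (EuclideanSpace ℝ (Fin d))}
    (hg : IsMetricOn g U) {x : EuclideanSpace ℝ (Fin d)} (hx : x ∈ U) {ι : Type*} [Fintype ι] [DecidableEq ι]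
    {e : Module.Basis ι ℝ (EuclideanSpace ℝ (Fin d))} (he : IsOrthonormalFor (g x) e) (b : EuclideanSpace ℝ (Fin d) →ₗ[ℝ] EuclideanSpace ℝ (Fin d) →ₗ[ℝ] W) :
    metricTrace g x (fun u v => b u v) = ∑ j, b (e j) (e j) := by
  have h1 : ∀ i, sharp g x (EuclideanSpace.proj i) = ∑ j, (e j) i • e j := by
    intro i
    rw [← he.sum_inner_smul (sharp g x _)]
    simp [hg.inner_sharp hx]
  have h2 : ∀ u : EuclideanSpace ℝ (Fin d), ∑ i, u i • EuclideanSpace.single i (1 : ℝ) = u := by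
    intro u
    ext k
    simp [Pi.single_apply]
  unfold metricTrace
  simp only [h1, map_sum, map_smul, LinearMap.sum_apply, LinearMap.smul_apply]
  rw [Finset.sum_comm]
  refine Finset.sum_congr rfl fun j _ => ?_
  simp only [← map_smul, ← map_sum, h2]

end MetricTrace

section Ricci

variable {F : Type*} [NormedAddCommGroup F] [NormedSpace ℝ F] [FiniteDimensional ℝ F]
  {G : F → F →L[ℝ] F →L[ℝ] ℝ} {V : Set F}

/-- The Ricci tensor `Ric(v, w) = trace (u ↦ R(u, v)w)`. -/
def ricci (G : F → F →L[ℝ] F →L[ℝ] ℝ) (x v w : F) : ℝ :=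
  ∑ i, (Module.finBasis ℝ F).coord i (curvature G x (Module.finBasis ℝ F i) v w)

lemma ricci_eq_trace {x v w : F} {A : F →ₗ[ℝ] F} (hA : ∀ u, A u = curvature G x u v w) :
    ricci G x v w = LinearMap.trace ℝ F A := by
  rw [LinearMap.trace_eq_matrix_trace ℝ (Module.finBasis ℝ F), Matrix.trace]
  simp [LinearMap.toMatrix_apply, hA, ricci]

namespace IsMetricOn

variable (hG : IsMetricOn G V) {x : F} (hx : x ∈ V)

include hG hx

lemma ricci_eq_sum {ι : Type*} [Fintype ι] [DecidableEq ι] {e : Module.Basis ι ℝ F}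
    (he : IsOrthonormalFor (G x) e) (v w : F) :
    ricci G x v w = ∑ i, G x (curvature G x (e i) v w) (e i) := by
  obtain ⟨R, hR⟩ := hG.exists_curvature_trilinear hx
  rw [ricci_eq_trace (A := (R.flip v).flip w) (fun u => by simp [hR]), he.trace_eq]
  simp [hR]

lemma ricci_symm (v w : F) : ricci G x v w = ricci G x w v := by
  obtain ⟨e, he⟩ := hG.exists_orthonormal hx
  rw [hG.ricci_eq_sum hx he, hG.ricci_eq_sum hx he]
  refine Finset.sum_congr rfl fun i _ => ?_
  rw [hG.curvature_pair hx, hG.curvature_skew hx, IsMetricOn.curvature_swap]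
  simp

lemma ricci_add_left (v v' w : F) : ricci G x (v + v') w = ricci G x v w + ricci G x v' w := by
  obtain ⟨R, hR⟩ := hG.exists_curvature_trilinear hx
  simp only [ricci, ← hR, map_add, LinearMap.add_apply, Finset.sum_add_distrib]

lemma ricci_smul_left (c : ℝ) (v w : F) : ricci G x (c • v) w = c * ricci G x v w := by
  obtain ⟨R, hR⟩ := hG.exists_curvature_trilinear hx
  simp only [ricci, ← hR, map_smul, LinearMap.smul_apply, Finset.mul_sum, smul_eq_mul]

end IsMetricOn

end Ricci

section MetricTraceDeriv

variable {d : ℕ}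

lemma sum_coord_smul_single (u : EuclideanSpace ℝ (Fin d)) : ∑ i, u i • EuclideanSpace.single i (1 : ℝ) = u := by
  ext k
  simp [Pi.single_apply]

/-- Metric traces commute with covariant differentiation. -/
lemma IsMetricOn.fderiv_metricTrace {g : EuclideanSpace ℝ (Fin d) → EuclideanSpace ℝ (Fin d) →L[ℝ] EuclideanSpace ℝ (Fin d) →L[ℝ] ℝ} {U : Set (EuclideanSpace ℝ (Fin d))}
    (hg : IsMetricOn g U) {x : EuclideanSpace ℝ (Fin d)} (hx : x ∈ U) {β : EuclideanSpace ℝ (Fin d) → EuclideanSpace ℝ (Fin d) →L[ℝ] EuclideanSpace ℝ (Fin d) →L[ℝ] ℝ}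
    (hβ : DifferentiableAt ℝ β x) (w : EuclideanSpace ℝ (Fin d)) :
    fderiv ℝ (fun y => metricTrace g y (fun u v => β y u v)) x w
      = metricTrace g x (fun u v => fderiv ℝ β x w u v - β x (christoffel g x w u) v
          - β x u (christoffel g x w v)) := by
  set s : Fin d → EuclideanSpace ℝ (Fin d) → EuclideanSpace ℝ (Fin d) := fun i y => sharp g y (EuclideanSpace.proj i) with hs
  have hsd : ∀ i, DifferentiableAt ℝ (s i) x := fun i =>
    (hg.contDiffAt_sharp hx).diff.clm_apply (differentiableAt_const _)
  have hgs : ∀ i, ∀ y ∈ U, ∀ z, g y (s i y) z = z i := fun i y hy z => by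
    simp [hs, hg.inner_sharp hy]
  have hexp : ∀ u : EuclideanSpace ℝ (Fin d), u = ∑ j, g x u (EuclideanSpace.single j 1) • s j x := fun u => by
    refine hg.eq_of_forall_inner hx fun z => ?_
    simp only [map_sum, map_smul, _root_.sum_apply, _root_.smul_apply, hgs _ x hx,
      smul_eq_mul]
    conv_lhs => rw [← sum_coord_smul_single z]
    simp [mul_comm]
  have hds : ∀ i, fderiv ℝ (s i) x w = - christoffel g x w (s i x)
      - ∑ j, (christoffel g x w (EuclideanSpace.single j 1)) i • s j x := by
    intro i
    refine hg.eq_of_forall_inner hx fun z => ?_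
    have h1 := hg.fderiv_inner_along (ψ := id) (X := s i) (Y := fun _ => z) hx differentiableAt_id
      (hsd i) (differentiableAt_const z) w
    have h2 : (fun y => g (id y) (s i y) z) =ᶠ[nhds x] fun _ => z i := by
      filter_upwards [hg.isOpen.mem_nhds hx] with y hy using hgs i y hy z
    rw [h2.fderiv_eq] at h1
    simp only [covDeriv, fderiv_fun_const, fderiv_id, Pi.zero_apply, _root_.zero_apply, id,
      ContinuousLinearMap.id_apply, map_add, _root_.add_apply, hgs i x hx,
      zero_add] at h1
    simp only [map_sub, map_neg, map_sum, map_smul, _root_.sub_apply, _root_.neg_apply,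
      _root_.sum_apply, _root_.smul_apply, hgs _ x hx, smul_eq_mul]
    have h3 : christoffel g x w z = ∑ j, z j • christoffel g x w (EuclideanSpace.single j 1) := by
      conv_lhs => rw [← sum_coord_smul_single z]
      simp only [← christoffelL_apply, map_sum, map_smul]
    have h4 : (christoffel g x w z) i
        = ∑ j, (christoffel g x w (EuclideanSpace.single j 1)) i * z j := by
      rw [h3]; simp [mul_comm]
    linarith
  unfold metricTrace
  have hterm : ∀ i, DifferentiableAt ℝ (fun y => β y (s i y) (EuclideanSpace.single i 1)) x :=
    fun i => (hβ.clm_apply (hsd i)).clm_apply (differentiableAt_const _)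
  rw [fderiv_fun_sum fun i _ => hterm i]
  simp only [_root_.sum_apply]
  have : ∀ i, fderiv ℝ (fun y => β y (s i y) (EuclideanSpace.single i 1)) x w
      = fderiv ℝ β x w (s i x) (EuclideanSpace.single i 1)
        - β x (christoffel g x w (s i x)) (EuclideanSpace.single i 1)
        - ∑ j, (christoffel g x w (EuclideanSpace.single j 1)) i
            * β x (s j x) (EuclideanSpace.single i 1) := by
    intro i
    rw [fderiv_clm_apply₂ w hβ (hsd i) (differentiableAt_const _), hds]
    simp
    ring
  simp only [this, Finset.sum_sub_distrib]
  congr 1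
  rw [Finset.sum_comm]
  refine Finset.sum_congr rfl fun j _ => ?_
  conv_rhs => rw [← sum_coord_smul_single (christoffel g x w (EuclideanSpace.single j 1))]
  simp [hs]

end MetricTraceDeriv

section IsometricImmersion

variable {E F : Type*} [NormedAddCommGroup E] [NormedSpace ℝ E] [FiniteDimensional ℝ E]
  [NormedAddCommGroup F] [NormedSpace ℝ F] [FiniteDimensional ℝ F]
  {g : E → E →L[ℝ] E →L[ℝ] ℝ} {G : F → F →L[ℝ] F →L[ℝ] ℝ} {U : Set E} {V : Set F} {ψ : E → F}

/-- In coordinates, `ψ` is an isometric immersion from `(U, g)` to `(V, G)`. -/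
structure IsIsometricOn (g : E → E →L[ℝ] E →L[ℝ] ℝ) (G : F → F →L[ℝ] F →L[ℝ] ℝ) (ψ : E → F)
    (U : Set E) (V : Set F) : Prop where
  source : IsMetricOn g U
  target : IsMetricOn G V
  smooth : ∀ x ∈ U, ContDiffAt ℝ ∞ ψ x
  mapsTo : ∀ x ∈ U, ψ x ∈ V
  isometric : ∀ x ∈ U, ∀ u v, G (ψ x) (fderiv ℝ ψ x u) (fderiv ℝ ψ x v) = g x u v

/-- The Hessian `∇_u (dψ v)` of a map, for constant fields `v`, as a bilinear map. -/
def hessL (G : F → F →L[ℝ] F →L[ℝ] ℝ) (ψ : E → F) (x : E) : E →L[ℝ] E →L[ℝ] F :=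
  fderiv ℝ (fderiv ℝ ψ) x
    + ((ContinuousLinearMap.flip ((christoffelL G (ψ x)).comp (fderiv ℝ ψ x))).comp
        (fderiv ℝ ψ x)).flip

omit [FiniteDimensional ℝ E] [FiniteDimensional ℝ F] in
lemma hessL_apply {x : E} (hψ : ContDiffAt ℝ ∞ ψ x) (u v : E) :
    hessL G ψ x u v = covDeriv G ψ (fun y => fderiv ℝ ψ y v) x u := by
  rw [covDeriv_eq, fderiv_fderiv_apply hψ]
  simp [hessL]

omit [FiniteDimensional ℝ E] in
lemma IsMetricOn.contDiffAt_hessL (hG : IsMetricOn G V) {x : E} (hx : ψ x ∈ V)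
    (hψ : ContDiffAt ℝ ∞ ψ x) : ContDiffAt ℝ ∞ (hessL G ψ) x := by
  have h1 : ContDiffAt ℝ ∞ (fun y => (christoffelL G (ψ y)).comp (fderiv ℝ ψ y)) x :=
    ((hG.contDiffAt_christoffelL hx).comp x hψ).clm_comp hψ.fderiv_top
  have h2 : ContDiffAt ℝ ∞
      (fun y => ((christoffelL G (ψ y)).comp (fderiv ℝ ψ y)).flip.comp (fderiv ℝ ψ y)) x :=
    ((ContinuousLinearMap.flipₗᵢ ℝ E F F).contDiff.contDiffAt.comp x h1).clm_comp hψ.fderiv_top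
  exact hψ.fderiv_top.fderiv_top.add
    ((ContinuousLinearMap.flipₗᵢ ℝ E E F).contDiff.contDiffAt.comp x h2)

namespace IsIsometricOn

variable (hψ : IsIsometricOn g G ψ U V) {x : E} (hx : x ∈ U)

include hψ hx

omit [FiniteDimensional ℝ E] [FiniteDimensional ℝ F] in
lemma hess_symm (u v : E) : hessL G ψ x u v = hessL G ψ x v u := by
  rw [hessL_apply (hψ.smooth x hx), hessL_apply (hψ.smooth x hx)]
  exact hψ.target.covDeriv_fderiv_symm (hψ.mapsTo x hx) (hψ.smooth x hx) u v

omit [FiniteDimensional ℝ E] [FiniteDimensional ℝ F] in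
lemma sff_eq (u v : E) : secondFundamentalForm g G ψ x u v
    = hessL G ψ x u v - fderiv ℝ ψ x (christoffelL g x u v) := by
  rw [hessL_apply (hψ.smooth x hx), christoffelL_apply]; rfl

omit [FiniteDimensional ℝ E] [FiniteDimensional ℝ F] in
lemma exists_sff_bilinear : ∃ S : E →ₗ[ℝ] E →ₗ[ℝ] F,
    ∀ u v, S u v = secondFundamentalForm g G ψ x u v := by
  refine ⟨LinearMap.mk₂ ℝ (secondFundamentalForm g G ψ x) ?_ ?_ ?_ ?_, fun u v => rfl⟩ <;>
  · intros
    simp only [hψ.sff_eq hx, map_add, _root_.add_apply, map_smul, _root_.smul_apply, smul_sub]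
    try abel

/-- The second fundamental form of an isometric immersion is normal. -/
lemma inner_sff_tangent (u v w : E) :
    G (ψ x) (secondFundamentalForm g G ψ x u v) (fderiv ℝ ψ x w) = 0 := by
  have hV := hψ.mapsTo x hx
  have hT : ∀ v, DifferentiableAt ℝ (fun y => fderiv ℝ ψ y v) x := fun v =>
    (hψ.smooth x hx).fderiv_top.diff.clm_apply (differentiableAt_const v)
  have hd := (hψ.source.smooth x hx).diff
  have h1 : ∀ u v w, fderiv ℝ g x u v w
      = G (ψ x) (hessL G ψ x u v) (fderiv ℝ ψ x w)
        + G (ψ x) (hessL G ψ x u w) (fderiv ℝ ψ x v) := by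
    intro u v w
    have h2 : fderiv ℝ (fun y => g y v w) x u = fderiv ℝ g x u v w := by
      rw [fderiv_clm_apply₂ u hd (differentiableAt_const v) (differentiableAt_const w)]; simp
    have h3 : (fun y => G (ψ y) (fderiv ℝ ψ y v) (fderiv ℝ ψ y w))
        =ᶠ[nhds x] fun y => g y v w := by
      filter_upwards [hψ.source.isOpen.mem_nhds hx] with y hy using hψ.isometric y hy v w
    rw [← h2, ← h3.fderiv_eq, hψ.target.fderiv_inner_along hV (hψ.smooth x hx).diff (hT v) (hT w),
      hessL_apply (hψ.smooth x hx), hessL_apply (hψ.smooth x hx),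
      hψ.target.symm _ hV (fderiv ℝ ψ x v)]
  have h4 := hψ.source.inner_christoffel hx u v w
  rw [← hψ.isometric x hx] at h4
  simp only [koszul, _root_.smul_apply, _root_.sub_apply,
    _root_.add_apply, ContinuousLinearMap.flip_apply, smul_eq_mul, h1] at h4
  rw [hψ.hess_symm hx v u, hψ.hess_symm hx w u, hψ.hess_symm hx w v] at h4
  rw [hψ.sff_eq hx, christoffelL_apply, map_sub, _root_.sub_apply, h4]
  ring

omit [FiniteDimensional ℝ E] in
/-- The second covariant derivative is bilinear. -/
lemma exists_secondCovDeriv_bilinear {X : E → F} (hX : ContDiffAt ℝ ∞ X x) :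
    ∃ S : E →ₗ[ℝ] E →ₗ[ℝ] F, ∀ u v, S u v = secondCovDeriv g G ψ X x u v := by
  refine ⟨LinearMap.mk₂ ℝ (secondCovDeriv g G ψ X x) ?_ ?_ ?_ ?_, fun u v => rfl⟩ <;>
  · intros
    simp only [secondCovDeriv, hψ.target.covDeriv_covDeriv (hψ.mapsTo x hx) (hψ.smooth x hx) hX]
    simp only [covDeriv_add_left, covDeriv_smul_left, ← christoffelL_apply, map_add, _root_.add_apply,
      map_smul, _root_.smul_apply, smul_sub, smul_add]
    try abel

omit [FiniteDimensional ℝ E] in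
lemma secondCovDeriv_commutator {X : E → F} (hX : ContDiffAt ℝ ∞ X x) (u v : E) :
    secondCovDeriv g G ψ X x u v - secondCovDeriv g G ψ X x v u
      = curvature G (ψ x) (fderiv ℝ ψ x u) (fderiv ℝ ψ x v) (X x) := by
  rw [← hψ.target.covDeriv_commutator (hψ.mapsTo x hx) (hψ.smooth x hx) hX, secondCovDeriv,
    secondCovDeriv, hψ.source.christoffel_symm hx v u]
  abel

omit [FiniteDimensional ℝ E] in
lemma secondCovDeriv_const_smul {X : E → F} (hX : ∀ y ∈ U, ContDiffAt ℝ ∞ X y) (a : ℝ) (u v : E) :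
    secondCovDeriv g G ψ (fun y => a • X y) x u v = a • secondCovDeriv g G ψ X x u v := by
  have h : (fun y => covDeriv G ψ (fun y => a • X y) y v)
      =ᶠ[nhds x] fun y => a • covDeriv G ψ X y v := by
    filter_upwards [hψ.source.isOpen.mem_nhds hx] with y hy
      using covDeriv_const_smul a (hX y hy).diff v
  rw [secondCovDeriv, covDeriv_congr h, covDeriv_const_smul a (hX x hx).diff, covDeriv_const_smul,
    secondCovDeriv, smul_sub]
  exact (hψ.target.contDiffAt_covDeriv (hψ.mapsTo x hx) (hψ.smooth x hx) (hX x hx)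
    contDiffAt_const).diff

end IsIsometricOn

end IsometricImmersion

section NormalField

variable {E F : Type*} [NormedAddCommGroup E] [NormedSpace ℝ E] [FiniteDimensional ℝ E]
  [NormedAddCommGroup F] [NormedSpace ℝ F] [FiniteDimensional ℝ F]
  {g : E → E →L[ℝ] E →L[ℝ] ℝ} {G : F → F →L[ℝ] F →L[ℝ] ℝ} {U : Set E} {V : Set F} {ψ H : E → F}
  {h : ℝ}

/-- `H` is a smooth normal field of constant nonzero length `h` along the hypersurface `ψ`. -/
structure IsNormalFieldOn (G : F → F →L[ℝ] F →L[ℝ] ℝ) (ψ H : E → F) (h : ℝ) (U : Set E) :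
    Prop where
  codim_one : Module.finrank ℝ F = Module.finrank ℝ E + 1
  ne_zero : h ≠ 0
  smooth : ∀ x ∈ U, ContDiffAt ℝ ∞ H x
  normal : ∀ x ∈ U, ∀ w, G (ψ x) (H x) (fderiv ℝ ψ x w) = 0
  norm_sq : ∀ x ∈ U, G (ψ x) (H x) (H x) = h ^ 2

namespace IsNormalFieldOn

variable (hH : IsNormalFieldOn G ψ H h U) (hψ : IsIsometricOn g G ψ U V) {x : E} (hx : x ∈ U)

include hH hψ hx

omit [FiniteDimensional ℝ E] [FiniteDimensional ℝ F] in
/-- A tangent orthonormal basis, completed by the unit normal. -/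
lemma exists_basis {ι : Type*} [Fintype ι] [DecidableEq ι] {e : Module.Basis ι ℝ E}
    (he : IsOrthonormalFor (g x) e) :
    ∃ f : Module.Basis (Option ι) ℝ F, IsOrthonormalFor (G (ψ x)) f ∧
      (∀ i, f (some i) = fderiv ℝ ψ x (e i)) ∧ f none = h⁻¹ • H x := by
  have hV := hψ.mapsTo x hx
  let f : Option ι → F := fun o => o.elim (h⁻¹ • H x) fun i => fderiv ℝ ψ x (e i)
  have hh := hH.ne_zero
  have hf : IsOrthonormalFor (G (ψ x)) f := by
    rintro (_ | i) (_ | j)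
    · simp only [f, Option.elim, map_smul, _root_.smul_apply, hH.norm_sq x hx, smul_eq_mul,
        if_true]
      field_simp
    · simp [f, hH.normal x hx]
    · simp [f, hψ.target.symm _ hV _ (H x), hH.normal x hx]
    · simp [f, hψ.isometric x hx, he i j]
  have hli : LinearIndependent ℝ f := by
    rw [Fintype.linearIndependent_iff]
    intro c hc i
    have := congrArg (fun t => G (ψ x) t (f i)) hc
    simpa only [map_sum, map_smul, _root_.sum_apply, _root_.smul_apply, hf _ i, smul_eq_mul,
      mul_ite, mul_one, mul_zero, Finset.sum_ite_eq', Finset.mem_univ, if_true, map_zero,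
      _root_.zero_apply] using this
  refine ⟨basisOfLinearIndependentOfCardEqFinrank hli ?_, ?_, ?_, ?_⟩
  · rw [Fintype.card_option, hH.codim_one, Module.finrank_eq_card_basis e]
  · rw [coe_basisOfLinearIndependentOfCardEqFinrank]; exact hf
  · intro i; rw [coe_basisOfLinearIndependentOfCardEqFinrank]; rfl
  · rw [coe_basisOfLinearIndependentOfCardEqFinrank]; rfl

omit [FiniteDimensional ℝ E] [FiniteDimensional ℝ F] in
lemma inner_eq_sum {ι : Type*} [Fintype ι] [DecidableEq ι] {e : Module.Basis ι ℝ E}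
    (he : IsOrthonormalFor (g x) e) (Y Z : F) :
    G (ψ x) Y Z = (h ^ 2)⁻¹ * (G (ψ x) Y (H x) * G (ψ x) (H x) Z)
      + ∑ i, G (ψ x) Y (fderiv ℝ ψ x (e i)) * G (ψ x) (fderiv ℝ ψ x (e i)) Z := by
  obtain ⟨f, hf, hs, hn⟩ := hH.exists_basis hψ hx he
  rw [← hf.sum_inner_mul_inner, Fintype.sum_option]
  simp only [hs, hn, map_smul, _root_.smul_apply, smul_eq_mul]
  congr 1
  ring

omit [FiniteDimensional ℝ F] in
lemma inner_of_tangent_of_normal {Y Z : F} (hY : G (ψ x) Y (H x) = 0)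
    (hZ : ∀ w, G (ψ x) Z (fderiv ℝ ψ x w) = 0) : G (ψ x) Y Z = 0 := by
  obtain ⟨e, he⟩ := hψ.source.exists_orthonormal hx
  rw [hH.inner_eq_sum hψ hx he, hY]
  simp [hψ.target.symm _ (hψ.mapsTo x hx) _ Z, hZ]

omit [FiniteDimensional ℝ E] in
lemma inner_covDeriv_self (v : E) : G (ψ x) (covDeriv G ψ H x v) (H x) = 0 := by
  have hV := hψ.mapsTo x hx
  have h1 : (fun y => G (ψ y) (H y) (H y)) =ᶠ[nhds x] fun _ => h ^ 2 := by
    filter_upwards [hψ.source.isOpen.mem_nhds hx] with y hy using hH.norm_sq y hy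
  have h2 := hψ.target.fderiv_inner_along hV (hψ.smooth x hx).diff (hH.smooth x hx).diff
    (hH.smooth x hx).diff v
  rw [h1.fderiv_eq, hψ.target.symm _ hV (H x)] at h2
  simp at h2
  linarith

omit [FiniteDimensional ℝ E] in
lemma inner_covDeriv_tangent (v w : E) : G (ψ x) (covDeriv G ψ H x v) (fderiv ℝ ψ x w)
    = -G (ψ x) (H x) (hessL G ψ x v w) := by
  have hV := hψ.mapsTo x hx
  have h1 : (fun y => G (ψ y) (H y) (fderiv ℝ ψ y w)) =ᶠ[nhds x] fun _ => 0 := by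
    filter_upwards [hψ.source.isOpen.mem_nhds hx] with y hy using hH.normal y hy w
  have h2 := hψ.target.fderiv_inner_along hV (hψ.smooth x hx).diff (hH.smooth x hx).diff
    ((hψ.smooth x hx).fderiv_top.diff.clm_apply (differentiableAt_const w)) v
  rw [h1.fderiv_eq, ← hessL_apply (hψ.smooth x hx)] at h2
  simp at h2
  linarith

omit [FiniteDimensional ℝ E] [FiniteDimensional ℝ F] in
lemma inner_hess_eq_inner_sff (u v : E) : G (ψ x) (H x) (hessL G ψ x u v)
    = G (ψ x) (H x) (secondFundamentalForm g G ψ x u v) := by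
  rw [hψ.sff_eq hx, map_sub, hH.normal x hx, sub_zero]

omit [FiniteDimensional ℝ E] in
lemma secondCovDeriv_inner_self (v w : E) :
    G (ψ x) (secondCovDeriv g G ψ H x v w) (H x)
      = -G (ψ x) (covDeriv G ψ H x w) (covDeriv G ψ H x v) := by
  have hV := hψ.mapsTo x hx
  have h1 : (fun y => G (ψ y) (covDeriv G ψ H y w) (H y)) =ᶠ[nhds x] fun _ => 0 := by
    filter_upwards [hψ.source.isOpen.mem_nhds hx] with y hy using hH.inner_covDeriv_self hψ hy w
  have h2 := hψ.target.fderiv_inner_along hV (hψ.smooth x hx).diff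
    (hψ.target.contDiffAt_covDeriv hV (hψ.smooth x hx) (hH.smooth x hx)
      (contDiffAt_const (c := w))).diff (hH.smooth x hx).diff v
  rw [h1.fderiv_eq] at h2
  simp at h2
  rw [secondCovDeriv, map_sub, _root_.sub_apply, hH.inner_covDeriv_self hψ hx]
  linarith

end IsNormalFieldOn

/-- The scalar second fundamental form `G(H, B)` as a bilinear form. -/
def shapeForm (G : F → F →L[ℝ] F →L[ℝ] ℝ) (ψ H : E → F) (x : E) : E →L[ℝ] E →L[ℝ] ℝ :=
  (ContinuousLinearMap.compL ℝ E F ℝ (G (ψ x) (H x))).comp (hessL G ψ x)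

omit [FiniteDimensional ℝ E] [FiniteDimensional ℝ F] in
lemma shapeForm_apply (x u v : E) : shapeForm G ψ H x u v = G (ψ x) (H x) (hessL G ψ x u v) := rfl

namespace IsNormalFieldOn

variable (hH : IsNormalFieldOn G ψ H h U) (hψ : IsIsometricOn g G ψ U V) {x : E} (hx : x ∈ U)

include hH hψ hx

omit [FiniteDimensional ℝ E] in
lemma differentiableAt_shapeForm : DifferentiableAt ℝ (shapeForm G ψ H) x := by
  have hV := hψ.mapsTo x hx
  have h1 : ContDiffAt ℝ ∞ (fun y => G (ψ y) (H y)) x :=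
    ((hψ.target.smooth _ hV).comp x (hψ.smooth x hx)).clm_apply (hH.smooth x hx)
  have h2 : ContDiffAt ℝ ∞ (fun y => ContinuousLinearMap.compL ℝ E F ℝ (G (ψ y) (H y))) x :=
    (ContinuousLinearMap.contDiff _).contDiffAt.comp x h1
  exact (h2.clm_comp (hψ.target.contDiffAt_hessL hV (hψ.smooth x hx))).diff

lemma secondCovDeriv_inner_tangent (u v w : E) :
    G (ψ x) (secondCovDeriv g G ψ H x u v) (fderiv ℝ ψ x w)
      = -(fderiv ℝ (shapeForm G ψ H) x u v w - shapeForm G ψ H x (christoffel g x u v) w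
          - shapeForm G ψ H x v (christoffel g x u w)) := by
  have hV := hψ.mapsTo x hx
  have hβ := hH.differentiableAt_shapeForm hψ hx
  have h1 : (fun y => G (ψ y) (covDeriv G ψ H y v) (fderiv ℝ ψ y w))
      =ᶠ[nhds x] fun y => -shapeForm G ψ H y v w := by
    filter_upwards [hψ.source.isOpen.mem_nhds hx] with y hy
      using hH.inner_covDeriv_tangent hψ hy v w
  have h2 := hψ.target.fderiv_inner_along hV (hψ.smooth x hx).diff
    (hψ.target.contDiffAt_covDeriv hV (hψ.smooth x hx) (hH.smooth x hx)
      (contDiffAt_const (c := v))).diff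
    ((hψ.smooth x hx).fderiv_top.diff.clm_apply (differentiableAt_const w)) u
  have h3 : fderiv ℝ (fun y => -shapeForm G ψ H y v w) x u
      = -fderiv ℝ (shapeForm G ψ H) x u v w := by
    rw [fderiv_fun_neg, _root_.neg_apply,
      fderiv_clm_apply₂ u hβ (differentiableAt_const v) (differentiableAt_const w)]
    simp
  have h4 : G (ψ x) (covDeriv G ψ H x v) (hessL G ψ x u w)
      = - shapeForm G ψ H x v (christoffel g x u w) := by
    have h5 : hessL G ψ x u w = secondFundamentalForm g G ψ x u w
        + fderiv ℝ ψ x (christoffel g x u w) := by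
      rw [hψ.sff_eq hx, christoffelL_apply]; abel
    rw [h5, map_add, hH.inner_of_tangent_of_normal hψ hx (hH.inner_covDeriv_self hψ hx v)
      (hψ.inner_sff_tangent hx u w), hH.inner_covDeriv_tangent hψ hx, zero_add, shapeForm_apply]
  rw [h1.fderiv_eq, h3, ← hessL_apply (hψ.smooth x hx), h4] at h2
  rw [secondCovDeriv, map_sub, _root_.sub_apply, hH.inner_covDeriv_tangent hψ hx,
    ← shapeForm_apply]
  linarith

lemma secondCovDeriv_inner_tangent_symm (u v w : E) :
    G (ψ x) (secondCovDeriv g G ψ H x u v) (fderiv ℝ ψ x w)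
      = G (ψ x) (secondCovDeriv g G ψ H x u w) (fderiv ℝ ψ x v) := by
  have hβ := hH.differentiableAt_shapeForm hψ hx
  have hs : ∀ y ∈ U, ∀ v w, shapeForm G ψ H y v w = shapeForm G ψ H y w v := fun y hy v w => by
    rw [shapeForm_apply, hψ.hess_symm hy, shapeForm_apply]
  have h3 : ∀ v w, fderiv ℝ (fun y => shapeForm G ψ H y v w) x u
      = fderiv ℝ (shapeForm G ψ H) x u v w := by
    intro v w
    rw [fderiv_clm_apply₂ u hβ (differentiableAt_const v) (differentiableAt_const w)]
    simp
  have h4 : (fun y => shapeForm G ψ H y v w) =ᶠ[nhds x] fun y => shapeForm G ψ H y w v := by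
    filter_upwards [hψ.source.isOpen.mem_nhds hx] with y hy using hs y hy v w
  rw [hH.secondCovDeriv_inner_tangent hψ hx, hH.secondCovDeriv_inner_tangent hψ hx, ← h3 v w,
    h4.fderiv_eq, h3, hs x hx v, hs x hx w]
  ring

end IsNormalFieldOn

end NormalField

section Bitension

variable {d : ℕ} {F : Type*} [NormedAddCommGroup F] [NormedSpace ℝ F] [FiniteDimensional ℝ F]

variable {g : EuclideanSpace ℝ (Fin d) → EuclideanSpace ℝ (Fin d) →L[ℝ] EuclideanSpace ℝ (Fin d) →L[ℝ] ℝ} {G : F → F →L[ℝ] F →L[ℝ] ℝ} {U : Set (EuclideanSpace ℝ (Fin d))} {V : Set F}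
  {ψ : EuclideanSpace ℝ (Fin d) → F} {h : ℝ} (hψ : IsIsometricOn g G ψ U V) {x : EuclideanSpace ℝ (Fin d)} (hx : x ∈ U)

include hψ

lemma IsIsometricOn.contDiffAt_meanCurvature (hx : x ∈ U) :
    ContDiffAt ℝ ∞ (meanCurvature g G ψ) x := by
  refine ContDiffAt.const_smul _ (ContDiffAt.sum fun i _ => ?_)
  have hs : ContDiffAt ℝ ∞ (fun y => sharp g y (EuclideanSpace.proj i)) x :=
    (hψ.source.contDiffAt_sharp hx).clm_apply contDiffAt_const
  have hΓ : ContDiffAt ℝ ∞ (fun y => christoffel g y (sharp g y (EuclideanSpace.proj i))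
      (EuclideanSpace.single i (1 : ℝ))) x := by
    simp only [← christoffelL_apply]
    exact ((hψ.source.contDiffAt_christoffelL hx).clm_apply hs).clm_apply contDiffAt_const
  exact (hψ.target.contDiffAt_covDeriv (hψ.mapsTo x hx) (hψ.smooth x hx)
    ((hψ.smooth x hx).fderiv_top.clm_apply contDiffAt_const) hs).sub
      ((hψ.smooth x hx).fderiv_top.clm_apply hΓ)

lemma IsIsometricOn.meanCurvature_normal (hx : x ∈ U) (w : EuclideanSpace ℝ (Fin d)) :
    G (ψ x) (meanCurvature g G ψ x) (fderiv ℝ ψ x w) = 0 := by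
  simp [meanCurvature, metricTrace, hψ.inner_sff_tangent hx]

/-- The mean curvature vector of a hypersurface of constant nonzero mean curvature is a normal field
of constant length. -/
lemma IsIsometricOn.isNormalFieldOn_meanCurvature (hdim : Module.finrank ℝ F = d + 1) (hh : h ≠ 0)
    (hn : ∀ x ∈ U, G (ψ x) (meanCurvature g G ψ x) (meanCurvature g G ψ x) = h ^ 2) :
    IsNormalFieldOn G ψ (meanCurvature g G ψ) h U where
  codim_one := by simpa using hdim
  ne_zero := hh
  smooth _ hy := hψ.contDiffAt_meanCurvature hy
  normal _ hy := hψ.meanCurvature_normal hy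
  norm_sq := hn

variable {H : EuclideanSpace ℝ (Fin d) → F} (hH : IsNormalFieldOn G ψ H h U)

include hH hx

lemma IsNormalFieldOn.normSq_sff {ι : Type*} [Fintype ι] [DecidableEq ι] {e : Module.Basis ι ℝ (EuclideanSpace ℝ (Fin d))}
    (he : IsOrthonormalFor (g x) e) :
    normSqSecondFundamentalForm g G ψ x * h ^ 2
      = ∑ i, G (ψ x) (covDeriv G ψ H x (e i)) (covDeriv G ψ H x (e i)) := by
  have hh := hH.ne_zero
  have hV := hψ.mapsTo x hx
  obtain ⟨S, hS⟩ := hψ.exists_sff_bilinear hx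
  have h1 : ∀ u u', metricTrace g x (fun v v' => G (ψ x) (S u v) (S u' v'))
      = ∑ j, G (ψ x) (S u (e j)) (S u' (e j)) := fun u u' =>
    hψ.source.metricTrace_eq_sum hx he (LinearMap.mk₂ ℝ (fun v v' => G (ψ x) (S u v) (S u' v'))
      (by simp) (by simp) (by simp) (by simp))
  have h2 : normSqSecondFundamentalForm g G ψ x
      = ∑ i, ∑ j, G (ψ x) (S (e i) (e j)) (S (e i) (e j)) := by
    unfold normSqSecondFundamentalForm
    simp only [← hS, h1]
    exact hψ.source.metricTrace_eq_sum hx he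
      (LinearMap.mk₂ ℝ (fun u u' => ∑ j, G (ψ x) (S u (e j)) (S u' (e j)))
      (by simp [Finset.sum_add_distrib]) (by simp [Finset.mul_sum])
      (by simp [Finset.sum_add_distrib]) (by simp [Finset.mul_sum]))
  rw [h2, Finset.sum_mul]
  refine Finset.sum_congr rfl fun i _ => ?_
  rw [hH.inner_eq_sum hψ hx he (covDeriv G ψ H x (e i)), hH.inner_covDeriv_self hψ hx,
    Finset.sum_mul]
  simp only [zero_mul, mul_zero, zero_add]
  refine Finset.sum_congr rfl fun j _ => ?_
  rw [hψ.target.symm _ hV (fderiv ℝ ψ x (e j)), hH.inner_covDeriv_tangent hψ hx,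
    hH.inner_hess_eq_inner_sff hψ hx, hH.inner_eq_sum hψ hx he (S (e i) (e j)), ← hS,
    hψ.target.symm _ hV _ (H x)]
  simp only [hS, hψ.inner_sff_tangent hx, zero_mul, Finset.sum_const_zero, add_zero]
  field_simp

/-- Tangential part of the rough Laplacian of a normal field, by the Codazzi equation. -/
lemma IsNormalFieldOn.trace_secondCovDeriv_tangent {ι : Type*} [Fintype ι] [DecidableEq ι]
    {e : Module.Basis ι ℝ (EuclideanSpace ℝ (Fin d))} (he : IsOrthonormalFor (g x) e)
    (hmc : ∀ y ∈ U, metricTrace g y (fun u v => shapeForm G ψ H y u v) = d * h ^ 2) (w : EuclideanSpace ℝ (Fin d)) :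
    ∑ i, G (ψ x) (secondCovDeriv g G ψ H x (e i) (e i)) (fderiv ℝ ψ x w)
      = ricci G (ψ x) (fderiv ℝ ψ x w) (H x) := by
  have hV := hψ.mapsTo x hx
  have hβ := hH.differentiableAt_shapeForm hψ hx
  have h0 : ∑ i, G (ψ x) (secondCovDeriv g G ψ H x w (e i)) (fderiv ℝ ψ x (e i)) = 0 := by
    have h1 : (fun y => metricTrace g y (fun u v => shapeForm G ψ H y u v))
        =ᶠ[nhds x] fun _ => (d : ℝ) * h ^ 2 := by
      filter_upwards [hψ.source.isOpen.mem_nhds hx] with y hy using hmc y hy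
    have h2 := hψ.source.fderiv_metricTrace hx hβ w
    rw [h1.fderiv_eq] at h2
    have h3 := hψ.source.metricTrace_eq_sum hx he
      (LinearMap.mk₂ ℝ (fun u v => fderiv ℝ (shapeForm G ψ H) x w u v
        - shapeForm G ψ H x (christoffel g x w u) v - shapeForm G ψ H x u (christoffel g x w v))
        (by intros; simp only [← christoffelL_apply, map_add, _root_.add_apply]; ring)
        (by intros; simp only [← christoffelL_apply, map_smul, _root_.smul_apply, smul_sub])
        (by intros; simp only [← christoffelL_apply, map_add]; ring)
        (by intros; simp only [← christoffelL_apply, map_smul, smul_sub]))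
    simp only [LinearMap.mk₂_apply] at h3
    rw [h3] at h2
    simp only [hH.secondCovDeriv_inner_tangent hψ hx, Finset.sum_neg_distrib, ← h2]
    simp
  obtain ⟨f, hf, hs, hn⟩ := hH.exists_basis hψ hx he
  rw [hψ.target.ricci_eq_sum hV hf, Fintype.sum_option, hn]
  have h4 : G (ψ x) (curvature G (ψ x) (h⁻¹ • H x) (fderiv ℝ ψ x w) (H x)) (h⁻¹ • H x) = 0 := by
    have := hψ.target.curvature_skew hV (h⁻¹ • H x) (fderiv ℝ ψ x w) (H x) (H x)
    rw [map_smul, smul_eq_mul]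
    have h5 : G (ψ x) (curvature G (ψ x) (h⁻¹ • H x) (fderiv ℝ ψ x w) (H x)) (H x) = 0 := by
      linarith
    rw [h5, mul_zero]
  rw [h4, zero_add, ← sub_eq_zero, ← h0, ← Finset.sum_sub_distrib]
  refine Finset.sum_congr rfl fun i _ => ?_
  rw [hs, hH.secondCovDeriv_inner_tangent_symm hψ hx,
    ← hψ.secondCovDeriv_commutator hx (hH.smooth x hx), map_sub, _root_.sub_apply]
  ring

end Bitension

section BitensionMean

variable {d : ℕ} {F : Type*} [NormedAddCommGroup F] [NormedSpace ℝ F] [FiniteDimensional ℝ F]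

variable {g : EuclideanSpace ℝ (Fin d) → EuclideanSpace ℝ (Fin d) →L[ℝ] EuclideanSpace ℝ (Fin d) →L[ℝ] ℝ} {G : F → F →L[ℝ] F →L[ℝ] ℝ} {U : Set (EuclideanSpace ℝ (Fin d))} {V : Set F}
  {ψ : EuclideanSpace ℝ (Fin d) → F} {h : ℝ}

/-- A hypersurface of constant nonzero mean curvature is biharmonic if and only if
`Ric(H) = |B|² H`. -/
theorem IsIsometricOn.bitension_eq_zero_iff (hψ : IsIsometricOn g G ψ U V)
    (hdim : Module.finrank ℝ F = d + 1) (hd : d ≠ 0) (hh : h ≠ 0)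
    (hn : ∀ x ∈ U, G (ψ x) (meanCurvature g G ψ x) (meanCurvature g G ψ x) = h ^ 2)
    {x : EuclideanSpace ℝ (Fin d)} (hx : x ∈ U) :
    bitension g G ψ x = 0 ↔ ∀ Z, ricci G (ψ x) Z (meanCurvature g G ψ x)
      = normSqSecondFundamentalForm g G ψ x * G (ψ x) (meanCurvature g G ψ x) Z := by
  have hV := hψ.mapsTo x hx
  have hd' : (d : ℝ) ≠ 0 := Nat.cast_ne_zero.mpr hd
  have hH := hψ.isNormalFieldOn_meanCurvature hdim hh hn
  set H := meanCurvature g G ψ with hHdef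
  have hτ : tension g G ψ = fun y => (d : ℝ) • H y := by
    ext y
    rw [hHdef, meanCurvature, smul_smul, mul_one_div_cancel hd', one_smul, tension]
  have hmc : ∀ y ∈ U, metricTrace g y (fun u v => shapeForm G ψ H y u v) = d * h ^ 2 := by
    intro y hy
    rw [← hn y hy, ← smul_eq_mul, ← map_smul, ← congrFun hτ y]
    simp only [shapeForm_apply, metricTrace, tension, map_sum, hH.inner_hess_eq_inner_sff hψ hy]
  obtain ⟨e, he⟩ := hψ.source.exists_orthonormal hx
  obtain ⟨S, hS⟩ := hψ.exists_secondCovDeriv_bilinear hx (hH.smooth x hx)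
  obtain ⟨R, hR⟩ := hψ.target.exists_curvature_trilinear hV
  obtain ⟨f, hf, hfs, hfn⟩ := hH.exists_basis hψ hx he
  have h1 : metricTrace g x (secondCovDeriv g G ψ (tension g G ψ) x)
      = (d : ℝ) • ∑ i, secondCovDeriv g G ψ H x (e i) (e i) := by
    have : secondCovDeriv g G ψ (tension g G ψ) x = fun u v => ((d : ℝ) • S) u v := by
      ext u v
      rw [hτ, hψ.secondCovDeriv_const_smul hx hH.smooth]
      simp [hS]
    rw [this, hψ.source.metricTrace_eq_sum hx he]
    simp [hS, Finset.smul_sum]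
  have h2 : metricTrace g x (fun u v =>
        curvature G (ψ x) (fderiv ℝ ψ x u) (tension g G ψ x) (fderiv ℝ ψ x v))
      = (d : ℝ) • ∑ i, curvature G (ψ x) (fderiv ℝ ψ x (e i)) (H x) (fderiv ℝ ψ x (e i)) := by
    have := hψ.source.metricTrace_eq_sum hx he (LinearMap.mk₂ ℝ (fun u v =>
      R (fderiv ℝ ψ x u) (tension g G ψ x) (fderiv ℝ ψ x v)) (by simp) (by simp) (by simp)
      (by simp))
    simp only [LinearMap.mk₂_apply, hR] at this
    rw [this, hτ]
    simp [← hR, Finset.smul_sum]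
  have h3 : ∀ Z, G (ψ x) (bitension g G ψ x) Z
      = d * (∑ i, G (ψ x) (secondCovDeriv g G ψ H x (e i) (e i)) Z + ricci G (ψ x) Z (H x)) := by
    intro Z
    rw [bitension, h1, h2, hψ.target.ricci_symm hV, hψ.target.ricci_eq_sum hV hf,
      Fintype.sum_option, hfn]
    have h4 : curvature G (ψ x) (h⁻¹ • H x) (H x) Z = 0 := by
      have h5 : curvature G (ψ x) (H x) (H x) Z = 0 := by
        simp [curvature]
      rw [← hR] at h5 ⊢
      rw [map_smul]
      simp [h5]
    rw [h4]
    simp only [hfs, map_sub, map_smul, map_sum, _root_.sub_apply, _root_.smul_apply,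
      _root_.sum_apply, map_zero, _root_.zero_apply, zero_add, mul_zero, smul_eq_mul]
    rw [← mul_sub, ← Finset.sum_sub_distrib, ← Finset.sum_add_distrib]
    congr 1
    refine Finset.sum_congr rfl fun i _ => ?_
    rw [hψ.target.curvature_skew hV _ _ (fderiv ℝ ψ x (e i)) Z]
    ring
  have hT : ∀ w, G (ψ x) (bitension g G ψ x) (fderiv ℝ ψ x w)
      = d * (2 * ricci G (ψ x) (fderiv ℝ ψ x w) (H x)) := by
    intro w
    rw [h3, hH.trace_secondCovDeriv_tangent hψ hx he hmc]
    ring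
  have hN : G (ψ x) (bitension g G ψ x) (H x)
      = d * (ricci G (ψ x) (H x) (H x) - normSqSecondFundamentalForm g G ψ x * h ^ 2) := by
    rw [h3, hH.normSq_sff hψ hx he]
    simp only [hH.secondCovDeriv_inner_self hψ hx, Finset.sum_neg_distrib]
    ring
  have hexp : ∀ Z : F, ∃ (w : EuclideanSpace ℝ (Fin d)) (a : ℝ), Z = fderiv ℝ ψ x w + a • H x := by
    intro Z
    refine ⟨∑ i, f.repr Z (some i) • e i, f.repr Z none * h⁻¹, ?_⟩
    conv_lhs => rw [← f.sum_repr Z, Fintype.sum_option]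
    simp only [hfs, hfn, map_sum, map_smul, smul_smul]
    rw [add_comm]
  constructor
  · intro hb Z
    obtain ⟨w, a, rfl⟩ := hexp Z
    have h5 := hT w
    rw [hb] at h5 hN
    simp only [map_zero, _root_.zero_apply, zero_eq_mul, hd', false_or,
      mul_eq_zero, OfNat.ofNat_ne_zero] at h5 hN
    rw [hψ.target.ricci_add_left hV, hψ.target.ricci_smul_left hV, h5, map_add, map_smul,
      hH.normal x hx, hH.norm_sq x hx, smul_eq_mul]
    linear_combination a * hN
  · intro hric
    refine hψ.target.eq_of_forall_inner hV fun Z => ?_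
    obtain ⟨w, a, rfl⟩ := hexp Z
    simp only [map_add, map_smul, hT, hN, hric, hH.normal x hx, hH.norm_sq x hx]
    simp

end BitensionMean

section Warped

lemma contDiffAt_of_apply {E F W : Type*} [NormedAddCommGroup E] [NormedSpace ℝ E]
    [NormedAddCommGroup F] [NormedSpace ℝ F] [FiniteDimensional ℝ F]
    [NormedAddCommGroup W] [NormedSpace ℝ W] {V : Set E} (hV : IsOpen V) {A : E → F →L[ℝ] W}
    (h : ∀ u, ∀ x ∈ V, ContDiffAt ℝ ∞ (fun y => A y u) x) {x : E} (hx : x ∈ V) :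
    ContDiffAt ℝ ∞ A x := by
  have : ContDiffOn ℝ ∞ A V :=
    contDiffOn_clm_apply.mpr fun u y hy => (h u y hy).contDiffWithinAt
  exact this.contDiffAt (hV.mem_nhds hx)

lemma contDiffAt_of_apply₂ {E F : Type*} [NormedAddCommGroup E] [NormedSpace ℝ E]
    [NormedAddCommGroup F] [NormedSpace ℝ F] [FiniteDimensional ℝ F]
    {V : Set E} (hV : IsOpen V) {A : E → F →L[ℝ] F →L[ℝ] ℝ}
    (h : ∀ u v, ∀ x ∈ V, ContDiffAt ℝ ∞ (fun y => A y u v) x) {x : E} (hx : x ∈ V) :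
    ContDiffAt ℝ ∞ A x :=
  contDiffAt_of_apply hV (fun u _ hy => contDiffAt_of_apply hV (h u) hy) hx

variable {E₁ E₂ : Type*} [NormedAddCommGroup E₁] [NormedSpace ℝ E₁] [FiniteDimensional ℝ E₁]
  [NormedAddCommGroup E₂] [NormedSpace ℝ E₂] [FiniteDimensional ℝ E₂]
  {G₁ : E₁ → E₁ →L[ℝ] E₁ →L[ℝ] ℝ} {G₂ : E₂ → E₂ →L[ℝ] E₂ →L[ℝ] ℝ} {f : E₁ → ℝ}
  {G : E₁ × E₂ → (E₁ × E₂) →L[ℝ] (E₁ × E₂) →L[ℝ] ℝ} {V₁ : Set E₁} {V₂ : Set E₂}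

/-- In coordinates, `G` is the warped product metric `G₁ + f² G₂` on `V₁ × V₂`. -/
structure IsWarpedOn (G : E₁ × E₂ → (E₁ × E₂) →L[ℝ] (E₁ × E₂) →L[ℝ] ℝ)
    (G₁ : E₁ → E₁ →L[ℝ] E₁ →L[ℝ] ℝ) (G₂ : E₂ → E₂ →L[ℝ] E₂ →L[ℝ] ℝ) (f : E₁ → ℝ)
    (V₁ : Set E₁) (V₂ : Set E₂) : Prop where
  metric₁ : IsMetricOn G₁ V₁
  metric₂ : IsMetricOn G₂ V₂
  smooth : ∀ x ∈ V₁, ContDiffAt ℝ ∞ f x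
  pos : ∀ x ∈ V₁, 0 < f x
  apply : ∀ z ∈ V₁ ×ˢ V₂, ∀ u v, G z u v = G₁ z.1 u.1 v.1 + f z.1 ^ 2 * G₂ z.2 u.2 v.2

/-- The Hessian `D²f(u, v) - df(Γ(u, v))` of a function. -/
def hessian (G₁ : E₁ → E₁ →L[ℝ] E₁ →L[ℝ] ℝ) (f : E₁ → ℝ) (x u v : E₁) : ℝ :=
  fderiv ℝ (fderiv ℝ f) x u v - fderiv ℝ f x (christoffel G₁ x u v)

namespace IsWarpedOn

variable (hw : IsWarpedOn G G₁ G₂ f V₁ V₂)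

include hw

lemma isMetricOn : IsMetricOn G (V₁ ×ˢ V₂) where
  isOpen := hw.metric₁.isOpen.prod hw.metric₂.isOpen
  smooth z hz := by
    refine contDiffAt_of_apply₂ (hw.metric₁.isOpen.prod hw.metric₂.isOpen) (fun u v y hy => ?_) hz
    have h1 : (fun y => G y u v) =ᶠ[nhds y]
        fun z => G₁ z.1 u.1 v.1 + f z.1 ^ 2 * G₂ z.2 u.2 v.2 := by
      filter_upwards [(hw.metric₁.isOpen.prod hw.metric₂.isOpen).mem_nhds hy] with z hz
        using hw.apply z hz u v
    refine ContDiffAt.congr_of_eventuallyEq ?_ h1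
    have e1 : ContDiffAt ℝ ∞ (fun z : E₁ × E₂ => G₁ z.1) y :=
      (hw.metric₁.smooth y.1 hy.1).comp y contDiffAt_fst
    have e2 : ContDiffAt ℝ ∞ (fun z : E₁ × E₂ => G₂ z.2) y :=
      (hw.metric₂.smooth y.2 hy.2).comp y contDiffAt_snd
    have e3 : ContDiffAt ℝ ∞ (fun z : E₁ × E₂ => f z.1) y :=
      (hw.smooth y.1 hy.1).comp y contDiffAt_fst
    exact ((e1.clm_apply contDiffAt_const).clm_apply contDiffAt_const).add
      ((e3.pow 2).mul ((e2.clm_apply contDiffAt_const).clm_apply contDiffAt_const))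
  symm z hz u v := by
    rw [hw.apply z hz, hw.apply z hz, hw.metric₁.symm _ hz.1, hw.metric₂.symm _ hz.2]
  pos z hz u hu := by
    rw [hw.apply z hz]
    have hf := pow_pos (hw.pos z.1 hz.1) 2
    by_cases h1 : u.1 = 0
    · have h2 : u.2 ≠ 0 := fun h2 => hu (Prod.ext h1 h2)
      simpa [h1] using mul_pos hf (hw.metric₂.pos z.2 hz.2 _ h2)
    · have := hw.metric₁.pos z.1 hz.1 _ h1
      rcases eq_or_ne u.2 0 with h2 | h2
      · simpa [h2] using this
      · exact add_pos this (mul_pos hf (hw.metric₂.pos z.2 hz.2 _ h2))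

variable {z : E₁ × E₂} (hz : z ∈ V₁ ×ˢ V₂)

include hz

lemma fderiv_apply (u v w : E₁ × E₂) : fderiv ℝ G z u v w
    = fderiv ℝ G₁ z.1 u.1 v.1 w.1 + 2 * f z.1 * fderiv ℝ f z.1 u.1 * G₂ z.2 v.2 w.2
      + f z.1 ^ 2 * fderiv ℝ G₂ z.2 u.2 v.2 w.2 := by
  have hd := (hw.isMetricOn.smooth z hz).diff
  have h0 : fderiv ℝ (fun y => G y v w) z u = fderiv ℝ G z u v w := by
    rw [fderiv_clm_apply₂ u hd (differentiableAt_const v) (differentiableAt_const w)]; simp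
  have h1 : (fun y => G y v w) =ᶠ[nhds z]
      fun z => G₁ z.1 v.1 w.1 + f z.1 ^ 2 * G₂ z.2 v.2 w.2 := by
    filter_upwards [hw.isMetricOn.isOpen.mem_nhds hz] with z hz using hw.apply z hz v w
  have e1 : HasFDerivAt (fun y : E₁ × E₂ => G₁ y.1)
      ((fderiv ℝ G₁ z.1).comp (ContinuousLinearMap.fst ℝ E₁ E₂)) z :=
    (hw.metric₁.smooth z.1 hz.1).diff.hasFDerivAt.comp z hasFDerivAt_fst
  have e2 : HasFDerivAt (fun y : E₁ × E₂ => G₂ y.2)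
      ((fderiv ℝ G₂ z.2).comp (ContinuousLinearMap.snd ℝ E₁ E₂)) z :=
    (hw.metric₂.smooth z.2 hz.2).diff.hasFDerivAt.comp z hasFDerivAt_snd
  have e3 : HasFDerivAt (fun y : E₁ × E₂ => f y.1)
      ((fderiv ℝ f z.1).comp (ContinuousLinearMap.fst ℝ E₁ E₂)) z :=
    (hw.smooth z.1 hz.1).diff.hasFDerivAt.comp z hasFDerivAt_fst
  have e4 : DifferentiableAt ℝ (fun y : E₁ × E₂ => G₁ y.1 v.1 w.1) z :=
    (e1.differentiableAt.clm_apply (differentiableAt_const _)).clm_apply (differentiableAt_const _)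
  have e5 : DifferentiableAt ℝ (fun y : E₁ × E₂ => G₂ y.2 v.2 w.2) z :=
    (e2.differentiableAt.clm_apply (differentiableAt_const _)).clm_apply (differentiableAt_const _)
  have e6 : DifferentiableAt ℝ (fun y : E₁ × E₂ => f y.1 ^ 2) z := e3.differentiableAt.pow 2
  have e7 : fderiv ℝ (fun y : E₁ × E₂ => f y.1 ^ 2) z u = 2 * f z.1 * fderiv ℝ f z.1 u.1 := by
    simp only [sq]
    rw [fderiv_fun_mul e3.differentiableAt e3.differentiableAt, e3.fderiv]
    simp
    ring
  have e8 : DifferentiableAt ℝ (fun y : E₁ × E₂ => f y.1 ^ 2 * G₂ y.2 v.2 w.2) z := e6.mul e5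
  rw [← h0, h1.fderiv_eq, fderiv_fun_add e4 e8, _root_.add_apply,
    fderiv_fun_mul e6 e5, _root_.add_apply, _root_.smul_apply, _root_.smul_apply, e7,
    fderiv_clm_apply₂ u e1.differentiableAt (differentiableAt_const _) (differentiableAt_const _),
    fderiv_clm_apply₂ u e2.differentiableAt (differentiableAt_const _) (differentiableAt_const _),
    e1.fderiv, e2.fderiv]
  simp
  ring

/-- The Christoffel symbols of a warped product. -/
lemma christoffel_eq (u v : E₁ × E₂) : christoffel G z u v
    = (christoffel G₁ z.1 u.1 v.1 - (f z.1 * G₂ z.2 u.2 v.2) • gradient G₁ f z.1,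
        christoffel G₂ z.2 u.2 v.2 + (fderiv ℝ f z.1 u.1 / f z.1) • v.2
          + (fderiv ℝ f z.1 v.1 / f z.1) • u.2) := by
  refine hw.isMetricOn.eq_of_forall_inner hz fun w => ?_
  have hf := (hw.pos z.1 hz.1).ne'
  rw [hw.isMetricOn.inner_christoffel hz, hw.apply z hz]
  simp only [gradient, map_sub, map_add, map_smul, _root_.sub_apply, _root_.add_apply,
    _root_.smul_apply, hw.metric₁.inner_christoffel hz.1, hw.metric₂.inner_christoffel hz.2,
    hw.metric₁.inner_sharp hz.1, koszul, ContinuousLinearMap.flip_apply, smul_eq_mul,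
    hw.fderiv_apply hz]
  field_simp
  ring

/-- The curvature of a warped product on a horizontal vector. -/
lemma curvature_horizontal (u v : E₁ × E₂) (X : E₁) : curvature G z u v (X, 0)
    = (curvature G₁ z.1 u.1 v.1 X, (1 / f z.1) • (hessian G₁ f z.1 u.1 X • v.2
        - hessian G₁ f z.1 v.1 X • u.2)) := by
  have hf := (hw.pos z.1 hz.1).ne'
  set q : E₁ → ℝ := fun x => fderiv ℝ f x X / f x with hq
  have hX : ContDiffAt ℝ ∞ (fun x => fderiv ℝ f x X) z.1 :=
    (hw.smooth z.1 hz.1).fderiv_top.clm_apply contDiffAt_const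
  have hqd : DifferentiableAt ℝ q z.1 := (hX.div (hw.smooth z.1 hz.1) hf).diff
  have hqf : ∀ a, fderiv ℝ q z.1 a * f z.1
      = fderiv ℝ (fderiv ℝ f) z.1 a X - q z.1 * fderiv ℝ f z.1 a := by
    intro a
    have h1 : (fun x => q x * f x) =ᶠ[nhds z.1] fun x => fderiv ℝ f x X := by
      filter_upwards [hw.metric₁.isOpen.mem_nhds hz.1] with x hx
      exact div_mul_cancel₀ _ (hw.pos x hx).ne'
    have h2 := h1.fderiv_eq (𝕜 := ℝ)
    rw [fderiv_fun_mul hqd (hw.smooth z.1 hz.1).diff] at h2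
    have h3 := congrArg (fun L : E₁ →L[ℝ] ℝ => L a) h2
    simp only [_root_.add_apply, _root_.smul_apply, smul_eq_mul,
      fderiv_fderiv_apply (hw.smooth z.1 hz.1)] at h3
    linarith
  have key : ∀ u v : E₁ × E₂, covDeriv G id (fun y => covDeriv G id (fun _ => (X, (0 : E₂))) y v) z u
      = (covDeriv G₁ id (fun y => covDeriv G₁ id (fun _ => X) y v.1) z.1 u.1
          - (f z.1 * G₂ z.2 u.2 (q z.1 • v.2)) • gradient G₁ f z.1,
        fderiv ℝ q z.1 u.1 • v.2 + (christoffel G₂ z.2 u.2 (q z.1 • v.2)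
          + (fderiv ℝ f z.1 u.1 / f z.1) • (q z.1 • v.2)
          + (fderiv ℝ f z.1 (christoffel G₁ z.1 v.1 X) / f z.1) • u.2)) := by
    intro u v
    have h1 : (fun y => covDeriv G id (fun _ => (X, (0 : E₂))) y v)
        =ᶠ[nhds z] fun y => (christoffelL G₁ y.1 v.1 X, q y.1 • v.2) := by
      filter_upwards [hw.isMetricOn.isOpen.mem_nhds hz] with y hy
      simp only [covDeriv, fderiv_fun_const, fderiv_id, Pi.zero_apply, _root_.zero_apply, id,
        ContinuousLinearMap.id_apply, zero_add]
      rw [hw.christoffel_eq hy, christoffelL_apply]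
      simp [← christoffelL_apply, hq]
    have hΓ : DifferentiableAt ℝ (fun x => christoffelL G₁ x v.1 X) z.1 :=
      ((hw.metric₁.contDiffAt_christoffelL hz.1).diff.clm_apply
        (differentiableAt_const _)).clm_apply (differentiableAt_const _)
    have e1 : HasFDerivAt (fun y : E₁ × E₂ => christoffelL G₁ y.1 v.1 X)
        ((fderiv ℝ (fun x => christoffelL G₁ x v.1 X) z.1).comp
          (ContinuousLinearMap.fst ℝ E₁ E₂)) z :=
      hΓ.hasFDerivAt.comp z hasFDerivAt_fst
    have e2 : HasFDerivAt (fun y : E₁ × E₂ => q y.1)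
        ((fderiv ℝ q z.1).comp (ContinuousLinearMap.fst ℝ E₁ E₂)) z :=
      hqd.hasFDerivAt.comp z hasFDerivAt_fst
    have e3 := e1.prodMk (e2.smul_const v.2)
    rw [covDeriv_congr h1, covDeriv, e3.fderiv, id_eq z, hw.christoffel_eq hz]
    simp only [covDeriv, fderiv_fun_const, fderiv_id, Pi.zero_apply, _root_.zero_apply, id,
        ContinuousLinearMap.id_apply, zero_add, christoffelL_apply]
    ext1
    · simp
      abel
    · simp
  rw [curvature, key, key, curvature]
  ext1
  · simp only [map_smul, smul_eq_mul, Prod.fst_sub]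
    rw [hw.metric₂.symm _ hz.2 v.2 u.2]
    abel
  · have hq' : ∀ a, fderiv ℝ q z.1 a
        = (fderiv ℝ (fderiv ℝ f) z.1 a X - q z.1 * fderiv ℝ f z.1 a) / f z.1 := fun a => by
      rw [← hqf, mul_div_cancel_right₀ _ hf]
    simp only [Prod.snd_sub, hq', christoffel_smul_right, hw.metric₂.christoffel_symm hz.2 v.2 u.2,
      hessian]
    rw [hw.metric₁.christoffel_symm hz.1 v.1 X, hw.metric₁.christoffel_symm hz.1 u.1 X]
    module

omit [FiniteDimensional ℝ E₁] [FiniteDimensional ℝ E₂] in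
lemma hessian_symm (u v : E₁) : hessian G₁ f z.1 u v = hessian G₁ f z.1 v u := by
  rw [hessian, hessian, hw.metric₁.christoffel_symm hz.1, fderiv_fderiv_symm (hw.smooth z.1 hz.1)]

/-- The Ricci tensor of a warped product on a horizontal vector. -/
lemma ricci_horizontal (Z : E₁ × E₂) (X : E₁) : ricci G z Z (X, 0)
    = ricci G₁ z.1 Z.1 X - (Module.finrank ℝ E₂ / f z.1) * hessian G₁ f z.1 Z.1 X := by
  obtain ⟨R, hR⟩ := hw.isMetricOn.exists_curvature_trilinear hz
  obtain ⟨R₁, hR₁⟩ := hw.metric₁.exists_curvature_trilinear hz.1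
  set A : (E₁ × E₂) →ₗ[ℝ] (E₁ × E₂) := (R.flip Z).flip (X, 0) with hA
  have hA' : ∀ u, A u = curvature G z u Z (X, 0) := fun u => by simp [hA, hR]
  rw [ricci_eq_trace hA', ricci_eq_trace (A := (R₁.flip Z.1).flip X) (fun u => by simp [hR₁])]
  have hsplit : A = (A ∘ₗ LinearMap.inl ℝ E₁ E₂) ∘ₗ LinearMap.fst ℝ E₁ E₂
      + (A ∘ₗ LinearMap.inr ℝ E₁ E₂) ∘ₗ LinearMap.snd ℝ E₁ E₂ := by
    refine LinearMap.ext fun u => ?_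
    simp only [LinearMap.add_apply, LinearMap.comp_apply, ← map_add]
    simp
  have h1 : LinearMap.fst ℝ E₁ E₂ ∘ₗ A ∘ₗ LinearMap.inl ℝ E₁ E₂ = (R₁.flip Z.1).flip X := by
    ext u
    simp [hA', hw.curvature_horizontal hz, hR₁]
  have h2 : LinearMap.snd ℝ E₁ E₂ ∘ₗ A ∘ₗ LinearMap.inr ℝ E₁ E₂
      = (-(hessian G₁ f z.1 Z.1 X / f z.1)) • LinearMap.id := by
    ext u
    simp only [LinearMap.comp_apply, LinearMap.inr_apply, LinearMap.snd_apply, hA',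
      hw.curvature_horizontal hz, LinearMap.smul_apply, LinearMap.id_apply]
    have : hessian G₁ f z.1 0 X = 0 := by simp [hessian, ← christoffelL_apply]
    rw [this]
    module
  rw [hsplit, map_add, LinearMap.trace_comp_comm' (LinearMap.fst ℝ E₁ E₂),
    LinearMap.trace_comp_comm' (LinearMap.snd ℝ E₁ E₂), h1, h2, map_smul,
    LinearMap.trace_id, smul_eq_mul]
  ring

/-- The covariant derivative, in a horizontal direction, of the gradient of a warping function. -/
lemma inner_covDeriv_gradient (Z : E₁ × E₂) (X : E₁) :
    G z (covDeriv G id (gradient G (fun y => f y.1)) z (X, 0)) Z = hessian G₁ f z.1 Z.1 X := by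
  have hG := hw.isMetricOn
  have hfs : ∀ y ∈ V₁ ×ˢ V₂, ContDiffAt ℝ ∞ (fun y : E₁ × E₂ => f y.1) y := fun y hy =>
    (hw.smooth y.1 hy.1).comp y contDiffAt_fst
  have hfd : ∀ y ∈ V₁ ×ˢ V₂, ∀ u, fderiv ℝ (fun y : E₁ × E₂ => f y.1) y u
      = fderiv ℝ f y.1 u.1 := fun y hy u => by
    have e : HasFDerivAt (fun y : E₁ × E₂ => f y.1)
        ((fderiv ℝ f y.1).comp (ContinuousLinearMap.fst ℝ E₁ E₂)) y :=
      (hw.smooth y.1 hy.1).diff.hasFDerivAt.comp y hasFDerivAt_fst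
    rw [e.fderiv]; rfl
  have hgrad : ContDiffAt ℝ ∞ (gradient G (fun y => f y.1)) z :=
    (hG.contDiffAt_sharp hz).clm_apply (hfs z hz).fderiv_top
  have h1 := hG.fderiv_inner_along (ψ := id) hz differentiableAt_id hgrad.diff
    (differentiableAt_const Z) (X, 0)
  have h2 : (fun y => G (id y) (gradient G (fun y => f y.1) y) Z)
      =ᶠ[nhds z] fun y => fderiv ℝ f y.1 Z.1 := by
    filter_upwards [hG.isOpen.mem_nhds hz] with y hy
    rw [id, gradient, hG.inner_sharp hy, hfd y hy]
  have e2 : HasFDerivAt (fun y : E₁ × E₂ => fderiv ℝ f y.1 Z.1)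
      ((fderiv ℝ (fun x => fderiv ℝ f x Z.1) z.1).comp (ContinuousLinearMap.fst ℝ E₁ E₂)) z :=
    ((hw.smooth z.1 hz.1).fderiv_top.diff.clm_apply (differentiableAt_const _)).hasFDerivAt.comp z
      hasFDerivAt_fst
  rw [h2.fderiv_eq, e2.fderiv, ContinuousLinearMap.comp_apply, ContinuousLinearMap.coe_fst',
    fderiv_fderiv_apply (hw.smooth z.1 hz.1)] at h1
  have h3 : ∀ Y, G z (gradient G (fun y => f y.1) z) Y = fderiv ℝ f z.1 Y.1 := fun Y => by
    rw [gradient, hG.inner_sharp hz, hfd z hz]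
  have h4 : (covDeriv G id (fun _ => Z) z (X, 0)).1 = christoffel G₁ z.1 X Z.1 := by
    simp [covDeriv, hw.christoffel_eq hz]
  change _ = G z _ Z + G z _ _ at h1
  rw [h3, h4] at h1
  rw [hw.hessian_symm hz, hessian]
  linarith

end IsWarpedOn

end Warped

section Sasakian

variable {E : Type*} [NormedAddCommGroup E] [NormedSpace ℝ E] [FiniteDimensional ℝ E]
  {g : E → E →L[ℝ] E →L[ℝ] ℝ} {φ : E → E →L[ℝ] E} {ξ : E → E} {η : E → E →L[ℝ] ℝ} {U : Set E}
  {c : ℝ}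

/-- A Sasakian structure, in coordinates, on the set `U`. -/
structure IsSasakianOn (g : E → E →L[ℝ] E →L[ℝ] ℝ) (φ : E → E →L[ℝ] E) (ξ : E → E)
    (η : E → E →L[ℝ] ℝ) (U : Set E) : Prop where
  metric : IsMetricOn g U
  smooth_φ : ∀ x ∈ U, ContDiffAt ℝ ∞ φ x
  smooth_ξ : ∀ x ∈ U, ContDiffAt ℝ ∞ ξ x
  smooth_η : ∀ x ∈ U, ContDiffAt ℝ ∞ η x
  φ_sq : ∀ x ∈ U, ∀ u, φ x (φ x u) = -u + η x u • ξ x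
  η_ξ : ∀ x ∈ U, η x (ξ x) = 1
  η_φ : ∀ x ∈ U, ∀ u, η x (φ x u) = 0
  η_eq : ∀ x ∈ U, ∀ u, η x u = g x (ξ x) u
  compatible : ∀ x ∈ U, ∀ u v, g x (φ x u) (φ x v) = g x u v - η x u * η x v
  contact : ∀ x ∈ U, ∀ X Y : E → E, ContDiff ℝ ∞ X → ContDiff ℝ ∞ Y →
    g x (X x) (φ x (Y x)) = extDeriv η X Y x
  normal : ∀ x ∈ U, ∀ X Y : E → E, ContDiff ℝ ∞ X → ContDiff ℝ ∞ Y →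
    nijenhuis φ X Y x + (2 * extDeriv η X Y x) • ξ x = 0

/-- The covariant derivative `(∇_u φ)v` of a field of endomorphisms. -/
def covDerivEnd (g : E → E →L[ℝ] E →L[ℝ] ℝ) (φ : E → E →L[ℝ] E) (x u v : E) : E :=
  fderiv ℝ φ x u v + christoffelL g x u (φ x v) - φ x (christoffelL g x u v)

omit [FiniteDimensional ℝ E] in
lemma covDeriv_end_apply {x : E} {W : E → E} (hφ : DifferentiableAt ℝ φ x)
    (hW : DifferentiableAt ℝ W x) (u : E) :
    covDeriv g id (fun y => φ y (W y)) x u = covDerivEnd g φ x u (W x)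
      + φ x (covDeriv g id W x u) := by
  rw [covDeriv_eq, fderiv_clm_apply' u hφ hW, covDeriv_eq]
  simp only [covDerivEnd, fderiv_id, id, ContinuousLinearMap.id_apply, map_add]
  abel

omit [FiniteDimensional ℝ E] in
lemma covDeriv_id_const (x u v : E) :
    covDeriv g id (fun _ => v) x u = christoffel g x u v := by
  simp [covDeriv]

namespace IsSasakianOn

variable (hS : IsSasakianOn g φ ξ η U) {x : E} (hx : x ∈ U)

include hS hx

omit [FiniteDimensional ℝ E] in
lemma skew (u v : E) : g x (φ x u) v = -g x u (φ x v) := by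
  have h := hS.compatible x hx (φ x u) v
  rw [hS.φ_sq x hx, hS.η_φ x hx] at h
  simp only [map_add, map_neg, map_smul, _root_.add_apply, _root_.neg_apply, _root_.smul_apply,
    ← hS.η_eq x hx, hS.η_φ x hx, smul_eq_mul] at h
  linarith

omit [FiniteDimensional ℝ E] in
lemma φ_ξ : φ x (ξ x) = 0 := by
  refine hS.metric.eq_zero_of_self hx ?_
  rw [hS.compatible x hx, ← hS.η_eq x hx, hS.η_ξ x hx]
  ring

omit [FiniteDimensional ℝ E] in
lemma contact_const (u v : E) :
    2 * g x u (φ x v) = fderiv ℝ η x u v - fderiv ℝ η x v u := by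
  have h := hS.contact x hx (fun _ => u) (fun _ => v) contDiff_const contDiff_const
  have hd := (hS.smooth_η x hx).diff
  rw [extDeriv, fderiv_clm_apply' _ hd (differentiableAt_const _),
    fderiv_clm_apply' _ hd (differentiableAt_const _)] at h
  simp [VectorField.lieBracket] at h
  linarith

omit [FiniteDimensional ℝ E] in
lemma normal_const (u v : E) :
    fderiv ℝ φ x (φ x u) v - fderiv ℝ φ x (φ x v) u + φ x (fderiv ℝ φ x v u)
      - φ x (fderiv ℝ φ x u v) + (2 * g x u (φ x v)) • ξ x = 0 := by
  have h := hS.normal x hx (fun _ => u) (fun _ => v) contDiff_const contDiff_const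
  rw [← hS.contact x hx (fun _ => u) (fun _ => v) contDiff_const contDiff_const] at h
  have hd := (hS.smooth_φ x hx).diff
  have h1 : ∀ v w, fderiv ℝ (fun y => φ y v) x w = fderiv ℝ φ x w v := fun v w => by
    rw [fderiv_clm_apply' _ hd (differentiableAt_const _)]; simp
  simp only [nijenhuis, VectorField.lieBracket, h1, fderiv_fun_const, Pi.zero_apply,
    _root_.zero_apply, sub_zero, zero_sub, map_neg, map_zero, add_zero, sub_neg_eq_add] at h
  exact h

lemma fderiv_form (u v : E) : fderiv ℝ η x u v
    = g x (covDeriv g id ξ x u) v + η x (christoffelL g x u v) := by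
  have h1 : (fun y => g (id y) (ξ y) v) =ᶠ[nhds x] fun y => η y v := by
    filter_upwards [hS.metric.isOpen.mem_nhds hx] with y hy using (hS.η_eq y hy v).symm
  have h2 := hS.metric.fderiv_inner_along (ψ := id) hx differentiableAt_id
    (hS.smooth_ξ x hx).diff (differentiableAt_const v) u
  rw [h1.fderiv_eq, fderiv_clm_apply' _ (hS.smooth_η x hx).diff (differentiableAt_const _),
    covDeriv_id_const] at h2
  rw [hS.η_eq x hx, christoffelL_apply]
  simpa using h2

lemma inner_nabla_ξ_ξ (u : E) : g x (covDeriv g id ξ x u) (ξ x) = 0 := by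
  have h1 : (fun y => g (id y) (ξ y) (ξ y)) =ᶠ[nhds x] fun _ => 1 := by
    filter_upwards [hS.metric.isOpen.mem_nhds hx] with y hy
    rw [id, ← hS.η_eq y hy, hS.η_ξ y hy]
  have h2 := hS.metric.fderiv_inner_along (ψ := id) hx differentiableAt_id
    (hS.smooth_ξ x hx).diff (hS.smooth_ξ x hx).diff u
  rw [h1.fderiv_eq, id, hS.metric.symm x hx (ξ x)] at h2
  simp at h2
  linarith

omit [FiniteDimensional ℝ E] in
lemma covDerivEnd_ξ (u : E) : covDerivEnd g φ x u (ξ x) = -φ x (covDeriv g id ξ x u) := by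
  have h1 : (fun y => φ y (ξ y)) =ᶠ[nhds x] fun _ => 0 := by
    filter_upwards [hS.metric.isOpen.mem_nhds hx] with y hy using hS.φ_ξ hy
  have h2 := covDeriv_end_apply (g := g) (hS.smooth_φ x hx).diff (hS.smooth_ξ x hx).diff u
  rw [covDeriv_congr h1, covDeriv_id_const, ← christoffelL_apply, map_zero] at h2
  exact eq_neg_of_add_eq_zero_left h2.symm

lemma covDerivEnd_skew (u v w : E) :
    g x (covDerivEnd g φ x u v) w = -g x (covDerivEnd g φ x u w) v := by
  have hd := (hS.smooth_φ x hx).diff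
  have hv : ∀ v, DifferentiableAt ℝ (fun y => φ y v) x := fun v =>
    hd.clm_apply (differentiableAt_const v)
  have h1 : (fun y => g (id y) (φ y v) w) =ᶠ[nhds x] fun y => -g (id y) (φ y w) v := by
    filter_upwards [hS.metric.isOpen.mem_nhds hx] with y hy
    rw [id, hS.skew hy, hS.metric.symm y hy v]
  have h2 := hS.metric.fderiv_inner_along (ψ := id) hx differentiableAt_id
    (hv v) (differentiableAt_const w) u
  have h3 := hS.metric.fderiv_inner_along (ψ := id) hx differentiableAt_id
    (hv w) (differentiableAt_const v) u
  rw [h1.fderiv_eq, fderiv_fun_neg, _root_.neg_apply, h3,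
    covDeriv_end_apply hd (differentiableAt_const v),
    covDeriv_end_apply hd (differentiableAt_const w), covDeriv_id_const, covDeriv_id_const] at h2
  simp only [id, map_add, _root_.add_apply] at h2
  have h4 := hS.skew hx (christoffel g x u v) w
  have h5 := hS.skew hx (christoffel g x u w) v
  have h6 := hS.metric.symm x hx (christoffel g x u v) (φ x w)
  have h7 := hS.metric.symm x hx (christoffel g x u w) (φ x v)
  linarith

lemma covDerivEnd_φ (u v : E) : covDerivEnd g φ x u (φ x v) + φ x (covDerivEnd g φ x u v)
    = g x (covDeriv g id ξ x u) v • ξ x + η x v • covDeriv g id ξ x u := by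
  have hd := (hS.smooth_φ x hx).diff
  have hηv : DifferentiableAt ℝ (fun y => η y v) x :=
    (hS.smooth_η x hx).diff.clm_apply (differentiableAt_const v)
  have h1 : (fun y => φ y (φ y v)) =ᶠ[nhds x] fun y => -v + η y v • ξ y := by
    filter_upwards [hS.metric.isOpen.mem_nhds hx] with y hy using hS.φ_sq y hy v
  have h2 := covDeriv_end_apply (g := g) hd (hd.clm_apply (differentiableAt_const v)) u
  rw [covDeriv_congr h1, covDeriv_end_apply hd (differentiableAt_const v), covDeriv_id_const,
    covDeriv_add (differentiableAt_const _) (hηv.fun_smul (hS.smooth_ξ x hx).diff),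
    covDeriv_smul hηv (hS.smooth_ξ x hx).diff, covDeriv_id_const,
    fderiv_clm_apply' _ (hS.smooth_η x hx).diff (differentiableAt_const _), hS.fderiv_form hx,
    map_add, hS.φ_sq x hx] at h2
  simp only [← christoffelL_apply, map_neg, fderiv_fun_const, Pi.zero_apply, _root_.zero_apply,
    map_zero, add_zero] at h2
  rw [← sub_eq_zero] at h2 ⊢
  rw [← neg_eq_zero, ← h2]
  module

lemma closed (u v w : E) : g x (covDerivEnd g φ x u v) w + g x (covDerivEnd g φ x v w) u
    + g x (covDerivEnd g φ x w u) v = 0 := by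
  have hd := (hS.smooth_φ x hx).diff
  have hη := (hS.smooth_η x hx)
  have h1 : ∀ u v w, fderiv ℝ (fderiv ℝ η) x u v w - fderiv ℝ (fderiv ℝ η) x u w v
      = 2 * (g x (christoffel g x u v) (φ x w) + g x (covDerivEnd g φ x u w) v
        - g x (christoffel g x u w) (φ x v)) := by
    intro u v w
    have e1 : (fun y => fderiv ℝ η y v w - fderiv ℝ η y w v)
        =ᶠ[nhds x] fun y => 2 * g (id y) v (φ y w) := by
      filter_upwards [hS.metric.isOpen.mem_nhds hx] with y hy using (hS.contact_const hy v w).symm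
    have e2 := e1.fderiv_eq (𝕜 := ℝ)
    have e3 := congrArg (fun L : E →L[ℝ] ℝ => L u) e2
    have hη' : ∀ a, DifferentiableAt ℝ (fun y => fderiv ℝ η y a) x := fun a =>
      hη.fderiv_top.diff.clm_apply (differentiableAt_const a)
    have hη'' : ∀ a b, DifferentiableAt ℝ (fun y => fderiv ℝ η y a b) x := fun a b =>
      (hη' a).clm_apply (differentiableAt_const b)
    have hφw : DifferentiableAt ℝ (fun y => φ y w) x := hd.clm_apply (differentiableAt_const w)
    have hgφ : DifferentiableAt ℝ (fun y => g (id y) v (φ y w)) x :=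
      ((hS.metric.smooth x hx).diff.clm_apply (differentiableAt_const v)).clm_apply hφw
    have e4 : ∀ a b, fderiv ℝ (fun y => fderiv ℝ η y a b) x u = fderiv ℝ (fderiv ℝ η) x u a b := by
      intro a b
      rw [fderiv_clm_apply' _ (hη' a) (differentiableAt_const b), fderiv_fderiv_apply hη]
      simp
    simp only [fderiv_fun_sub (hη'' v w) (hη'' w v), fderiv_const_mul hgφ, _root_.sub_apply,
      _root_.smul_apply, e4, smul_eq_mul] at e3
    rw [e3, hS.metric.fderiv_inner_along (ψ := id) hx differentiableAt_id
      (differentiableAt_const v) hφw u, covDeriv_end_apply hd (differentiableAt_const w),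
      covDeriv_id_const, covDeriv_id_const]
    simp only [id, map_add]
    rw [hS.metric.symm x hx v, hS.metric.symm x hx v, hS.skew hx]
    ring
  have h2 := h1 u v w
  have h3 := h1 v w u
  have h4 := h1 w u v
  rw [fderiv_fderiv_symm hη v u, hS.metric.christoffel_symm hx v u] at h3
  rw [fderiv_fderiv_symm hη w u, fderiv_fderiv_symm hη w v, hS.metric.christoffel_symm hx w u,
    hS.metric.christoffel_symm hx w v] at h4
  have k1 := hS.covDerivEnd_skew hx u v w
  have k2 := hS.covDerivEnd_skew hx v w u
  have k3 := hS.covDerivEnd_skew hx w u v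
  linarith

omit [FiniteDimensional ℝ E] in
lemma normal_covDerivEnd (u v : E) :
    covDerivEnd g φ x (φ x u) v - covDerivEnd g φ x (φ x v) u + φ x (covDerivEnd g φ x v u)
      - φ x (covDerivEnd g φ x u v) + (2 * g x u (φ x v)) • ξ x = 0 := by
  rw [← hS.normal_const hx u v]
  simp only [covDerivEnd, map_add, map_sub, christoffelL_apply]
  rw [hS.metric.christoffel_symm hx (φ x v) (φ x u), hS.metric.christoffel_symm hx (φ x v) u,
    hS.metric.christoffel_symm hx v (φ x u), hS.metric.christoffel_symm hx v u]
  abel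

lemma inner_nabla_ξ (u v : E) : g x (covDeriv g id ξ x u) v = g x u (φ x v) := by
  set h : E → E → ℝ := fun u v => g x (covDeriv g id ξ x u) v with hh
  have hadd : ∀ a b v, h (a + b) v = h a v + h b v := fun a b v => by
    simp only [hh, covDeriv_add_left, map_add, _root_.add_apply]
  have hsmul : ∀ (t : ℝ) a v, h (t • a) v = t * h a v := fun t a v => by
    simp only [hh, covDeriv_smul_left, map_smul, _root_.smul_apply, smul_eq_mul]
  have hneg : ∀ a v, h (-a) v = -h a v := fun a v => by
    rw [← neg_one_smul ℝ a, hsmul]; ring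
  have hanti : ∀ u v, h u v - h v u = 2 * g x u (φ x v) := fun u v => by
    have h1 := hS.contact_const hx u v
    rw [hS.fderiv_form hx, hS.fderiv_form hx, christoffelL_apply, christoffelL_apply,
      hS.metric.christoffel_symm hx v u] at h1
    simp only [hh]
    linarith
  have hξr : ∀ u, h u (ξ x) = 0 := fun u => hS.inner_nabla_ξ_ξ hx u
  have hξl : ∀ u, h (ξ x) u = 0 := fun u => by
    have := hanti u (ξ x)
    rw [hS.φ_ξ hx, map_zero, hξr] at this
    linarith
  have hαξ : ∀ u v, g x (covDerivEnd g φ x u v) (ξ x) = -h u (φ x v) := fun u v => by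
    rw [hS.covDerivEnd_skew hx, hS.covDerivEnd_ξ hx]
    simp only [hh, map_neg, _root_.neg_apply, hS.skew hx]
    ring
  have hφφ : ∀ u v, h u (φ x (φ x v)) = -h u v := fun u v => by
    rw [hS.φ_sq x hx]
    have := hξr u
    simp only [hh] at this ⊢
    simp [this]
  have hφφ' : ∀ u v, h (φ x (φ x u)) v = -h u v := fun u v => by
    rw [hS.φ_sq x hx, hadd, hsmul, hξl, hneg]
    ring
  have hsym : ∀ u v, h (φ x u) (φ x v) + h (φ x v) (φ x u) = 0 := by
    intro u v
    have h1 := congrArg (fun t => g x t v) (hS.normal_covDerivEnd hx u (ξ x))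
    simp only [hS.φ_ξ hx, map_add, map_sub, map_neg, map_zero, _root_.add_apply,
      _root_.sub_apply, _root_.neg_apply, _root_.zero_apply,
      hS.covDerivEnd_ξ hx, hS.skew hx, mul_zero, zero_smul] at h1
    have h2 : g x (covDerivEnd g φ x 0 u) v = 0 := by simp [covDerivEnd]
    have h3 := hS.closed hx (ξ x) u (φ x v)
    have h4 := hS.covDerivEnd_skew hx (φ x v) (ξ x) u
    rw [hαξ] at h3 h4
    have h5 : g x (covDeriv g id ξ x u) (φ x (φ x v)) = - h u v := hφφ u v
    have h6 := hφφ u v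
    have h7 : g x (covDeriv g id ξ x (φ x u)) (φ x v) = h (φ x u) (φ x v) := rfl
    linarith
  have h1 := hsym (φ x u) (φ x v)
  rw [hφφ', hφφ, hφφ', hφφ] at h1
  have h2 := hanti u v
  change h u v = _
  linarith

/-- `∇_u ξ = -φu`. -/
lemma nabla_ξ (u : E) : covDeriv g id ξ x u = -φ x u := by
  refine hS.metric.eq_of_forall_inner hx fun w => ?_
  rw [hS.inner_nabla_ξ hx, map_neg, _root_.neg_apply, hS.skew hx, neg_neg]

/-- `(∇_u φ)v = g(u, v)ξ - η(v)u`. -/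
lemma covDerivEnd_eq (u v : E) : covDerivEnd g φ x u v = g x u v • ξ x - η x v • u := by
  refine hS.metric.eq_of_forall_inner hx fun w => ?_
  have hskew := hS.covDerivEnd_skew hx
  have hclosed := hS.closed hx
  set α : E → E → E → ℝ := fun u v w => g x (covDerivEnd g φ x u v) w with hα
  have hαξ : ∀ u v, α u v (ξ x) = g x u v - η x u * η x v := fun u v => by
    simp only [hα]
    rw [hS.covDerivEnd_skew hx, hS.covDerivEnd_ξ hx, map_neg, _root_.neg_apply, hS.skew hx,
      hS.inner_nabla_ξ hx, hS.φ_sq x hx]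
    simp only [map_add, map_neg, map_smul, smul_eq_mul, hS.metric.symm x hx u (ξ x),
      ← hS.η_eq x hx]
    ring
  have hφφ : ∀ u v w, α u v (φ x (φ x w)) = -α u v w + η x w * (g x u v - η x u * η x v) := by
    intro u v w
    rw [← hαξ, hS.φ_sq x hx]
    simp [hα]
  have hφ : ∀ u v w, α u (φ x v) w - α u v (φ x w)
      = g x u (φ x v) * η x w + η x v * g x u (φ x w) := by
    intro u v w
    have h1 := congrArg (fun t => g x t w) (hS.covDerivEnd_φ hx u v)
    simp only [map_add, map_smul, _root_.add_apply, _root_.smul_apply, hS.skew hx,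
      hS.inner_nabla_ξ hx, ← hS.η_eq x hx, smul_eq_mul] at h1
    simp only [hα]
    linarith
  have hN : ∀ u v w, α (φ x u) v w - α (φ x v) u w - α v u (φ x w) + α u v (φ x w)
      + 2 * g x u (φ x v) * η x w = 0 := by
    intro u v w
    have h1 := congrArg (fun t => g x t w) (hS.normal_covDerivEnd hx u v)
    simp only [map_add, map_sub, map_smul, _root_.add_apply, _root_.sub_apply, _root_.smul_apply,
      hS.skew hx, ← hS.η_eq x hx, smul_eq_mul, map_zero, _root_.zero_apply] at h1
    simp only [hα]
    linarith
  have e1 := hN v w (φ x u)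
  rw [hφφ, hφφ, hS.η_φ x hx] at e1
  have e2 := hφ (φ x v) w u
  have e3 := hφ (φ x w) v u
  have e4 := hclosed u (φ x v) (φ x w)
  have e4' := hskew (φ x w) u (φ x v)
  have e5 := hφ u v (φ x w)
  rw [hφφ, hS.η_φ x hx] at e5
  have e6 := hclosed u v w
  have e6' := hskew w u v
  change α (φ x w) u (φ x v) = -α (φ x w) (φ x v) u at e4'
  change α w u v = -α w v u at e6'
  change α u (φ x v) (φ x w) + α (φ x v) (φ x w) u + α (φ x w) u (φ x v) = 0 at e4
  change α u v w + α v w u + α w u v = 0 at e6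
  have hs : ∀ a b, g x a (φ x (φ x b)) = -g x a b + η x a * η x b := fun a b => by
    rw [hS.φ_sq x hx]
    simp only [map_add, map_neg, map_smul, smul_eq_mul, hS.metric.symm x hx a (ξ x),
      ← hS.η_eq x hx]
    ring
  rw [hs] at e5
  simp only [hS.compatible x hx] at e2 e3
  rw [hS.metric.symm x hx w v] at e1 e3
  rw [hS.metric.symm x hx v u] at e2
  rw [hS.metric.symm x hx w u] at e3
  change α u v w = _
  simp only [map_sub, map_smul, _root_.sub_apply, _root_.smul_apply, smul_eq_mul,
    ← hS.η_eq x hx]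
  linarith

/-- `R(u, v)ξ = η(v)u - η(u)v`. -/
lemma curvature_ξ (u v : E) : curvature g x u v (ξ x) = η x v • u - η x u • v := by
  have hd := (hS.smooth_φ x hx).diff
  have h := hS.metric.covDeriv_commutator (ψ := id) hx contDiffAt_id (hS.smooth_ξ x hx) u v
  have h1 : ∀ v, (fun y => covDeriv g id ξ y v) =ᶠ[nhds x] fun y => -φ y v := fun v => by
    filter_upwards [hS.metric.isOpen.mem_nhds hx] with y hy using hS.nabla_ξ hy v
  rw [covDeriv_congr (h1 v), covDeriv_congr (h1 u), covDeriv_neg, covDeriv_neg,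
    covDeriv_end_apply hd (differentiableAt_const v),
    covDeriv_end_apply hd (differentiableAt_const u), covDeriv_id_const, covDeriv_id_const,
    hS.covDerivEnd_eq hx, hS.covDerivEnd_eq hx, hS.metric.christoffel_symm hx v u,
    hS.metric.symm x hx v u] at h
  simp only [fderiv_id, id, ContinuousLinearMap.id_apply] at h
  rw [← h]
  abel

/-- The commutation rule of the curvature operator with `φ`. -/
lemma curvature_φ (u v w : E) : curvature g x u v (φ x w) = φ x (curvature g x u v w)
    - g x v w • φ x u + g x u w • φ x v - g x u (φ x w) • v + g x v (φ x w) • u := by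
  have hd := (hS.smooth_φ x hx).diff
  have hφw : ContDiffAt ℝ ∞ (fun y => φ y w) x := (hS.smooth_φ x hx).clm_apply contDiffAt_const
  have h := hS.metric.covDeriv_commutator (ψ := id) hx contDiffAt_id hφw u v
  have h1 : ∀ u v, covDeriv g id (fun y => covDeriv g id (fun y => φ y w) y v) x u
      = (g x (christoffel g x u v) w + g x v (christoffel g x u w)) • ξ x - g x v w • φ x u
        - ((g x u (φ x w) + η x (christoffel g x u w)) • v + η x w • christoffel g x u v)
        + (g x u (christoffel g x v w) • ξ x - η x (christoffel g x v w) • u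
          + φ x (covDeriv g id (fun y => covDeriv g id (fun _ => w) y v) x u)) := by
    intro u v
    have e1 : (fun y => covDeriv g id (fun y => φ y w) y v)
        =ᶠ[nhds x] fun y => g y v w • ξ y - η y w • v
          + φ y (covDeriv g id (fun _ => w) y v) := by
      filter_upwards [hS.metric.isOpen.mem_nhds hx] with y hy
      rw [covDeriv_end_apply (hS.smooth_φ y hy).diff (differentiableAt_const w),
        hS.covDerivEnd_eq hy]
    have d1 : DifferentiableAt ℝ (fun y => g y v w) x :=
      ((hS.metric.smooth x hx).diff.clm_apply (differentiableAt_const v)).clm_apply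
        (differentiableAt_const w)
    have d2 : DifferentiableAt ℝ (fun y => η y w) x :=
      (hS.smooth_η x hx).diff.clm_apply (differentiableAt_const w)
    have d3 : DifferentiableAt ℝ (fun y => covDeriv g id (fun _ => w) y v) x :=
      (hS.metric.contDiffAt_covDeriv (ψ := id) hx contDiffAt_id contDiffAt_const
        contDiffAt_const).diff
    have d4 : DifferentiableAt ℝ (fun y => g y v w • ξ y) x := d1.smul (hS.smooth_ξ x hx).diff
    have d5 : DifferentiableAt ℝ (fun y => η y w • v) x := d2.smul (differentiableAt_const v)
    have e2 : fderiv ℝ (fun y => g y v w) x u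
        = g x (christoffel g x u v) w + g x v (christoffel g x u w) := by
      rw [fderiv_clm_apply₂ u (hS.metric.smooth x hx).diff (differentiableAt_const v)
        (differentiableAt_const w), hS.metric.fderiv_inner hx]
      simp
    have e3 : fderiv ℝ (fun y => η y w) x u = g x u (φ x w) + η x (christoffel g x u w) := by
      rw [fderiv_clm_apply' u (hS.smooth_η x hx).diff (differentiableAt_const w),
        hS.fderiv_form hx, hS.inner_nabla_ξ hx, christoffelL_apply]
      simp
    rw [covDeriv_congr e1, covDeriv_add (d4.fun_sub d5) (hd.clm_apply d3), covDeriv_sub d4 d5,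
      covDeriv_smul d1 (hS.smooth_ξ x hx).diff, covDeriv_smul d2 (differentiableAt_const v),
      covDeriv_end_apply hd d3, e2, e3, hS.covDerivEnd_eq hx, hS.nabla_ξ hx, covDeriv_id_const,
      covDeriv_id_const]
    module
  rw [h1, h1] at h
  simp only [fderiv_id, id, ContinuousLinearMap.id_apply] at h
  rw [← h, curvature, map_sub, hS.metric.christoffel_symm hx v u]
  module

end IsSasakianOn

end Sasakian

section KaehlerLike

/-- A curvature-like tensor which commutes with an almost complex operator `J`, and for which the
holomorphic sectional curvatures vanish, has vanishing sectional curvatures. Here `J² = -1` only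
modulo the kernel of the tensor. -/
lemma sectional_eq_zero_of_holomorphic {E : Type*} [AddCommGroup E] (D : E → E → E → E → ℝ)
    (J : E →+ E) (add₁ : ∀ a b Y Z W, D (a + b) Y Z W = D a Y Z W + D b Y Z W)
    (swap : ∀ X Y Z W, D X Y Z W = -D Y X Z W) (skew : ∀ X Y Z W, D X Y Z W = -D X Y W Z)
    (pair : ∀ X Y Z W, D X Y Z W = D Z W X Y)
    (bianchi : ∀ X Y Z W, D X Y Z W + D Y Z X W + D Z X Y W = 0)
    (comm : ∀ X Y Z W, D X Y (J Z) W = -D X Y Z (J W))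
    (sq : ∀ X Y Z W, D X Y (J (J Z)) W = -D X Y Z W)
    (hol : ∀ X, D (J (J X)) (J (J (J X))) (J (J (J X))) (J (J X)) = 0) (X Y Z : E) :
    D X Y Z X = 0 := by
  have add₂ : ∀ X a b Z W, D X (a + b) Z W = D X a Z W + D X b Z W := fun X a b Z W => by
    rw [swap, add₁, swap X a, swap X b]; ring
  have add₃ : ∀ X Y a b W, D X Y (a + b) W = D X Y a W + D X Y b W := fun X Y a b W => by
    rw [pair, add₁, pair a, pair b]
  have add₄ : ∀ X Y Z a b, D X Y Z (a + b) = D X Y Z a + D X Y Z b := fun X Y Z a b => by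
    rw [skew, add₃, skew X Y Z a, skew X Y Z b]; ring
  have neg₁ : ∀ a Y Z W, D (-a) Y Z W = -D a Y Z W := fun a Y Z W => by
    have h0 := add₁ 0 0 Y Z W
    have h1 := add₁ a (-a) Y Z W
    rw [add_zero] at h0
    rw [add_neg_cancel] at h1
    linarith
  have neg₂ : ∀ X a Z W, D X (-a) Z W = -D X a Z W := fun X a Z W => by
    rw [swap, neg₁, swap X a]
  have neg₃ : ∀ X Y a W, D X Y (-a) W = -D X Y a W := fun X Y a W => by
    rw [pair, neg₁, pair a]
  have neg₄ : ∀ X Y Z a, D X Y Z (-a) = -D X Y Z a := fun X Y Z a => by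
    rw [skew, neg₃, skew X Y Z a]
  have inv' : ∀ X Y Z W, D X Y (J Z) (J W) = D X Y Z W := fun X Y Z W => by
    have h1 := comm X Y (J Z) W
    rw [sq] at h1
    linarith
  have inv : ∀ X Y Z W, D (J X) (J Y) Z W = D X Y Z W := fun X Y Z W => by
    rw [pair, inv', pair]
  have sq₂ : ∀ X Y Z W, D X (J (J Y)) Z W = -D X Y Z W := fun X Y Z W => by
    rw [pair, skew, sq, skew, pair]; ring
  have hol' : ∀ X, D X (J X) (J X) X = 0 := fun X => by
    have h := hol X
    rwa [inv, inv, inv', inv'] at h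
  have sec : ∀ X Y, D X Y Y X + 3 * D X (J Y) (J Y) X = 0 := by
    intro X Y
    have h1 := hol' (X + Y)
    have h2 := hol' (X + -Y)
    simp only [map_add, map_neg, add₁, add₂, add₃, add₄, neg₁, neg₂, neg₃, neg₄, hol'] at h1 h2
    have k1 : D Y (J Y) (J X) X = D X (J X) (J Y) Y := by
      rw [pair, swap, skew]; ring
    have k2 : D Y (J X) (J Y) X = D X (J Y) (J X) Y := by
      rw [pair, swap, skew]; ring
    have k3 : D X (J Y) (J X) Y = D X (J Y) (J Y) X := by
      rw [comm, skew, neg_neg]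
    have k4 : D Y (J X) (J X) Y = D X (J Y) (J Y) X := by
      rw [← inv, sq₂, swap, neg_neg, k3]
    have k5 := bianchi X (J X) (J Y) Y
    have k6 : D (J X) (J Y) X Y = -D X Y Y X := by rw [inv, skew]
    have k7 : D (J Y) X (J X) Y = -D X (J Y) (J X) Y := swap _ _ _ _
    linarith
  have hXX : ∀ X Y, D X Y Y X = 0 := by
    intro X Y
    have h1 := sec X Y
    have h2 := sec X (J Y)
    have h3 : D X (J (J Y)) (J (J Y)) X = D X Y Y X := by
      rw [sq, sq₂, neg_neg]
    linarith
  have h1 := hXX X (Y + Z)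
  simp only [add₂, add₃, hXX] at h1
  have h2 : D X Z Y X = D X Y Z X := by
    rw [pair, swap, skew]; ring
  linarith

end KaehlerLike

section SasakianSpaceForm

variable {E : Type*} [NormedAddCommGroup E] [NormedSpace ℝ E] [FiniteDimensional ℝ E]
  {g : E → E →L[ℝ] E →L[ℝ] ℝ} {φ : E → E →L[ℝ] E} {ξ : E → E} {η : E → E →L[ℝ] ℝ} {U : Set E}
  {c : ℝ}

/-- The curvature tensor `g(R(X, Y)Z, W)` of a Sasakian space form. -/
def sasakianModel (B : E →L[ℝ] E →L[ℝ] ℝ) (J : E →L[ℝ] E) (θ : E →L[ℝ] ℝ) (c : ℝ)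
    (X Y Z W : E) : ℝ :=
  (c + 3) / 4 * (B Y Z * B X W - B X Z * B Y W)
    + (c - 1) / 4 * (θ X * θ Z * B Y W - θ Y * θ Z * B X W + B X Z * θ Y * θ W
      - B Y Z * θ X * θ W + B Z (J Y) * B (J X) W - B Z (J X) * B (J Y) W
      + 2 * B X (J Y) * B (J Z) W)

/-- The curvature tensor of a Sasakian space form, contracted. -/
lemma IsSasakianOn.curvature_eq_model (hS : IsSasakianOn g φ ξ η U) {x : E} (hx : x ∈ U)
    (hc : ∀ u, u ≠ 0 → η x u = 0 → sectionalCurvature g x u (φ x u) = c) (X Y Z : E) :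
    g x (curvature g x X Y Z) X = sasakianModel (g x) (φ x) (η x) c X Y Z X := by
  obtain ⟨R, hR⟩ := hS.metric.exists_curvature_trilinear hx
  have hg := hS.metric.symm x hx
  have hsk := hS.skew hx
  have hco := hS.compatible x hx
  have hηφ := hS.η_φ x hx
  have hsq : ∀ u v, g x u (φ x (φ x v)) = -g x u v + η x u * η x v := fun u v => by
    have := hsk u (φ x v)
    rw [hco] at this
    linarith
  have hp : ∀ u v, g x u (φ x v) = -g x v (φ x u) := fun u v => by
    rw [hg u, hsk]
  set D : E → E → E → E → ℝ := fun X Y Z W =>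
    g x (curvature g x X Y Z) W - sasakianModel (g x) (φ x) (η x) c X Y Z W with hD
  have hmain : D X Y Z X = 0 := by
    refine sectional_eq_zero_of_holomorphic D (φ x : E →+ E) ?_ ?_ ?_ ?_ ?_ ?_ ?_ ?_ X Y Z
    · intro a b Y Z W
      simp only [hD, ← hR, sasakianModel, map_add, LinearMap.add_apply, _root_.add_apply]
      ring
    · intro X Y Z W
      simp only [hD, sasakianModel]
      rw [IsMetricOn.curvature_swap, map_neg, _root_.neg_apply, hp Y X]
      ring
    · intro X Y Z W
      simp only [hD, sasakianModel, hsk]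
      rw [hS.metric.curvature_skew hx, hp W Y, hp W X, hp W Z, hp Z Y, hp Z X]
      ring
    · intro X Y Z W
      simp only [hD, sasakianModel, hsk]
      rw [hS.metric.curvature_pair hx, hg Z X, hg W Y, hg W X, hg Z Y, hp X W, hp Y W, hp Z Y,
        hp Z X, hp X Y, hp Z W]
      ring
    · intro X Y Z W
      have h1 := congrArg (fun t => g x t W) (hS.metric.curvature_bianchi hx X Y Z)
      simp only [map_add, _root_.add_apply, map_zero, _root_.zero_apply] at h1
      simp only [hD, sasakianModel, hsk]
      rw [hg Y X, hg Z X, hg Z Y, hp Y X, hp Z X, hp Z Y]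
      linear_combination h1
    · intro X Y Z W
      change D X Y (φ x Z) W = -D X Y Z (φ x W)
      simp only [hD, sasakianModel]
      rw [hS.curvature_φ hx]
      simp only [map_add, map_sub, map_smul, _root_.add_apply, _root_.sub_apply,
        _root_.smul_apply, smul_eq_mul, hηφ, hsk, hsq]
      simp only [hp Z Y, hp Z X, hg Z Y, hg Z X]
      ring
    · intro X Y Z W
      change D X Y (φ x (φ x Z)) W = -D X Y Z W
      simp only [hD, sasakianModel]
      have h1 := hS.curvature_ξ hx X Y
      rw [hS.φ_sq x hx Z]
      simp only [← hR] at h1 ⊢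
      simp only [map_add, map_neg, map_smul, h1, map_sub, _root_.add_apply, _root_.neg_apply,
        _root_.sub_apply, _root_.smul_apply, smul_eq_mul, hS.φ_ξ hx, map_zero, hS.η_ξ x hx,
        ← hS.η_eq x hx, _root_.zero_apply, hηφ, hg _ (ξ x)]
      ring
    · intro X
      change D (φ x (φ x X)) (φ x (φ x (φ x X))) (φ x (φ x (φ x X))) (φ x (φ x X)) = 0
      generalize hu : φ x (φ x X) = u
      have hη : η x u = 0 := by rw [← hu, hηφ]
      have h0 : g x u (φ x u) = 0 := by linarith [hp u u]
      have h1 : g x (curvature g x u (φ x u) (φ x u)) u = c * g x u u ^ 2 := by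
        by_cases hu0 : u = 0
        · simp [hu0]
        · have h2 := hc u hu0 hη
          have h3 := (hS.metric.pos x hx u hu0).ne'
          rw [sectionalCurvature, hco, hη, h0] at h2
          field_simp at h2
          linear_combination h2
      simp only [hD, sasakianModel]
      rw [h1]
      simp only [hsk, hsq, hηφ, hη, h0]
      ring
  exact sub_eq_zero.mp hmain

/-- The Ricci tensor of a Sasakian space form on vectors orthogonal to `ξ`. -/
lemma IsSasakianOn.ricci_eq (hS : IsSasakianOn g φ ξ η U) {x : E} (hx : x ∈ U) {m : ℕ}
    (hdim : Module.finrank ℝ E = 2 * m + 1)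
    (hc : ∀ u, u ≠ 0 → η x u = 0 → sectionalCurvature g x u (φ x u) = c) (Y : E) {Z : E}
    (hZ : η x Z = 0) :
    ricci g x Y Z = (c * (m + 1) + 3 * m - 1) / 2 * g x Z Y := by
  obtain ⟨e, he⟩ := hS.metric.exists_orthonormal hx
  have hg := hS.metric.symm x hx
  rw [hS.metric.ricci_eq_sum hx he]
  have h1 : ∀ i, g x (curvature g x (e i) Y Z) (e i)
      = (c + 3) / 4 * g x Z Y + (-((c + 3) / 4)) * (g x Z (e i) * g x (e i) Y)
        + (c - 1) / 4 * η x Y * (g x (ξ x) (e i) * g x (e i) Z)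
        + (-((c - 1) / 4 * g x Z Y)) * (g x (ξ x) (e i) * g x (e i) (ξ x))
        + (3 * (c - 1) / 4) * (g x (φ x Z) (e i) * g x (e i) (φ x Y)) := by
    intro i
    have h0 : g x (e i) (φ x (e i)) = 0 := by
      have := hS.skew hx (e i) (e i)
      rw [hg] at this
      linarith
    rw [hS.curvature_eq_model hx hc, sasakianModel, hZ]
    simp only [hS.skew hx, h0, he i i, if_true, hS.η_eq x hx]
    rw [hg (e i) (ξ x), hg (e i) Z, hg Y (e i), hg Y Z]
    have h2 := hS.skew hx Y (e i)
    rw [hg] at h2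
    rw [← neg_eq_iff_eq_neg.mpr h2]
    ring
  simp only [h1, Finset.sum_add_distrib, ← Finset.mul_sum, he.sum_inner_mul_inner]
  simp only [hS.compatible x hx, ← hS.η_eq x hx, hZ, hS.η_ξ x hx, Finset.sum_const, Finset.card_univ,
    Fintype.card_fin, hdim, nsmul_eq_mul]
  push_cast
  ring

end SasakianSpaceForm

section Charts

variable {E : Type*} [NormedAddCommGroup E] [NormedSpace ℝ E]
  {H : Type*} [TopologicalSpace H] {I : ModelWithCorners ℝ E H}
  {M : Type*} [TopologicalSpace M] [ChartedSpace H M]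

theorem localMetric_apply (g : ∀ p : M, TangentSpace I p →L[ℝ] TangentSpace I p →L[ℝ] ℝ) (p₀ : M) (x u v : E) :
    localMetric I g p₀ x u v
      = g ((extChartAt I p₀).symm x) (fromCoord I p₀ x u) (fromCoord I p₀ x v) :=
  rfl

section One

variable [IsManifold I 1 M] {p₀ : M} {x : E}

theorem toCoord_fromCoord (hx : x ∈ (extChartAt I p₀).target) (u : E) :
    toCoord I p₀ x (fromCoord I p₀ x u) = u :=
  DFunLike.congr_fun (mfderiv_extChartAt_comp_mfderivWithin_extChartAt_symm hx) u

theorem fromCoord_toCoord (hx : x ∈ (extChartAt I p₀).target)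
    (u : TangentSpace I ((extChartAt I p₀).symm x)) :
    fromCoord I p₀ x (toCoord I p₀ x u) = u :=
  DFunLike.congr_fun (mfderivWithin_extChartAt_symm_comp_mfderiv_extChartAt hx) u

theorem trivializationAt_snd (hx : x ∈ (extChartAt I p₀).target)
    (u : TangentSpace I ((extChartAt I p₀).symm x)) :
    (trivializationAt E (TangentSpace I) p₀ ⟨(extChartAt I p₀).symm x, u⟩).2
      = toCoord I p₀ x u := by
  have h : (extChartAt I p₀).symm x ∈ (chartAt H p₀).source := by
    rw [← extChartAt_source (I := I)]
    exact (extChartAt I p₀).map_target hx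
  have h' := DFunLike.congr_fun
    (TangentBundle.continuousLinearMapAt_trivializationAt (𝕜 := ℝ) (I := I) h) u
  refine Eq.trans ?_ h'
  rw [Trivialization.continuousLinearMapAt_apply, Trivialization.coe_linearMapAt_of_mem]
  simpa using h

end One

variable [IsManifold I ∞ M] {p₀ : M} {x : E}

section Smooth

variable [I.Boundaryless]

theorem contMDiffAt_extChartAt_symm (hx : x ∈ (extChartAt I p₀).target) :
    ContMDiffAt 𝓘(ℝ, E) I ∞ (extChartAt I p₀).symm x :=
  (contMDiffOn_extChartAt_symm p₀).contMDiffAt ((isOpen_extChartAt_target p₀).mem_nhds hx)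

theorem contMDiffAt_fromCoord (hx : x ∈ (extChartAt I p₀).target) (u : E) :
    ContMDiffAt 𝓘(ℝ, E) (I.prod 𝓘(ℝ, E)) ∞
      (fun y => TotalSpace.mk' E (E := fun p : M => TangentSpace I p)
        ((extChartAt I p₀).symm y) (fromCoord I p₀ y u)) x := by
  rw [(trivializationAt E (TangentSpace I) p₀).contMDiffAt_iff]
  · refine ⟨contMDiffAt_extChartAt_symm hx, ?_⟩
    refine (contMDiffAt_const (c := u)).congr_of_eventuallyEq ?_
    filter_upwards [(isOpen_extChartAt_target p₀).mem_nhds hx] with y hy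
    rw [trivializationAt_snd hy, toCoord_fromCoord hy]
  · rw [Trivialization.mem_source]
    have := (extChartAt I p₀).map_target hx
    simpa using this

theorem contDiffAt_toCoord {v : ∀ y : E, TangentSpace I ((extChartAt I p₀).symm y)}
    (hx : x ∈ (extChartAt I p₀).target)
    (hv : ContMDiffAt 𝓘(ℝ, E) (I.prod 𝓘(ℝ, E)) ∞
      (fun y => TotalSpace.mk' E (E := fun p : M => TangentSpace I p)
        ((extChartAt I p₀).symm y) (v y)) x) :
    ContDiffAt ℝ ∞ (fun y => toCoord I p₀ y (v y)) x := by
  rw [(trivializationAt E (TangentSpace I) p₀).contMDiffAt_iff] at hv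
  · rw [← contMDiffAt_iff_contDiffAt]
    refine hv.2.congr_of_eventuallyEq ?_
    filter_upwards [(isOpen_extChartAt_target p₀).mem_nhds hx] with y hy
    rw [← trivializationAt_snd hy]
  · rw [Trivialization.mem_source]
    have := (extChartAt I p₀).map_target hx
    simpa using this

theorem contDiffAt_localVec {ξ : ∀ p : M, TangentSpace I p}
    (hξ : ContMDiff I (I.prod 𝓘(ℝ, E)) ∞ (fun p => TotalSpace.mk' E p (ξ p)))
    (hx : x ∈ (extChartAt I p₀).target) :
    ContDiffAt ℝ ∞ (localVec I ξ p₀) x :=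
  contDiffAt_toCoord hx
    (ContMDiffAt.comp x (hξ.contMDiffAt) (contMDiffAt_extChartAt_symm hx))

theorem contDiffAt_localEnd [FiniteDimensional ℝ E]
    {φ : ∀ p : M, TangentSpace I p →L[ℝ] TangentSpace I p}
    (hφ : ContMDiff I (I.prod 𝓘(ℝ, E →L[ℝ] E)) ∞ (fun p => TotalSpace.mk' (E →L[ℝ] E) p (φ p)))
    (hx : x ∈ (extChartAt I p₀).target) :
    ContDiffAt ℝ ∞ (localEnd I φ p₀) x := by
  refine contDiffAt_of_apply (isOpen_extChartAt_target p₀) (fun u y hy => ?_) hx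
  refine contDiffAt_toCoord (v := fun y => φ _ (fromCoord I p₀ y u)) hy ?_
  exact ContMDiffAt.clm_bundle_apply
    (ContMDiffAt.comp y hφ.contMDiffAt (contMDiffAt_extChartAt_symm hy))
    (contMDiffAt_fromCoord hy u)

theorem contDiffAt_localForm [FiniteDimensional ℝ E]
    {η : ∀ p : M, TangentSpace I p →L[ℝ] ℝ}
    (hη : ContMDiff I (I.prod 𝓘(ℝ, E →L[ℝ] ℝ)) ∞ (fun p => TotalSpace.mk' (E →L[ℝ] ℝ) p (η p)))
    (hx : x ∈ (extChartAt I p₀).target) :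
    ContDiffAt ℝ ∞ (localForm I η p₀) x := by
  refine contDiffAt_of_apply (isOpen_extChartAt_target p₀) (fun u y hy => ?_) hx
  have h := ContMDiffAt.clm_bundle_apply (F₁ := E) (F₂ := ℝ)
    (E₁ := fun p : M => TangentSpace I p) (E₂ := Bundle.Trivial M ℝ)
    (b := (extChartAt I p₀).symm) (ϕ := fun y => η ((extChartAt I p₀).symm y))
    (ContMDiffAt.comp y hη.contMDiffAt (contMDiffAt_extChartAt_symm hy))
    (contMDiffAt_fromCoord hy u)
  rw [contMDiffAt_totalSpace] at h
  exact contMDiffAt_iff_contDiffAt.1 h.2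

theorem contDiffAt_localMetric [FiniteDimensional ℝ E]
    {g : ∀ p : M, TangentSpace I p →L[ℝ] TangentSpace I p →L[ℝ] ℝ}
    (hg : ContMDiff I (I.prod 𝓘(ℝ, E →L[ℝ] E →L[ℝ] ℝ)) ∞
        (fun p => TotalSpace.mk' (E →L[ℝ] E →L[ℝ] ℝ) p (g p)))
    (hx : x ∈ (extChartAt I p₀).target) :
    ContDiffAt ℝ ∞ (localMetric I g p₀) x := by
  refine contDiffAt_of_apply₂ (isOpen_extChartAt_target p₀) (fun u v y hy => ?_) hx
  have h := ContMDiffAt.clm_bundle_apply₂ (F₁ := E) (F₂ := E) (F₃ := ℝ)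
    (E₁ := fun p : M => TangentSpace I p) (E₂ := fun p : M => TangentSpace I p)
    (E₃ := Bundle.Trivial M ℝ)
    (b := (extChartAt I p₀).symm) (ψ := fun y => g ((extChartAt I p₀).symm y))
    (ContMDiffAt.comp y hg.contMDiffAt (contMDiffAt_extChartAt_symm hy))
    (contMDiffAt_fromCoord hy u) (contMDiffAt_fromCoord hy v)
  rw [contMDiffAt_totalSpace] at h
  exact contMDiffAt_iff_contDiffAt.1 h.2

end Smooth

end Charts

section Metric

variable {E : Type*} [NormedAddCommGroup E] [NormedSpace ℝ E] [FiniteDimensional ℝ E]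
  {H : Type*} [TopologicalSpace H] {I : ModelWithCorners ℝ E H} [I.Boundaryless]
  {M : Type*} [TopologicalSpace M] [ChartedSpace H M] [IsManifold I ∞ M]

theorem isMetricOn_localMetric
    (g : ContMDiffRiemannianMetric I ∞ E (fun p : M => TangentSpace I p)) (p₀ : M) :
    IsMetricOn (localMetric I g.inner p₀) (extChartAt I p₀).target where
  isOpen := isOpen_extChartAt_target p₀
  smooth _ hx := contDiffAt_localMetric g.contMDiff hx
  symm _ _ _ _ := g.symm _ _ _
  pos x hx u hu := by
    refine g.pos _ _ fun h => hu ?_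
    rw [← toCoord_fromCoord hx u]
    exact (congrArg (toCoord I p₀ x) h).trans (map_zero _)

end Metric

theorem IsSasakian.isSasakianOn {d : ℕ} {M : Type*} [TopologicalSpace M]
    [ChartedSpace (EuclideanSpace ℝ (Fin d)) M] [IsManifold (𝓡 d) ∞ M]
    {g : ContMDiffRiemannianMetric (𝓡 d) ∞ (EuclideanSpace ℝ (Fin d))
      (fun p : M => TangentSpace (𝓡 d) p)}
    {φ : ∀ p : M, TangentSpace (𝓡 d) p →L[ℝ] TangentSpace (𝓡 d) p}
    {ξ : ∀ p : M, TangentSpace (𝓡 d) p} {η : ∀ p : M, TangentSpace (𝓡 d) p →L[ℝ] ℝ}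
    (hS : IsSasakian g φ ξ η) (p₀ : M) :
    IsSasakianOn (localMetric (𝓡 d) g.inner p₀) (localEnd (𝓡 d) φ p₀) (localVec (𝓡 d) ξ p₀)
      (localForm (𝓡 d) η p₀) (extChartAt (𝓡 d) p₀).target where
  metric := isMetricOn_localMetric g p₀
  smooth_φ _ hx := contDiffAt_localEnd hS.smooth_φ hx
  smooth_ξ _ hx := contDiffAt_localVec hS.smooth_ξ hx
  smooth_η _ hx := contDiffAt_localForm hS.smooth_η hx
  φ_sq x hx u := by
    simp only [localEnd, localForm, localVec, ContinuousLinearMap.comp_apply,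
      fromCoord_toCoord hx, hS.φ_sq, map_add, map_neg, map_smul, toCoord_fromCoord hx]
  η_ξ x hx := by
    simp only [localForm, localVec, ContinuousLinearMap.comp_apply, fromCoord_toCoord hx, hS.η_ξ]
  η_φ x hx u := by
    simp only [localForm, localEnd, ContinuousLinearMap.comp_apply, fromCoord_toCoord hx, hS.η_φ]
  η_eq x hx u := by
    simp only [localForm, localVec, localMetric_apply, ContinuousLinearMap.comp_apply,
      fromCoord_toCoord hx, hS.η_eq]
  compatible x hx u v := by
    simp only [localForm, localEnd, localMetric_apply, ContinuousLinearMap.comp_apply,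
      fromCoord_toCoord hx, hS.compatible]
  contact := hS.contact p₀
  normal := hS.normal p₀

section Warped

variable {E₁ : Type*} [NormedAddCommGroup E₁] [NormedSpace ℝ E₁]
  {H₁ : Type*} [TopologicalSpace H₁] {I₁ : ModelWithCorners ℝ E₁ H₁}
  {M₁ : Type*} [TopologicalSpace M₁] [ChartedSpace H₁ M₁]
  {E₂ : Type*} [NormedAddCommGroup E₂] [NormedSpace ℝ E₂]
  {H₂ : Type*} [TopologicalSpace H₂] {I₂ : ModelWithCorners ℝ E₂ H₂}
  {M₂ : Type*} [TopologicalSpace M₂] [ChartedSpace H₂ M₂]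

theorem warpedMetric_apply (g₁ : ∀ p : M₁, TangentSpace I₁ p →L[ℝ] TangentSpace I₁ p →L[ℝ] ℝ)
    (g₂ : ∀ p : M₂, TangentSpace I₂ p →L[ℝ] TangentSpace I₂ p →L[ℝ] ℝ) (f : M₁ → ℝ)
    (z : M₁ × M₂) (u v : TangentSpace (I₁.prod I₂) z) :
    warpedMetric I₁ I₂ g₁ g₂ f z u v
      = g₁ z.1 u.1 v.1 + f z.1 ^ 2 * g₂ z.2 u.2 v.2 := by
  simp only [warpedMetric, mfderiv_fst, mfderiv_snd]
  rfl

theorem fromCoord_prod [IsManifold I₁ 1 M₁] [IsManifold I₂ 1 M₂] {q₀ : M₁ × M₂} {z : E₁ × E₂}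
    (hz : z ∈ (extChartAt (I₁.prod I₂) q₀).target) (u : E₁ × E₂) :
    (fromCoord (I₁.prod I₂) q₀ z u : E₁ × E₂)
      = ((fromCoord I₁ q₀.1 z.1 u.1 : E₁), (fromCoord I₂ q₀.2 z.2 u.2 : E₂)) := by
  rw [extChartAt_prod, PartialEquiv.prod_target] at hz
  have h := mfderivWithin_prodMap (p := z)
    (mdifferentiableWithinAt_extChartAt_symm (I := I₁) hz.1)
    (mdifferentiableWithinAt_extChartAt_symm (I := I₂) hz.2)
    (I₁.uniqueMDiffOn _ (extChartAt_target_subset_range _ hz.1))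
    (I₂.uniqueMDiffOn _ (extChartAt_target_subset_range _ hz.2))
  rw [← modelWithCornersSelf_prod, chartedSpaceSelf_prod, ← ModelWithCorners.range_prod] at h
  exact DFunLike.congr_fun h u

theorem isWarpedOn_localMetric [FiniteDimensional ℝ E₁] [FiniteDimensional ℝ E₂]
    [I₁.Boundaryless] [IsManifold I₁ ∞ M₁] [I₂.Boundaryless] [IsManifold I₂ ∞ M₂]
    (g₁ : ContMDiffRiemannianMetric I₁ ∞ E₁ (fun p : M₁ => TangentSpace I₁ p))
    (g₂ : ContMDiffRiemannianMetric I₂ ∞ E₂ (fun p : M₂ => TangentSpace I₂ p))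
    {f : M₁ → ℝ} (hf : ContMDiff I₁ 𝓘(ℝ, ℝ) ∞ f) (hf_pos : ∀ p, 0 < f p) (q₀ : M₁ × M₂) :
    IsWarpedOn (localMetric (I₁.prod I₂) (warpedMetric I₁ I₂ g₁.inner g₂.inner f) q₀)
      (localMetric I₁ g₁.inner q₀.1) (localMetric I₂ g₂.inner q₀.2)
      (fun y => f ((extChartAt I₁ q₀.1).symm y))
      (extChartAt I₁ q₀.1).target (extChartAt I₂ q₀.2).target where
  metric₁ := isMetricOn_localMetric g₁ q₀.1
  metric₂ := isMetricOn_localMetric g₂ q₀.2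
  smooth x hx := contMDiffAt_iff_contDiffAt.1
    (ContMDiffAt.comp x hf.contMDiffAt (contMDiffAt_extChartAt_symm hx))
  pos _ _ := hf_pos _
  apply z hz u v := by
    have hz' : z ∈ (extChartAt (I₁.prod I₂) q₀).target := by
      rwa [extChartAt_prod, PartialEquiv.prod_target]
    rw [localMetric_apply, warpedMetric_apply, fromCoord_prod hz', fromCoord_prod hz']
    rfl

end Warped

section Maps

variable {E : Type*} [NormedAddCommGroup E] [NormedSpace ℝ E]
  {H : Type*} [TopologicalSpace H] {I : ModelWithCorners ℝ E H}
  {M : Type*} [TopologicalSpace M] [ChartedSpace H M]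
  {E' : Type*} [NormedAddCommGroup E'] [NormedSpace ℝ E']
  {H' : Type*} [TopologicalSpace H'] {I' : ModelWithCorners ℝ E' H'}
  {N : Type*} [TopologicalSpace N] [ChartedSpace H' N]
  {ψ : M → N} {p₀ : M} {x : E}

theorem mapsTo_writtenInExtChartAt (hx : x ∈ localDomain I I' ψ p₀) :
    writtenInExtChartAt I I' p₀ ψ x ∈ (extChartAt I' (ψ p₀)).target :=
  (extChartAt I' (ψ p₀)).map_source hx.2

theorem extChartAt_symm_writtenInExtChartAt (hx : x ∈ localDomain I I' ψ p₀) :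
    (extChartAt I' (ψ p₀)).symm (writtenInExtChartAt I I' p₀ ψ x)
      = ψ ((extChartAt I p₀).symm x) :=
  (extChartAt I' (ψ p₀)).left_inv hx.2

theorem isOpen_localDomain [I.Boundaryless] (hψ : Continuous ψ) : IsOpen (localDomain I I' ψ p₀) :=
  (continuousOn_extChartAt_symm p₀).isOpen_inter_preimage (isOpen_extChartAt_target p₀)
    ((isOpen_extChartAt_source (ψ p₀)).preimage hψ)

theorem mem_localDomain_self (ψ : M → N) (p₀ : M) :
    extChartAt I p₀ p₀ ∈ localDomain I I' ψ p₀ := by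
  refine ⟨mem_extChartAt_target p₀, ?_⟩
  simp

theorem contDiffAt_writtenInExtChartAt [I.Boundaryless] [IsManifold I ∞ M]
    [IsManifold I' ∞ N] (hψ : ContMDiff I I' ∞ ψ)
    (hx : x ∈ localDomain I I' ψ p₀) : ContDiffAt ℝ ∞ (writtenInExtChartAt I I' p₀ ψ) x := by
  rw [← contMDiffAt_iff_contDiffAt]
  exact ContMDiffAt.comp x (contMDiffAt_extChartAt' (by simpa using hx.2))
    (ContMDiffAt.comp x hψ.contMDiffAt (contMDiffAt_extChartAt_symm hx.1))

theorem fromCoord_fderiv_writtenInExtChartAt [I.Boundaryless] [IsManifold I ∞ M]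
    [I'.Boundaryless] [IsManifold I' ∞ N] (hψ : ContMDiff I I' ∞ ψ)
    (hx : x ∈ localDomain I I' ψ p₀) (u : E) :
    (fromCoord I' (ψ p₀) (writtenInExtChartAt I I' p₀ ψ x)
        (fderiv ℝ (writtenInExtChartAt I I' p₀ ψ) x u) : E')
      = (mfderiv I I' ψ ((extChartAt I p₀).symm x) (fromCoord I p₀ x u) : E') := by
  have hx' := mapsTo_writtenInExtChartAt hx
  have h : (extChartAt I' (ψ p₀)).symm ∘ writtenInExtChartAt I I' p₀ ψ
      =ᶠ[nhds x] ψ ∘ (extChartAt I p₀).symm := by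
    filter_upwards [(isOpen_localDomain hψ.continuous).mem_nhds hx] with y hy
    exact extChartAt_symm_writtenInExtChartAt hy
  have h' := h.mfderiv_eq (I := 𝓘(ℝ, E)) (I' := I')
  rw [mfderiv_comp x ((contMDiffAt_extChartAt_symm hx').mdifferentiableAt (by simp))
      ((contDiffAt_writtenInExtChartAt hψ hx).differentiableAt (by simp)).mdifferentiableAt,
    mfderiv_comp x (hψ.contMDiffAt.mdifferentiableAt (by simp))
      ((contMDiffAt_extChartAt_symm hx.1).mdifferentiableAt (by simp)),
    mfderiv_eq_fderiv] at h'
  simp only [fromCoord, ModelWithCorners.range_eq_univ, mfderivWithin_univ]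
  exact DFunLike.congr_fun h' u

theorem apply_eq_of_eq (G : ∀ q : N, TangentSpace I' q →L[ℝ] TangentSpace I' q →L[ℝ] ℝ) {q q' : N}
    (h : q = q') (u v : E') :
    (G q : E' →L[ℝ] E' →L[ℝ] ℝ) u v = (G q' : E' →L[ℝ] E' →L[ℝ] ℝ) u v := by
  subst h
  rfl

end Maps

theorem IsIsometricImmersion.isIsometricOn {d : ℕ} {M : Type*} [TopologicalSpace M]
    [ChartedSpace (EuclideanSpace ℝ (Fin d)) M] [IsManifold (𝓡 d) ∞ M]
    {E' : Type*} [NormedAddCommGroup E'] [NormedSpace ℝ E']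
    {H' : Type*} [TopologicalSpace H'] {I' : ModelWithCorners ℝ E' H'} [I'.Boundaryless]
    {N : Type*} [TopologicalSpace N] [ChartedSpace H' N] [IsManifold I' ∞ N]
    {g : ContMDiffRiemannianMetric (𝓡 d) ∞ (EuclideanSpace ℝ (Fin d))
      (fun p : M => TangentSpace (𝓡 d) p)}
    {G : ∀ q : N, TangentSpace I' q →L[ℝ] TangentSpace I' q →L[ℝ] ℝ} {ψ : M → N}
    (hψ : IsIsometricImmersion I' g.inner G ψ) (p₀ : M)
    (hG : IsMetricOn (localMetric I' G (ψ p₀)) (extChartAt I' (ψ p₀)).target) :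
    IsIsometricOn (localMetric (𝓡 d) g.inner p₀) (localMetric I' G (ψ p₀))
      (writtenInExtChartAt (𝓡 d) I' p₀ ψ) (localDomain (𝓡 d) I' ψ p₀)
      (extChartAt I' (ψ p₀)).target where
  source := by
    have h := isMetricOn_localMetric g p₀
    exact ⟨isOpen_localDomain hψ.smooth.continuous, fun x hx => h.smooth x hx.1,
      fun x hx => h.symm x hx.1, fun x hx => h.pos x hx.1⟩
  target := hG
  smooth _ hx := contDiffAt_writtenInExtChartAt hψ.smooth hx
  mapsTo _ hx := mapsTo_writtenInExtChartAt hx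
  isometric x hx u v := by
    rw [localMetric_apply, localMetric_apply, ← hψ.isometric]
    refine (apply_eq_of_eq G (extChartAt_symm_writtenInExtChartAt hx) _ _).trans ?_
    rw [fromCoord_fderiv_writtenInExtChartAt hψ.smooth hx,
      fromCoord_fderiv_writtenInExtChartAt hψ.smooth hx]

theorem IsMetricOn.nonneg {F : Type*} [NormedAddCommGroup F] [NormedSpace ℝ F]
    {G : F → F →L[ℝ] F →L[ℝ] ℝ} {V : Set F} (hG : IsMetricOn G V) {x : F} (hx : x ∈ V) (u : F) :
    0 ≤ G x u u := by
  rcases eq_or_ne u 0 with rfl | hu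
  · simp
  · exact (hG.pos x hx u hu).le

/-- In coordinates, the characterization of biharmonic hypersurfaces tangent to the Reeb field, with
horizontal mean curvature vector of constant length, in a warped product whose base is a Sasakian
space form. -/
theorem IsIsometricOn.bitension_eq_zero_iff_of_warped {d m : ℕ}
    {E₁ E₂ : Type*} [NormedAddCommGroup E₁] [NormedSpace ℝ E₁] [FiniteDimensional ℝ E₁]
    [NormedAddCommGroup E₂] [NormedSpace ℝ E₂] [FiniteDimensional ℝ E₂]
    {G₁ : E₁ → E₁ →L[ℝ] E₁ →L[ℝ] ℝ} {G₂ : E₂ → E₂ →L[ℝ] E₂ →L[ℝ] ℝ} {f : E₁ → ℝ}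
    {G : E₁ × E₂ → (E₁ × E₂) →L[ℝ] (E₁ × E₂) →L[ℝ] ℝ} {V₁ : Set E₁} {V₂ : Set E₂}
    {φ : E₁ → E₁ →L[ℝ] E₁} {ξ : E₁ → E₁} {η : E₁ → E₁ →L[ℝ] ℝ} {c h : ℝ}
    {g : EuclideanSpace ℝ (Fin d) →
      EuclideanSpace ℝ (Fin d) →L[ℝ] EuclideanSpace ℝ (Fin d) →L[ℝ] ℝ}
    {ψ : EuclideanSpace ℝ (Fin d) → E₁ × E₂} {U : Set (EuclideanSpace ℝ (Fin d))}
    {x : EuclideanSpace ℝ (Fin d)}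
    (hψ : IsIsometricOn g G ψ U (V₁ ×ˢ V₂)) (hw : IsWarpedOn G G₁ G₂ f V₁ V₂)
    (hS : IsSasakianOn G₁ φ ξ η V₁)
    (hc : ∀ y ∈ V₁, ∀ u, u ≠ 0 → η y u = 0 → sectionalCurvature G₁ y u (φ y u) = c)
    (hm : Module.finrank ℝ E₁ = 2 * m + 1) (hdim : Module.finrank ℝ (E₁ × E₂) = d + 1)
    (hd : d ≠ 0) (hh : h ≠ 0)
    (hn : ∀ y ∈ U, G (ψ y) (meanCurvature g G ψ y) (meanCurvature g G ψ y) = h ^ 2)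
    (hx : x ∈ U) (hhor : (meanCurvature g G ψ x).2 = 0)
    (htan : ∃ u, fderiv ℝ ψ x u = (ξ (ψ x).1, 0)) :
    bitension g G ψ x = 0 ↔
      normSqSecondFundamentalForm g G ψ x • meanCurvature g G ψ x
        = ((c * (m + 1) + 3 * m - 1) / 2) • meanCurvature g G ψ x
          - (Module.finrank ℝ E₂ / f (ψ x).1) •
            covDeriv G id (gradient G (fun y => f y.1)) (ψ x) (meanCurvature g G ψ x) := by
  have hz := hψ.mapsTo x hx
  rw [hψ.bitension_eq_zero_iff hdim hd hh hn hx]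
  obtain ⟨u, hu⟩ := htan
  have hnormal := hψ.meanCurvature_normal hx u
  generalize meanCurvature g G ψ x = K at *
  obtain ⟨X, X'⟩ := K
  obtain rfl : X' = 0 := hhor
  have hη : η (ψ x).1 X = 0 := by
    rw [hu, hw.apply _ hz] at hnormal
    simpa [hS.η_eq _ hz.1, hw.metric₁.symm _ hz.1] using hnormal
  have key : ∀ Z, ricci G (ψ x) Z (X, 0) = G (ψ x) (((c * (m + 1) + 3 * m - 1) / 2) • (X, 0)
      - (Module.finrank ℝ E₂ / f (ψ x).1) •
        covDeriv G id (gradient G (fun y => f y.1)) (ψ x) (X, 0)) Z := by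
    intro Z
    rw [hw.ricci_horizontal hz, hS.ricci_eq hz.1 hm (hc _ hz.1) _ hη, map_sub, map_smul, map_smul,
      _root_.sub_apply, _root_.smul_apply, _root_.smul_apply, hw.inner_covDeriv_gradient hz,
      hw.apply _ hz]
    simp
  constructor
  · intro H
    refine hψ.target.eq_of_forall_inner hz fun Z => ?_
    rw [← key, H, map_smul, _root_.smul_apply, smul_eq_mul]
  · intro H Z
    rw [key, ← H, map_smul, _root_.smul_apply, smul_eq_mul]

theorem IsTangentTo.exists_fderiv_eq {d d₁ d₂ : ℕ} {M : Type*} [TopologicalSpace M]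
    [ChartedSpace (EuclideanSpace ℝ (Fin d)) M] [IsManifold (𝓡 d) ∞ M]
    {M₁ : Type*} [TopologicalSpace M₁] [ChartedSpace (EuclideanSpace ℝ (Fin d₁)) M₁]
    [IsManifold (𝓡 d₁) ∞ M₁]
    {M₂ : Type*} [TopologicalSpace M₂] [ChartedSpace (EuclideanSpace ℝ (Fin d₂)) M₂]
    [IsManifold (𝓡 d₂) ∞ M₂]
    {ξ : ∀ p : M₁, TangentSpace (𝓡 d₁) p} {ψ : M → M₁ × M₂}
    (hξ : IsTangentTo (d := d) (d₂ := d₂) ξ ψ)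
    (hψ : ContMDiff (𝓡 d) ((𝓡 d₁).prod (𝓡 d₂)) ∞ ψ) {p₀ : M} {x : EuclideanSpace ℝ (Fin d)}
    (hx : x ∈ localDomain (𝓡 d) ((𝓡 d₁).prod (𝓡 d₂)) ψ p₀) :
    ∃ u, fderiv ℝ (writtenInExtChartAt (𝓡 d) ((𝓡 d₁).prod (𝓡 d₂)) p₀ ψ) x u
      = (localVec (𝓡 d₁) ξ (ψ p₀).1
          (writtenInExtChartAt (𝓡 d) ((𝓡 d₁).prod (𝓡 d₂)) p₀ ψ x).1, 0) := by
  obtain ⟨u, hu₁, hu₂⟩ := hξ ((extChartAt (𝓡 d) p₀).symm x)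
  have hz := mapsTo_writtenInExtChartAt hx
  have hz' := hz
  rw [extChartAt_prod, PartialEquiv.prod_target] at hz'
  refine ⟨toCoord (𝓡 d) p₀ x u, ?_⟩
  have h := fromCoord_fderiv_writtenInExtChartAt hψ hx (toCoord (𝓡 d) p₀ x u)
  rw [fromCoord_toCoord hx.1, fromCoord_prod hz] at h
  rw [mfderiv_fst] at hu₁
  rw [mfderiv_snd] at hu₂
  have hq := extChartAt_symm_writtenInExtChartAt hx
  have h₁ := (congrArg Prod.fst h).trans hu₁
  have h₂ := (congrArg Prod.snd h).trans hu₂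
  refine Prod.ext ?_ ?_
  · have hξ' : ∀ q q' : M₁, q = q' → (ξ q : EuclideanSpace ℝ (Fin d₁)) = ξ q' := by
      rintro q _ rfl
      rfl
    have h₃ := h₁.trans (hξ' _ _ (congrArg Prod.fst hq.symm))
    exact (toCoord_fromCoord hz'.1 _).symm.trans (congrArg (toCoord (𝓡 d₁) (ψ p₀).1 _) h₃)
  · exact (toCoord_fromCoord hz'.2 _).symm.trans
      ((congrArg (toCoord (𝓡 d₂) (ψ p₀).2 _) h₂).trans (map_zero _))

end WarpedBiharmonic

end

theorem mainTheorem2 (m n : ℕ)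
    {M : Type*} [TopologicalSpace M] [ChartedSpace (EuclideanSpace ℝ (Fin (2 * (m + n)))) M]
    [IsManifold (𝓡 (2 * (m + n))) ∞ M] [Nonempty M]
    {M₁ : Type*} [TopologicalSpace M₁] [ChartedSpace (EuclideanSpace ℝ (Fin (2 * m + 1))) M₁]
    [IsManifold (𝓡 (2 * m + 1)) ∞ M₁]
    {M₂ : Type*} [TopologicalSpace M₂] [ChartedSpace (EuclideanSpace ℝ (Fin (2 * n))) M₂]
    [IsManifold (𝓡 (2 * n)) ∞ M₂]
    (g : ContMDiffRiemannianMetric (𝓡 (2 * (m + n))) ∞ (EuclideanSpace ℝ (Fin (2 * (m + n))))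
      (fun p : M => TangentSpace (𝓡 (2 * (m + n))) p))
    (g₁ : ContMDiffRiemannianMetric (𝓡 (2 * m + 1)) ∞ (EuclideanSpace ℝ (Fin (2 * m + 1)))
      (fun p : M₁ => TangentSpace (𝓡 (2 * m + 1)) p))
    (g₂ : ContMDiffRiemannianMetric (𝓡 (2 * n)) ∞ (EuclideanSpace ℝ (Fin (2 * n)))
      (fun p : M₂ => TangentSpace (𝓡 (2 * n)) p))
    (φ : ∀ p : M₁, TangentSpace (𝓡 (2 * m + 1)) p →L[ℝ] TangentSpace (𝓡 (2 * m + 1)) p)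
    (ξ : ∀ p : M₁, TangentSpace (𝓡 (2 * m + 1)) p)
    (η : ∀ p : M₁, TangentSpace (𝓡 (2 * m + 1)) p →L[ℝ] ℝ) (c : ℝ)
    (hM₁ : WarpedBiharmonic.IsSasakianSpaceForm g₁ φ ξ η c)
    (J : ∀ p : M₂, TangentSpace (𝓡 (2 * n)) p →L[ℝ] TangentSpace (𝓡 (2 * n)) p) (k : ℝ)
    (hM₂ : WarpedBiharmonic.IsComplexSpaceForm g₂ J k)
    (f : M₁ → ℝ) (hf : ContMDiff (𝓡 (2 * m + 1)) 𝓘(ℝ, ℝ) ∞ f) (hf_pos : ∀ p, 0 < f p)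
    (G : ∀ z : M₁ × M₂, TangentSpace ((𝓡 (2 * m + 1)).prod (𝓡 (2 * n))) z →L[ℝ]
      TangentSpace ((𝓡 (2 * m + 1)).prod (𝓡 (2 * n))) z →L[ℝ] ℝ)
    (hG : G = WarpedBiharmonic.warpedMetric (𝓡 (2 * m + 1)) (𝓡 (2 * n)) g₁.inner g₂.inner f)
    (ψ : M → M₁ × M₂)
    (hψ : WarpedBiharmonic.IsIsometricImmersion ((𝓡 (2 * m + 1)).prod (𝓡 (2 * n))) g.inner G ψ)
    (hξ : WarpedBiharmonic.IsTangentTo (d := 2 * (m + n)) (d₂ := 2 * n) ξ ψ)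
    (hH : WarpedBiharmonic.HasHorizontalMeanCurvature g.inner G ψ)
    (h : ℝ) (hh : h ≠ 0)
    (hCMC : WarpedBiharmonic.HasConstantMeanCurvature ((𝓡 (2 * m + 1)).prod (𝓡 (2 * n)))
      g.inner G ψ h) :
    WarpedBiharmonic.IsProperBiharmonic ((𝓡 (2 * m + 1)).prod (𝓡 (2 * n))) g.inner G ψ ↔
      ∀ p₀ : M, ∀ x ∈ WarpedBiharmonic.localDomain (𝓡 (2 * (m + n)))
          ((𝓡 (2 * m + 1)).prod (𝓡 (2 * n))) ψ p₀,
        WarpedBiharmonic.normSqBAt ((𝓡 (2 * m + 1)).prod (𝓡 (2 * n))) g.inner G ψ p₀ x •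
            WarpedBiharmonic.meanCurvatureAt ((𝓡 (2 * m + 1)).prod (𝓡 (2 * n)))
              g.inner G ψ p₀ x
          = ((c * (m + 1) + 3 * m - 1) / 2) •
              WarpedBiharmonic.meanCurvatureAt ((𝓡 (2 * m + 1)).prod (𝓡 (2 * n)))
                g.inner G ψ p₀ x
            - (2 * n / f (ψ ((extChartAt (𝓡 (2 * (m + n))) p₀).symm x)).1) •
              WarpedBiharmonic.covDerivGradAlongH ((𝓡 (2 * m + 1)).prod (𝓡 (2 * n)))
                g.inner G ψ (fun z => f z.1) p₀ x := by
  subst hG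
  have hw := fun p₀ : M => WarpedBiharmonic.isWarpedOn_localMetric g₁ g₂ hf hf_pos (ψ p₀)
  have hiso := fun p₀ : M => hψ.isIsometricOn p₀ (by
    have h := (hw p₀).isMetricOn
    rwa [← PartialEquiv.prod_target, ← extChartAt_prod] at h)
  have hd : 2 * (m + n) ≠ 0 := by
    intro hd
    obtain ⟨p₀⟩ := ‹Nonempty M›
    refine hh ((hCMC p₀ _ (WarpedBiharmonic.mem_localDomain_self ψ p₀)).symm.trans ?_)
    have hd' : ((2 * (m + n) : ℕ) : ℝ) = 0 := by rw [hd, Nat.cast_zero]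
    simp only [WarpedBiharmonic.meanCurvatureAt, WarpedBiharmonic.meanCurvature, hd', div_zero,
      zero_smul, map_zero, Real.sqrt_zero]
  have key : ∀ p₀ : M, ∀ x ∈ WarpedBiharmonic.localDomain (𝓡 (2 * (m + n)))
      ((𝓡 (2 * m + 1)).prod (𝓡 (2 * n))) ψ p₀, _ := fun p₀ x hx =>
    WarpedBiharmonic.IsIsometricOn.bitension_eq_zero_iff_of_warped (m := m) (c := c) (h := h)
      (U := WarpedBiharmonic.localDomain (𝓡 (2 * (m + n)))
        ((𝓡 (2 * m + 1)).prod (𝓡 (2 * n))) ψ p₀)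
      (by
        have := hiso p₀
        rwa [extChartAt_prod, PartialEquiv.prod_target] at this)
      (hw p₀) (hM₁.isSasakianOn (ψ p₀).1) (hM₁.φ_sectional (ψ p₀).1) (by simp)
      (by simp; ring) hd hh
      (fun y hy => by
        rw [← hCMC p₀ y hy,
          Real.sq_sqrt ((hiso p₀).target.nonneg ((hiso p₀).mapsTo y hy) _)]
        rfl)
      hx (hH p₀ x hx) (hξ.exists_fderiv_eq hψ.smooth hx)
  have hnot : ¬ WarpedBiharmonic.IsHarmonic ((𝓡 (2 * m + 1)).prod (𝓡 (2 * n))) g.inner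
      (WarpedBiharmonic.warpedMetric (𝓡 (2 * m + 1)) (𝓡 (2 * n)) g₁.inner g₂.inner f) ψ := by
    intro hharm
    obtain ⟨p₀⟩ := ‹Nonempty M›
    have hx := WarpedBiharmonic.mem_localDomain_self (I := 𝓡 (2 * (m + n)))
      (I' := (𝓡 (2 * m + 1)).prod (𝓡 (2 * n))) ψ p₀
    refine hh ((hCMC p₀ _ hx).symm.trans ?_)
    have h0 := hharm p₀ _ hx
    rw [WarpedBiharmonic.tension] at h0
    simp only [WarpedBiharmonic.meanCurvatureAt, WarpedBiharmonic.meanCurvature, h0,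
      smul_zero, map_zero, Real.sqrt_zero]
  rw [WarpedBiharmonic.IsProperBiharmonic, and_iff_left hnot]
  refine forall_congr' fun p₀ => forall₂_congr fun x hx => (key p₀ x hx).trans ?_
  have hpt := congrArg Prod.fst (WarpedBiharmonic.extChartAt_symm_writtenInExtChartAt hx)
  rw [← hpt, finrank_euclideanSpace_fin, Nat.cast_mul, Nat.cast_ofNat]
  rfl
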